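/- Identify $\mathbb R^2$ with $\mathbb C$, $\zeta=t_1+it_2=\rho e^{i\vartheta}$ with $\vartheta\in[0,2\pi)$, and set $\log\zeta=\log\rho+i\vartheta$, $\zeta^s=\rho^se^{is\vartheta}$. Let $0<\omega<2\pi$, let $\mathsf S_\omega=\{t: 0<\vartheta<\omega\}$ be the open sector of opening $\omega$, and fix a threshold $0<\delta_\omega<\tfrac12\min\{\omega,\pi\}$. Let $\mathsf A\subset\mathsf S_\omega$ be a bounded open set and $\rho_0>0$ such that $\mathscr B(0,\rho_0)\cap\mathsf A=\mathscr B(0,\rho_0)\cap\mathsf S_\omega$. Let $f\in L^2(\mathsf A)$ be real-valued and analytic near the vertex: there are $M_f>0$, $C$ and real $f_\alpha$ with $|f_\alpha|\le C M_f^{|\alpha|}$ and $f(t)=\sum_{\alpha\in\mathbb N^2}f_\alpha t_1^{\alpha_1}t_2^{\alpha_2}$ for (almost all) $t\in\mathscr B(0,M_f^{-1})\cap\mathsf A$. Let $u_0\in H^1_0(\mathsf A)$ be the (weak) solution of $\Delta u_0=f$ in $\mathsf A$, $u_0=0$ on $\partial\mathsf A$. Let $M_1>M_f$ and $\rho_1=\min\{\rho_0,M_1^{-1}\}$.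 With $\mathbb N_*=\{1,2,\dots\}$ and $\mathbb N^2_*=\mathbb N^2\setminus\{(0,0)\}$, let $\mathfrak A$ be the disjoint union $\mathbb N^2_*\cup\frac\pi\omega\mathbb N_*$, and put $|\gamma|=\alpha_1+\alpha_2$ for $\gamma=(\alpha_1,\alpha_2)\in\mathbb N^2_*$ and $|\gamma|=\gamma$ for $\gamma\in\frac\pi\omega\mathbb N_*$. Let $\mathfrak A_0$ be the set of the indices $(\ell,0)$, $\ell\in\mathbb N_*$, for which there is a (necessarily unique) $k\in\mathbb N_*$ with $|\ell\omega-k\pi|\le\delta_\omega$. Define 1. $\mathscr Z_\gamma(t)=\zeta^\gamma$ if $\gamma\in\frac\pi\omega\mathbb N_*$; 2. $\mathscr Z_\gamma(t)=\zeta^{\alpha_1}\bar\zeta^{\alpha_2}$ if $\gamma=(\alpha_1,\alpha_2)\in\mathbb N^2_*\setminus\mathfrak A_0$; 3. if $\gamma=(\ell,0)\in\mathfrak A_0$ with associated $k$: $\mathscr Z_\gamma(t)=\zeta^\ell\log\zeta$ if $\ell=\frac{k\pi}\omega$, and $\mathscr Z_\gamma(t)=\dfrac{\zeta^\ell-\zeta^{k\pi/\omega}}{\ell-k\pi/\omega}$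 if $\ell\ne\frac{k\pi}\omega$. Then there are coefficients $a_\gamma\in\mathbb C$, $\gamma\in\mathfrak A$, such that $$u_0(t)=\operatorname{Im}\sum_{\gamma\in\mathfrak A}a_\gamma\mathscr Z_\gamma(t),\qquad t\in\mathsf A\cap\mathscr B(0,\rho_1),$$ where the series converges unconditionally for every such $t$ and $u_0$ stands for its continuous representative on $\mathsf A\cap\mathscr B(0,\rho_1)$. Moreover, for every $M>\rho_1^{-1}$ there is a constant $C$ such that $|a_\gamma|\le C M^{|\gamma|}$ for all $\gamma\in\mathfrak A$, and $a_\gamma$ is real if $\gamma\in\frac\pi\omega\mathbb N_*$ or $\gamma=(\ell,0)$ with $\ell\in\mathbb N_*$. -/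

import Mathlib

open MeasureTheory Filter Topology
open scoped ComplexConjugate

noncomputable section

namespace CornerSeries

/-! The plane is identified with `ℂ`; the point `t = (t₁, t₂)` is the number `ζ = t₁ + i t₂`. -/

/-- The polar angle `ϑ` of a point of the plane, taken in `[0, 2π)`. -/
def angle (ζ : ℂ) : ℝ :=
  if ζ.arg < 0 then ζ.arg + 2 * Real.pi else ζ.arg

/-- The infinite open sector of opening `ω` (for `0 < ω < 2π`); it does not contain `0`,
since `angle 0 = 0`. -/
def sector (ω : ℝ) : Set ℂ :=
  {ζ | 0 < angle ζ ∧ angle ζ < ω}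

/-- The branch `log ζ = log ρ + i ϑ` of the logarithm, with `ϑ ∈ [0, 2π)`. -/
def sectorLog (ζ : ℂ) : ℂ :=
  (Real.log ‖ζ‖ : ℂ) + (angle ζ : ℂ) * Complex.I

/-- The power `ζ ^ s = ρ ^ s exp (i s ϑ)`, `ϑ ∈ [0, 2π)`, for a real exponent `s` and `ζ ≠ 0`. -/
def sectorPow (ζ : ℂ) (s : ℝ) : ℂ :=
  Complex.exp ((s : ℂ) * sectorLog ζ)

/-- First partial derivative `∂φ/∂t₁`. -/
def partial₁ (φ : ℂ → ℝ) (t : ℂ) : ℝ := fderiv ℝ φ t 1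

/-- Second partial derivative `∂φ/∂t₂`. -/
def partial₂ (φ : ℂ → ℝ) (t : ℂ) : ℝ := fderiv ℝ φ t Complex.I

/-- Test functions: real-valued smooth functions with compact support contained in `A`. -/
structure IsTestFunction (A : Set ℂ) (φ : ℂ → ℝ) : Prop where
  smooth : ContDiff ℝ ((⊤ : ℕ∞) : WithTop ℕ∞) φ
  compact : HasCompactSupport φ
  support_subset : tsupport φ ⊆ A

/-- `u` belongs to `H¹₀(A)`, the closure of the test functions in `H¹(A)`, and has the weak
gradient `(g₁, g₂)`: there are test functions that converge to `u` in `L²(A)` and whose partial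
derivatives converge to `g₁` and `g₂` in `L²(A)`. -/
structure IsH10With (A : Set ℂ) (u g₁ g₂ : ℂ → ℝ) : Prop where
  memLp : MemLp u 2 (volume.restrict A)
  memLp₁ : MemLp g₁ 2 (volume.restrict A)
  memLp₂ : MemLp g₂ 2 (volume.restrict A)
  approx : ∃ φ : ℕ → ℂ → ℝ, (∀ n, IsTestFunction A (φ n)) ∧
    Tendsto (fun n => eLpNorm (fun t => φ n t - u t) 2 (volume.restrict A)) atTop (𝓝 0) ∧
    Tendsto (fun n => eLpNorm (fun t => partial₁ (φ n) t - g₁ t) 2 (volume.restrict A))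
      atTop (𝓝 0) ∧
    Tendsto (fun n => eLpNorm (fun t => partial₂ (φ n) t - g₂ t) 2 (volume.restrict A))
      atTop (𝓝 0)

/-- `u ∈ H¹₀(A)` is the weak solution of `Δu = f` in `A`, `u = 0` on `∂A`. -/
def IsDirichletSolution (A : Set ℂ) (f u : ℂ → ℝ) : Prop :=
  ∃ g₁ g₂ : ℂ → ℝ, IsH10With A u g₁ g₂ ∧
    ∀ ψ : ℂ → ℝ, IsTestFunction A ψ →
      ∫ t in A, (g₁ t * partial₁ ψ t + g₂ t * partial₂ ψ t) = - ∫ t in A, f t * ψ t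

/-- `f` is the sum of the power series with coefficients `c` almost everywhere in
`A ∩ B(0, M⁻¹)`, and `|c_α| ≤ C M ^ |α|`. -/
def IsAnalyticAtVertex (A : Set ℂ) (f : ℂ → ℝ) (M : ℝ) : Prop :=
  ∃ (c : ℕ × ℕ → ℝ) (C : ℝ),
    (∀ α, |c α| ≤ C * M ^ (α.1 + α.2)) ∧
    ∀ᵐ t ∂(volume.restrict (A ∩ Metric.ball 0 M⁻¹)),
      HasSum (fun α : ℕ × ℕ => c α * t.re ^ α.1 * t.im ^ α.2) (f t)

/-- The index set: the disjoint union of `ℕ² \ {(0,0)}` and of `(π/ω) ℕ_*`, where the positive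
integer `k` stands for the exponent `k π / ω`. -/
abbrev Index : Type := {α : ℕ × ℕ // α ≠ (0, 0)} ⊕ ℕ+

/-- The size of an index: `α₁ + α₂` for a pair, `k π / ω` for an exponent. -/
def size (ω : ℝ) : Index → ℝ
  | .inl α => (α.1.1 : ℝ) + (α.1.2 : ℝ)
  | .inr k => (k : ℝ) * Real.pi / ω

/-- The pair `(ℓ, 0)` and the exponent `k π / ω` with `k ≥ 1` are nearly resonant. -/
def IsNear (ω δ : ℝ) (ℓ k : ℕ) : Prop :=
  0 < k ∧ |(ℓ : ℝ) * ω - (k : ℝ) * Real.pi| ≤ δ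

open Classical in
/-- The special functions. For `(ℓ, 0)` nearly resonant with `k π / ω` (such a `k` is unique if
`0 < δ < min ω π / 2`), a logarithmic term or a divided difference; otherwise the powers
`ζ ^ α₁ * conj ζ ^ α₂` and `ζ ^ (k π / ω)`. -/
def Z (ω δ : ℝ) : Index → ℂ → ℂ
  | .inr k, ζ => sectorPow ζ ((k : ℝ) * Real.pi / ω)
  | .inl α, ζ =>
    if h : α.1.2 = 0 ∧ ∃ k : ℕ, IsNear ω δ α.1.1 k then
      let ℓ : ℕ := α.1.1
      let s : ℝ := (h.2.choose : ℝ) * Real.pi / ω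
      if (ℓ : ℝ) = s then ζ ^ ℓ * sectorLog ζ
      else (ζ ^ ℓ - sectorPow ζ s) / (((ℓ : ℝ) - s : ℝ) : ℂ)
    else ζ ^ α.1.1 * (conj ζ) ^ α.1.2

end CornerSeries

end

open CornerSeries

/-! In the logarithmic coordinates `ζ = exp (x + i θ)` the sector near its vertex becomes the
half-strip `x < X`, `0 < θ < ω`, and the equation `Δ u = f` becomes `Δ u = exp (2 x) f`. The
expansion of the solution is the sum of a particular solution, indexed by the pairs, and of a
harmonic function with zero Dirichlet data on the two sides, indexed by the exponents `k π / ω`.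

*The particular solution.* The power series of `f` is the real part of a series of homogeneous
polynomials `F_n = ∑ F (i, j) ζ ^ i conj ζ ^ j` (`exists_complex_coefficients`). Multiplying
each term by `ζ conj ζ / (4 (i + 1) (j + 1))` gives a polynomial with Laplacian `F_n`. A multiple of
`conj ζ ^ (n + 2)` cancels its trace on `θ = 0`, and a multiple of the special function of
`(n + 2, 0)` cancels what is left on `θ = ω` (`exists_pair_coefficients`). The multiplier is
controlled because the imaginary part of the special function on `θ = ω`, divided by
`exp ((n + 2) x)`, is bounded away from `0` independently of `n` (`exists_pairZ_model`): away from the resonances it is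
`sin ((n + 2) ω)`, and near one the divided difference, or the logarithm in the limit, replaces
that small number by one of the order of `ω`. All coefficients therefore grow no faster than
powers of any number larger than the one that governs `f`, up to a constant; the special functions
themselves are bounded uniformly by `norm_pairZ_le`.

*The harmonic remainder.* The equation tested with `η (log ρ) sin (s ϑ)`, `s = k π / ω`
(`IsDirichletSolution.weak_ode`), says that the sine coefficient `W_k (x)` of the difference
between the solution and the particular solution is a weak solution of `W'' = s² W`. Hence
`W_k (x) = b exp (s x) + d exp (-s x)` (`ae_eq_exp_of_weak_ode`). A nonzero `d` is incompatible
with the finite energy of the solution, which bounds the coefficients in the mean as `x → -∞`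
(`IsDirichletSolution.bounded_coeff`, `ae_section_eq_exp`). Since `W_k (x)` is bounded by the
`L¹` norm of the section at `x`, a section with `x` close to `X` gives
`|b_k| ≤ C exp (-k π x / ω)`. The sine series then converges absolutely for smaller `x`, and by
Parseval's identity it represents the difference almost everywhere (`ae_eq_sine_sum`). No trace
theory is needed: `H¹₀` enters only through limits of test functions. -/

open MeasureTheory Filter Topology
open scoped ComplexConjugate

noncomputable section

namespace CornerSeries

open Finset.HasAntidiagonal (antidiagonal)

/-! ### Logarithmic polar coordinates -/

/-- The point `exp (x + i θ)` of the plane with logarithmic polar coordinates `p = (x, θ)`. -/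
def polarExp (p : ℝ × ℝ) : ℂ := Complex.exp ⟨p.1, p.2⟩

/-- The coordinates `(log ρ, ϑ)` of a point of the plane, with `ϑ ∈ [0, 2π)`. Away from `0` and for
these angles it is inverse to `polarExp`. -/
def polarLog (ζ : ℂ) : ℝ × ℝ := (Real.log ‖ζ‖, angle ζ)

/-- The half-strip `x < X`, `0 < θ < ω`: the logarithmic coordinates of the points of the sector of
opening `ω` at a distance less than `exp X` from the vertex. -/
def halfStrip (X ω : ℝ) : Set (ℝ × ℝ) := Set.Iio X ×ˢ Set.Ioo 0 ω

theorem measurableSet_halfStrip (X ω : ℝ) : MeasurableSet (halfStrip X ω) :=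
  measurableSet_Iio.prod measurableSet_Ioo

theorem angle_lt (ζ : ℂ) : angle ζ < 2 * Real.pi := by
  unfold angle
  split_ifs with h
  · linarith
  · linarith [Complex.arg_le_pi ζ, Real.pi_pos]

theorem exp_sectorLog {ζ : ℂ} (h : ζ ≠ 0) : Complex.exp (sectorLog ζ) = ζ := by
  have h1 : Complex.exp ((angle ζ : ℂ) * Complex.I) = Complex.exp (ζ.arg * Complex.I) := by
    unfold angle
    split_ifs
    · push_cast
      rw [add_mul, Complex.exp_add, Complex.exp_two_pi_mul_I, mul_one]
    · rfl
  rw [sectorLog, Complex.exp_add, h1, ← Complex.ofReal_exp, Real.exp_log (by positivity)]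
  exact Complex.norm_mul_exp_arg_mul_I ζ

theorem polarExp_polarLog {ζ : ℂ} (h : ζ ≠ 0) : polarExp (polarLog ζ) = ζ := by
  have : (⟨(polarLog ζ).1, (polarLog ζ).2⟩ : ℂ) = sectorLog ζ := by
    apply Complex.ext <;> simp [polarLog, sectorLog]
  rw [polarExp, this, exp_sectorLog h]

theorem norm_polarExp (p : ℝ × ℝ) : ‖polarExp p‖ = Real.exp p.1 := by
  simp [polarExp, Complex.norm_exp]

theorem angle_polarExp {p : ℝ × ℝ} (h0 : 0 ≤ p.2) (h1 : p.2 < 2 * Real.pi) :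
    angle (polarExp p) = p.2 := by
  unfold angle polarExp
  by_cases h : p.2 ≤ Real.pi
  · have : (Complex.exp ⟨p.1, p.2⟩).arg = p.2 := by
      rw [← Complex.log_im, Complex.log_exp]
      · change -Real.pi < p.2
        linarith [Real.pi_pos]
      · exact h
    rw [this, if_neg (by linarith)]
  · push Not at h
    have h2 : Complex.exp ⟨p.1, p.2⟩ = Complex.exp ⟨p.1, p.2 - 2 * Real.pi⟩ := by
      rw [Complex.exp_eq_exp_iff_exists_int]
      refine ⟨1, ?_⟩
      apply Complex.ext <;> simp
    have : (Complex.exp ⟨p.1, p.2⟩).arg = p.2 - 2 * Real.pi := by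
      rw [h2, ← Complex.log_im, Complex.log_exp]
      · change -Real.pi < p.2 - 2 * Real.pi
        linarith
      · change p.2 - 2 * Real.pi ≤ Real.pi
        linarith [Real.pi_pos]
    rw [this, if_pos (by linarith)]
    ring

theorem polarLog_polarExp {p : ℝ × ℝ} (h0 : 0 ≤ p.2) (h1 : p.2 < 2 * Real.pi) :
    polarLog (polarExp p) = p := by
  rw [polarLog, angle_polarExp h0 h1, norm_polarExp, Real.log_exp]

theorem sectorLog_polarExp {p : ℝ × ℝ} (h0 : 0 ≤ p.2) (h1 : p.2 < 2 * Real.pi) :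
    sectorLog (polarExp p) = ⟨p.1, p.2⟩ := by
  rw [sectorLog, angle_polarExp h0 h1, norm_polarExp, Real.log_exp]
  apply Complex.ext <;> simp

theorem ne_zero_of_mem_sector {ω : ℝ} {ζ : ℂ} (h : ζ ∈ sector ω) : ζ ≠ 0 := by
  rintro rfl
  simp [sector, angle] at h

theorem polarExp_mem_sector {ω : ℝ} (hω : ω < 2 * Real.pi) {p : ℝ × ℝ} (h0 : 0 ≤ p.2)
    (h1 : p.2 ≤ ω) : polarExp p ∈ sector ω ↔ 0 < p.2 ∧ p.2 < ω := by
  rw [sector, Set.mem_ofPred_eq, angle_polarExp h0 (h1.trans_lt hω)]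

theorem polarLog_mem_halfStrip {X ω : ℝ} {ζ : ℂ}
    (h : ζ ∈ sector ω ∩ Metric.ball 0 (Real.exp X)) : polarLog ζ ∈ halfStrip X ω := by
  refine ⟨?_, h.1⟩
  have h2 := h.2
  rw [mem_ball_zero_iff] at h2
  exact (Real.log_lt_iff_lt_exp (norm_pos_iff.2 (ne_zero_of_mem_sector h.1))).2 h2

theorem polarExp_mem {X ω : ℝ} (hω : ω < 2 * Real.pi) {p : ℝ × ℝ} (h : p ∈ halfStrip X ω) :
    polarExp p ∈ sector ω ∩ Metric.ball 0 (Real.exp X) := by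
  refine ⟨(polarExp_mem_sector hω h.2.1.le h.2.2.le).2 h.2, ?_⟩
  rw [mem_ball_zero_iff, norm_polarExp]
  exact Real.exp_lt_exp.2 h.1

theorem polarExp_image {X ω : ℝ} (hω : ω < 2 * Real.pi) :
    polarExp '' halfStrip X ω = sector ω ∩ Metric.ball 0 (Real.exp X) := by
  ext ζ
  constructor
  · rintro ⟨p, hp, rfl⟩
    exact polarExp_mem hω hp
  · intro h
    exact ⟨polarLog ζ, polarLog_mem_halfStrip h, polarExp_polarLog (ne_zero_of_mem_sector h.1)⟩

/-- On the sector the branch of the logarithm is a translate of the principal branch at `-ζ`. -/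
theorem sectorLog_eq {ω : ℝ} {ζ : ℂ} (h : ζ ∈ sector ω) :
    sectorLog ζ = Complex.log (-ζ) + Real.pi * Complex.I ∧ -ζ ∈ Complex.slitPlane := by
  have h0 := ne_zero_of_mem_sector h
  have h1 : Complex.log (-ζ) = sectorLog ζ - Real.pi * Complex.I := by
    have : -ζ = Complex.exp (sectorLog ζ - Real.pi * Complex.I) := by
      rw [Complex.exp_sub, exp_sectorLog h0, Complex.exp_pi_mul_I]
      ring
    rw [this, Complex.log_exp]
    · simpa [sectorLog] using h.1
    · have := angle_lt ζ
      simp [sectorLog]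
      linarith
  refine ⟨by rw [h1]; ring, ?_⟩
  rw [Complex.mem_slitPlane_iff_arg]
  refine ⟨?_, neg_ne_zero.2 h0⟩
  rw [← Complex.log_im, h1]
  have := angle_lt ζ
  simp [sectorLog]
  linarith

theorem isOpen_sector (ω : ℝ) : IsOpen (sector ω) := by
  -- the sector is a sublevel set of a continuous angle on the complement of `[0, ∞)`
  have key : sector ω = {ζ : ℂ | -ζ ∈ Complex.slitPlane} ∩
      {ζ : ℂ | (-ζ).arg + Real.pi < ω} := by
    ext ζ
    constructor
    · intro h
      refine ⟨(sectorLog_eq h).2, ?_⟩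
      have := congrArg Complex.im (sectorLog_eq h).1
      have h2 := h.2
      simp [sectorLog] at this
      rw [Complex.log_im] at this
      simp only [Set.mem_ofPred_eq]
      linarith
    · rintro ⟨h1, h2⟩
      have h0 : ζ ≠ 0 := by
        rintro rfl
        simp at h1
      have h3 : polarExp (Real.log ‖ζ‖, (-ζ).arg + Real.pi) = ζ := by
        have : (⟨Real.log ‖ζ‖, (-ζ).arg + Real.pi⟩ : ℂ)
            = Complex.log (-ζ) + Real.pi * Complex.I := by
          apply Complex.ext <;> simp [Complex.log_re, Complex.log_im]
        rw [polarExp, this, Complex.exp_add, Complex.exp_log (neg_ne_zero.2 h0),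
          Complex.exp_pi_mul_I]
        ring
      have h4 : -Real.pi < (-ζ).arg := Complex.neg_pi_lt_arg _
      have h5 : (-ζ).arg < Real.pi := lt_of_le_of_ne (Complex.arg_le_pi _)
        (Complex.mem_slitPlane_iff_arg.1 h1).1
      have h6 := angle_polarExp (p := (Real.log ‖ζ‖, (-ζ).arg + Real.pi)) (by simp; linarith)
        (by simp; linarith)
      rw [h3] at h6
      simp only [Set.mem_ofPred_eq] at h2
      refine ⟨?_, ?_⟩ <;> rw [h6] <;> simp <;> linarith
  rw [key]
  have ho : IsOpen {ζ : ℂ | -ζ ∈ Complex.slitPlane} :=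
    Complex.isOpen_slitPlane.preimage continuous_neg
  refine ContinuousOn.isOpen_inter_preimage (t := Set.Iio ω)
    (f := fun ζ : ℂ => (-ζ).arg + Real.pi) ?_ ho isOpen_Iio
  intro ζ hζ
  exact (((Complex.continuousAt_arg hζ).comp continuous_neg.continuousAt).add
    continuousAt_const).continuousWithinAt

theorem hasDerivAt_sectorLog {ω : ℝ} {ζ : ℂ} (h : ζ ∈ sector ω) :
    HasDerivAt sectorLog ζ⁻¹ ζ := by
  have h1 : HasDerivAt (fun ζ : ℂ => Complex.log (-ζ) + Real.pi * Complex.I) ζ⁻¹ ζ := by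
    have := ((hasDerivAt_neg ζ).clog (sectorLog_eq h).2).add_const (Real.pi * Complex.I)
    rwa [neg_div_neg_eq, one_div] at this
  refine h1.congr_of_eventuallyEq ?_
  filter_upwards [(isOpen_sector ω).mem_nhds h] with y hy using (sectorLog_eq hy).1

theorem continuousOn_polarLog (ω : ℝ) : ContinuousOn polarLog (sector ω) := by
  have h : ContinuousOn sectorLog (sector ω) := fun ζ hζ =>
    (hasDerivAt_sectorLog hζ).continuousAt.continuousWithinAt
  have h2 : polarLog = fun ζ => ((sectorLog ζ).re, (sectorLog ζ).im) := by
    funext ζ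
    simp [polarLog, sectorLog]
  rw [h2]
  exact (Complex.continuous_re.comp_continuousOn h).prodMk
    (Complex.continuous_im.comp_continuousOn h)

theorem continuous_polarExp : Continuous polarExp := by
  unfold polarExp
  refine Complex.continuous_exp.comp ?_
  exact Complex.equivRealProdCLM.symm.continuous

theorem polarExp_injOn {X ω : ℝ} (hω : ω < 2 * Real.pi) :
    Set.InjOn polarExp (halfStrip X ω) := by
  intro p hp q hq h
  rw [← polarLog_polarExp hp.2.1.le (hp.2.2.trans hω), h,
    polarLog_polarExp hq.2.1.le (hq.2.2.trans hω)]

/-! ### Change of variables -/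

theorem complexStrip_image (X ω : ℝ) (g : ℝ × ℝ → ℂ) :
    (fun z : ℂ => g (z.re, z.im)) '' (Complex.measurableEquivRealProd ⁻¹' halfStrip X ω)
      = g '' halfStrip X ω := by
  ext y
  constructor
  · rintro ⟨z, hz, rfl⟩
    exact ⟨_, hz, rfl⟩
  · rintro ⟨p, hp, rfl⟩
    exact ⟨⟨p.1, p.2⟩, hp, rfl⟩

/-- The real Jacobian of the multiplication by `c`. -/
theorem det_smul_complex (c : ℂ) :
    ((ContinuousLinearMap.toSpanSingleton ℂ c).restrictScalars ℝ).det = ‖c‖ ^ 2 := by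
  have h : (((ContinuousLinearMap.toSpanSingleton ℂ c).restrictScalars ℝ : ℂ →L[ℝ] ℂ) :
      ℂ →ₗ[ℝ] ℂ) = Algebra.lmul ℝ ℂ c := by
    ext
    simp [mul_comm]
  rw [ContinuousLinearMap.det, h, ← Algebra.norm_apply, Algebra.norm_complex_apply,
    Complex.normSq_eq_norm_sq]

theorem hasFDerivAt_exp_real (z : ℂ) : HasFDerivAt Complex.exp
    ((ContinuousLinearMap.toSpanSingleton ℂ (Complex.exp z)).restrictScalars ℝ : ℂ →L[ℝ] ℂ) z :=
  (Complex.hasDerivAt_exp z).hasFDerivAt.restrictScalars ℝ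

/-- The change of variables `ζ = exp (x + i θ)`, of Jacobian `exp (2 x)`. -/
theorem integral_and_integrable_polarExp {X ω : ℝ} (hω : ω < 2 * Real.pi) (h : ℂ → ℝ) :
    (∫ ζ in sector ω ∩ Metric.ball 0 (Real.exp X), h ζ
      = ∫ p in halfStrip X ω, Real.exp (2 * p.1) * h (polarExp p)) ∧
    (IntegrableOn h (sector ω ∩ Metric.ball 0 (Real.exp X)) ↔
      IntegrableOn (fun p => Real.exp (2 * p.1) * h (polarExp p)) (halfStrip X ω)) := by
  set T : Set ℂ := Complex.measurableEquivRealProd ⁻¹' halfStrip X ω with hT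
  have hTm : MeasurableSet T := Complex.measurableEquivRealProd.measurable
    (measurableSet_halfStrip X ω)
  have him : Complex.exp '' T = sector ω ∩ Metric.ball 0 (Real.exp X) := by
    rw [← polarExp_image hω, ← complexStrip_image]
    rfl
  have hinj : Set.InjOn Complex.exp T := by
    intro z hz w hw hzw
    have := polarExp_injOn hω hz hw hzw
    exact Complex.measurableEquivRealProd.injective this
  have hd : ∀ z ∈ T, HasFDerivWithinAt Complex.exp
    ((ContinuousLinearMap.toSpanSingleton ℂ (Complex.exp z)).restrictScalars ℝ : ℂ →L[ℝ] ℂ)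
    T z := fun z _ => (hasFDerivAt_exp_real z).hasFDerivWithinAt
  have hJ : (fun z : ℂ => |((ContinuousLinearMap.toSpanSingleton ℂ
      (Complex.exp z)).restrictScalars ℝ : ℂ →L[ℝ] ℂ).det| • h (Complex.exp z))
      = (fun p : ℝ × ℝ => Real.exp (2 * p.1) * h (polarExp p)) ∘
        Complex.measurableEquivRealProd := by
    funext z
    have h2 : Complex.exp z = polarExp (z.re, z.im) := rfl
    have h3 : Complex.measurableEquivRealProd z = (z.re, z.im) := rfl
    rw [det_smul_complex, h2, norm_polarExp, Function.comp_apply, h3, smul_eq_mul, abs_of_nonneg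
      (by positivity), ← Real.exp_nat_mul]
    norm_num
  constructor
  · rw [← him, integral_image_eq_integral_abs_det_fderiv_smul volume hTm hd hinj, hJ]
    exact Complex.volume_preserving_equiv_real_prod.setIntegral_preimage_emb
      Complex.measurableEquivRealProd.measurableEmbedding
      (fun p : ℝ × ℝ => Real.exp (2 * p.1) * h (polarExp p)) (halfStrip X ω)
  · rw [← him, integrableOn_image_iff_integrableOn_abs_det_fderiv_smul volume hTm hd hinj, hJ]
    exact Complex.volume_preserving_equiv_real_prod.integrableOn_comp_preimage
      Complex.measurableEquivRealProd.measurableEmbedding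

theorem quasiMeasurePreserving_polarExp {X ω : ℝ} (hω : ω < 2 * Real.pi) :
    Measure.QuasiMeasurePreserving polarExp (volume.restrict (halfStrip X ω))
      (volume.restrict (sector ω ∩ Metric.ball 0 (Real.exp X))) := by
  refine ⟨continuous_polarExp.measurable, ?_⟩
  refine Measure.AbsolutelyContinuous.mk fun N hN h0 => ?_
  rw [Measure.restrict_apply hN] at h0
  rw [Measure.map_apply continuous_polarExp.measurable hN,
    Measure.restrict_apply (continuous_polarExp.measurable hN),
    ← Complex.volume_preserving_equiv_real_prod.measure_preimage_equiv]
  refine measure_mono_null (t := sectorLog '' (N ∩ (sector ω ∩ Metric.ball 0 (Real.exp X)))) ?_ ?_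
  · rintro z ⟨hz1, hz2⟩
    refine ⟨_, ⟨hz1, polarExp_mem hω hz2⟩, ?_⟩
    exact sectorLog_polarExp hz2.2.1.le (hz2.2.2.trans hω)
  · refine addHaar_image_eq_zero_of_differentiableOn_of_addHaar_eq_zero volume ?_ h0
    rintro ζ ⟨-, hζ, -⟩
    exact ((hasDerivAt_sectorLog hζ).differentiableAt.restrictScalars ℝ).differentiableWithinAt

theorem ae_polarLog {X ω : ℝ} {P : ℝ × ℝ → Prop}
    (h : ∀ᵐ p ∂(volume.restrict (halfStrip X ω)), P p) :
    ∀ᵐ ζ ∂(volume.restrict (sector ω ∩ Metric.ball 0 (Real.exp X))), P (polarLog ζ) := by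
  have hm : MeasurableSet (sector ω ∩ Metric.ball (0 : ℂ) (Real.exp X)) :=
    ((isOpen_sector ω).inter Metric.isOpen_ball).measurableSet
  rw [ae_restrict_iff' hm]
  rw [ae_restrict_iff' (measurableSet_halfStrip X ω), ae_iff,
    ← Complex.volume_preserving_equiv_real_prod.measure_preimage_equiv] at h
  rw [ae_iff]
  refine measure_mono_null (t := Complex.exp '' (Complex.measurableEquivRealProd ⁻¹'
    {p | ¬(p ∈ halfStrip X ω → P p)})) ?_ ?_
  · intro ζ hζ
    simp only [Set.mem_ofPred_eq, Classical.not_imp] at hζ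
    refine ⟨⟨(polarLog ζ).1, (polarLog ζ).2⟩, ?_, polarExp_polarLog
      (ne_zero_of_mem_sector hζ.1.1)⟩
    simp only [Set.mem_preimage, Set.mem_ofPred_eq, Classical.not_imp]
    exact ⟨polarLog_mem_halfStrip hζ.1, hζ.2⟩
  · refine addHaar_image_eq_zero_of_differentiableOn_of_addHaar_eq_zero volume ?_ h
    intro z _
    exact (hasFDerivAt_exp_real z).differentiableAt.differentiableWithinAt

/-! ### Smooth functions of compact support on a half-line -/

/-- Smooth functions on the line that vanish outside a compact subinterval of `(-∞, X)`. -/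
structure IsBump (X : ℝ) (η : ℝ → ℝ) : Prop where
  smooth : ContDiff ℝ ((⊤ : ℕ∞) : WithTop ℕ∞) η
  supp : ∃ a b, a ≤ b ∧ b < X ∧ ∀ x, x ∉ Set.Icc a b → η x = 0

namespace IsBump

variable {X : ℝ} {η μ : ℝ → ℝ}

theorem tsupport_subset_of {a b : ℝ} (h : ∀ x, x ∉ Set.Icc a b → η x = 0) :
    tsupport η ⊆ Set.Icc a b := by
  refine closure_minimal (fun x hx => ?_) isClosed_Icc
  by_contra hc
  exact hx (h x hc)

theorem add (h : IsBump X η) (h' : IsBump X μ) : IsBump X (η + μ) := by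
  obtain ⟨a, b, hab, hb, hz⟩ := h.supp
  obtain ⟨a', b', hab', hb', hz'⟩ := h'.supp
  refine ⟨h.smooth.add h'.smooth, min a a', max b b', ?_, max_lt hb hb', fun x hx => ?_⟩
  · exact (min_le_left _ _).trans (hab.trans (le_max_left _ _))
  · rw [Pi.add_apply, hz x, hz' x, add_zero]
    · exact fun hc => hx ⟨(min_le_right _ _).trans hc.1, hc.2.trans (le_max_right _ _)⟩
    · exact fun hc => hx ⟨(min_le_left _ _).trans hc.1, hc.2.trans (le_max_left _ _)⟩

theorem mul_smooth (h : IsBump X η) {g : ℝ → ℝ}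
    (hg : ContDiff ℝ ((⊤ : ℕ∞) : WithTop ℕ∞) g) : IsBump X (fun x => g x * η x) := by
  obtain ⟨a, b, hab, hb, hz⟩ := h.supp
  exact ⟨hg.mul h.smooth, a, b, hab, hb, fun x hx => by simp [hz x hx]⟩

theorem deriv (h : IsBump X η) : IsBump X (deriv η) := by
  obtain ⟨a, b, hab, hb, hz⟩ := h.supp
  refine ⟨((contDiff_infty_iff_deriv).1 h.smooth).2, a, b, hab, hb, fun x hx => ?_⟩
  by_contra hc
  exact hx (tsupport_subset_of hz (support_deriv_subset hc))

theorem hasDerivAt (h : IsBump X η) (x : ℝ) : HasDerivAt η (_root_.deriv η x) x :=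
  ((h.smooth.differentiable (by simp)) x).hasDerivAt

theorem eq_zero (h : IsBump X η) {x : ℝ} (hx : X ≤ x) : η x = 0 := by
  obtain ⟨a, b, hab, hb, hz⟩ := h.supp
  exact hz x fun hc => by linarith [hc.2]

theorem hasCompactSupport (h : IsBump X η) : HasCompactSupport η := by
  obtain ⟨a, b, hab, hb, hz⟩ := h.supp
  exact HasCompactSupport.of_support_subset_isCompact isCompact_Icc
    ((subset_tsupport _).trans (tsupport_subset_of hz))

theorem tsupport_subset (h : IsBump X η) : tsupport η ⊆ Set.Iio X := by
  obtain ⟨a, b, hab, hb, hz⟩ := h.supp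
  exact (tsupport_subset_of hz).trans fun x hx => hx.2.trans_lt hb

theorem of_tsupport (hs : ContDiff ℝ ((⊤ : ℕ∞) : WithTop ℕ∞) η) (hc : HasCompactSupport η)
    (ht : tsupport η ⊆ Set.Iio X) : IsBump X η := by
  refine ⟨hs, ?_⟩
  by_cases he : (tsupport η).Nonempty
  · have h1 : IsCompact (tsupport η) := hc
    refine ⟨sInf (tsupport η), sSup (tsupport η), ?_, ht (h1.sSup_mem he), fun x hx => ?_⟩
    · exact Real.sInf_le_sSup _ h1.bddBelow h1.bddAbove
    · by_contra h2
      have h3 := subset_tsupport η h2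
      exact hx ⟨csInf_le h1.bddBelow h3, le_csSup h1.bddAbove h3⟩
  · refine ⟨X - 1, X - 1, le_rfl, by linarith, fun x _ => ?_⟩
    by_contra h2
    exact he ⟨x, subset_tsupport η h2⟩

/-- A function that is integrable over the compact subsets of `(-∞, X)` may be integrated against
a bump function. -/
theorem integrable_mul (h : IsBump X η) {W : ℝ → ℝ} (hW : LocallyIntegrableOn W (Set.Iio X)) :
    Integrable (fun x => W x * η x) := by
  have hK : IntegrableOn W (tsupport η) :=
    hW.integrableOn_compact_subset h.tsupport_subset h.hasCompactSupport
  have h1 : IntegrableOn (fun x => W x * η x) (tsupport η) :=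
    hK.mul_continuousOn h.smooth.continuous.continuousOn h.hasCompactSupport
  refine (integrableOn_iff_integrable_of_support_subset ?_).1 h1
  intro x hx
  refine subset_tsupport η fun hc => hx ?_
  simp [hc]

/-- A bump function of mean zero is the derivative of a bump function. -/
theorem exists_primitive (h : IsBump X μ) (h0 : ∫ x, μ x = 0) :
    ∃ κ, IsBump X κ ∧ _root_.deriv κ = μ := by
  obtain ⟨a, b, hab, hb, hz⟩ := h.supp
  have hc := h.smooth.continuous
  have hi : Integrable μ := hc.integrable_of_hasCompactSupport h.hasCompactSupport
  -- the base point is moved to `a - 1` so that the support lies in a half-open interval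
  set κ : ℝ → ℝ := fun x => ∫ t in (a - 1)..x, μ t
  have hd : _root_.deriv κ = μ := by
    funext x
    exact (intervalIntegral.integral_hasDerivAt_right (hc.intervalIntegrable _ _)
      hc.stronglyMeasurable.stronglyMeasurableAtFilter hc.continuousAt).deriv
  have hdiff : Differentiable ℝ κ := fun x =>
    (intervalIntegral.integral_hasDerivAt_right (hc.intervalIntegrable _ _)
      hc.stronglyMeasurable.stronglyMeasurableAtFilter hc.continuousAt).differentiableAt
  refine ⟨κ, ⟨contDiff_infty_iff_deriv.2 ⟨hdiff, hd ▸ h.smooth⟩, a - 1, b, by linarith, hb, ?_⟩,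
    hd⟩
  intro x hx
  rcases lt_or_ge x (a - 1) with hxa | hxa
  · refine intervalIntegral.integral_zero_ae (ae_of_all _ fun t ht => hz t fun hc => ?_)
    rw [Set.uIoc_of_ge hxa.le] at ht
    linarith [hc.1, ht.2]
  · have hxb : b < x := by
      by_contra hc
      exact hx ⟨hxa, not_lt.1 hc⟩
    change ∫ t in (a - 1)..x, μ t = 0
    rw [intervalIntegral.integral_eq_integral_of_support_subset, h0]
    intro t ht
    have : t ∈ Set.Icc a b := by
      by_contra hc
      exact ht (hz t hc)
    exact ⟨by linarith [this.1], by linarith [this.2]⟩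

theorem integral_deriv (h : IsBump X η) : ∫ x, _root_.deriv η x = 0 :=
  integral_eq_zero_of_hasDerivAt_of_integrable (fun x => h.hasDerivAt x)
    (h.deriv.smooth.continuous.integrable_of_hasCompactSupport h.deriv.hasCompactSupport)
    (h.smooth.continuous.integrable_of_hasCompactSupport h.hasCompactSupport)

theorem const_smul (h : IsBump X η) (c : ℝ) : IsBump X (c • η) :=
  h.mul_smooth (g := fun _ => c) contDiff_const

/-- The equation `η'' - s² η = μ` has a solution of compact support if `μ` is orthogonal to the
two solutions `exp (± s x)` of the homogeneous equation. -/
theorem exists_solution (h : IsBump X μ) {s : ℝ} (hs : s ≠ 0)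
    (hp : ∫ x, Real.exp (s * x) * μ x = 0) (hm : ∫ x, Real.exp (-s * x) * μ x = 0) :
    ∃ η, IsBump X η ∧ ∀ x, _root_.deriv (_root_.deriv η) x - s ^ 2 * η x = μ x := by
  have hexp : ∀ c : ℝ, ContDiff ℝ ((⊤ : ℕ∞) : WithTop ℕ∞) fun x => Real.exp (c * x) :=
    fun c => Real.contDiff_exp.comp (contDiff_const.mul contDiff_id)
  have hde : ∀ c x : ℝ, HasDerivAt (fun x => Real.exp (c * x)) (c * Real.exp (c * x)) x := by
    intro c x
    have := ((hasDerivAt_id x).const_mul c).exp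
    simpa [mul_comm] using this
  obtain ⟨κ, hκ, hκd⟩ := (h.mul_smooth (hexp s)).exists_primitive hp
  have h2 : ∫ x, Real.exp (-(2 * s) * x) * κ x = 0 := by
    have h3 := (hκ.mul_smooth (hexp (-(2 * s)))).integral_deriv
    have h4 : ∀ x, _root_.deriv (fun x => Real.exp (-(2 * s) * x) * κ x) x
        = -(2 * s) * (Real.exp (-(2 * s) * x) * κ x) + Real.exp (-s * x) * μ x := by
      intro x
      rw [((hde _ x).fun_mul (hκ.hasDerivAt x)).deriv, hκd]
      have : Real.exp (-(2 * s) * x) * Real.exp (s * x) = Real.exp (-s * x) := by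
        rw [← Real.exp_add]
        ring_nf
      linear_combination (μ x) * this
    simp_rw [h4] at h3
    have hi1 := (hκ.mul_smooth (hexp (-(2 * s))))
    have hi2 := (h.mul_smooth (hexp (-s)))
    rw [integral_add ((hi1.smooth.continuous.integrable_of_hasCompactSupport
      hi1.hasCompactSupport).const_mul _) (hi2.smooth.continuous.integrable_of_hasCompactSupport
      hi2.hasCompactSupport), hm, integral_const_mul, add_zero] at h3
    rcases mul_eq_zero.1 h3 with h5 | h5
    · exact absurd (by linarith) hs
    · exact h5
  obtain ⟨κ₂, hκ₂, hκ₂d⟩ := (hκ.mul_smooth (hexp (-(2 * s)))).exists_primitive h2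
  refine ⟨fun x => Real.exp (s * x) * κ₂ x, hκ₂.mul_smooth (hexp s), fun x => ?_⟩
  have h5 : _root_.deriv (fun x => Real.exp (s * x) * κ₂ x)
      = fun x => s * (Real.exp (s * x) * κ₂ x) + Real.exp (-s * x) * κ x := by
    funext x
    rw [((hde _ x).fun_mul (hκ₂.hasDerivAt x)).deriv, hκ₂d]
    have : Real.exp (s * x) * Real.exp (-(2 * s) * x) = Real.exp (-s * x) := by
      rw [← Real.exp_add]
      ring_nf
    linear_combination (κ x) * this
  rw [h5, ((((hde s x).fun_mul (hκ₂.hasDerivAt x)).const_mul s).fun_add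
    ((hde (-s) x).fun_mul (hκ.hasDerivAt x))).deriv, hκd, hκ₂d]
  have e1 : Real.exp (s * x) * Real.exp (-(2 * s) * x) = Real.exp (-s * x) := by
    rw [← Real.exp_add]
    ring_nf
  have e2 : Real.exp (-s * x) * Real.exp (s * x) = 1 := by
    rw [← Real.exp_add]
    simp
  simp only []
  linear_combination (s * κ x) * e1 + μ x * e2

end IsBump

/-- Integration of bump functions against a fixed weight, as a linear form. -/
def bumpPairing (X : ℝ) {W : ℝ → ℝ} (hW : LocallyIntegrableOn W (Set.Iio X)) :
    ({ carrier := {η | IsBump X η}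
       add_mem' := fun h h' => h.add h'
       zero_mem' := ⟨contDiff_const, X - 1, X - 1, le_rfl, by linarith, fun _ _ => rfl⟩
       smul_mem' := fun c _ h => h.const_smul c } : Submodule ℝ (ℝ → ℝ)) →ₗ[ℝ] ℝ where
  toFun η := ∫ x, W x * η.1 x
  map_add' η μ := by
    rw [← integral_add (η.2.integrable_mul hW) (μ.2.integrable_mul hW)]
    exact integral_congr_ae (ae_of_all _ fun x => mul_add _ _ _)
  map_smul' c η := by
    rw [RingHom.id_apply, smul_eq_mul, ← integral_const_mul]
    exact integral_congr_ae (ae_of_all _ fun x => mul_left_comm _ _ _)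

/-- A distributional solution of `W'' = s² W` on a half-line is a combination of
`exp (s x)` and `exp (-s x)`. -/
theorem ae_eq_exp_of_weak_ode {X s : ℝ} (hs : s ≠ 0) {W : ℝ → ℝ}
    (hW : LocallyIntegrableOn W (Set.Iio X))
    (h : ∀ η, IsBump X η → ∫ x, W x * (deriv (deriv η) x - s ^ 2 * η x) = 0) :
    ∃ b d : ℝ, ∀ᵐ x, x ∈ Set.Iio X → W x = b * Real.exp (s * x) + d * Real.exp (-s * x) := by
  have hexp : ∀ c : ℝ, LocallyIntegrableOn (fun x => Real.exp (c * x)) (Set.Iio X) := fun c =>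
    ((by fun_prop : Continuous fun x : ℝ => Real.exp (c * x)).locallyIntegrable).locallyIntegrableOn
      _
  let L := fun i : Fin 2 => bumpPairing X (hexp (![s, -s] i))
  have hker : ⨅ i, LinearMap.ker (L i) ≤ LinearMap.ker (bumpPairing X hW) := by
    intro η hη
    rw [Submodule.mem_iInf] at hη
    obtain ⟨κ, hκ, hκe⟩ := η.2.exists_solution hs (hη 0) (hη 1)
    have := h κ hκ
    simp_rw [hκe] at this
    exact this
  have hspan := mem_span_of_iInf_ker_le_ker hker
  obtain ⟨c, hc⟩ := (Submodule.mem_span_range_iff_exists_fun ℝ).1 hspan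
  rw [Fin.sum_univ_two] at hc
  refine ⟨c 0, c 1, ?_⟩
  have hV : LocallyIntegrableOn (fun x => W x - (c 0 * Real.exp (s * x) +
      c 1 * Real.exp (-s * x))) (Set.Iio X) :=
    hW.sub (((by fun_prop : Continuous fun x : ℝ => c 0 * Real.exp (s * x) +
      c 1 * Real.exp (-s * x)).locallyIntegrable).locallyIntegrableOn _)
  have := isOpen_Iio.ae_eq_zero_of_integral_contDiff_smul_eq_zero hV ?_
  · filter_upwards [this] with x hx hxX
    linarith [hx hxX]
  · intro g hg hgc hgt
    have hb : IsBump X g := IsBump.of_tsupport hg hgc hgt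
    have h1 : c 0 * (∫ x, Real.exp (s * x) * g x) + c 1 * (∫ x, Real.exp (-s * x) * g x)
        = ∫ x, W x * g x := LinearMap.congr_fun hc ⟨g, hb⟩
    rw [← integral_const_mul, ← integral_const_mul, ← integral_add
      ((hb.integrable_mul (hexp s)).const_mul _) ((hb.integrable_mul (hexp (-s))).const_mul _)]
      at h1
    rw [← sub_eq_zero, ← integral_sub] at h1
    · rw [← neg_eq_zero, ← integral_neg, ← h1]
      refine integral_congr_ae (ae_of_all _ fun x => ?_)
      simp only [smul_eq_mul]
      ring
    · exact ((hb.integrable_mul (hexp s)).const_mul _).add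
        ((hb.integrable_mul (hexp (-s))).const_mul _)
    · exact hb.integrable_mul hW

/-! ### Completeness of the sine system -/

/-- A square integrable function on `(0, ω)` that is orthogonal to all `sin (k π θ / ω)` vanishes
almost everywhere: this is Parseval's identity for the odd extension. -/
theorem ae_eq_zero_of_sine_coeff {ω : ℝ} (hω : 0 < ω) {h : ℝ → ℝ}
    (hL : MemLp h 2 (volume.restrict (Set.Ioo 0 ω)))
    (h0 : ∀ k : ℕ+, ∫ θ in Set.Ioo 0 ω, h θ * Real.sin (k * Real.pi / ω * θ) = 0) :
    ∀ᵐ θ ∂(volume.restrict (Set.Ioo 0 ω)), h θ = 0 := by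
  set g : ℝ → ℝ := (Set.Ioo 0 ω).indicator h with hg
  have hgL : MemLp g 2 volume := (memLp_indicator_iff_restrict measurableSet_Ioo).2 hL
  set H : ℝ → ℂ := fun θ => ((g θ - g (-θ) : ℝ) : ℂ) with hH
  have hHL : MemLp H 2 volume := by
    have h2 : MemLp (fun θ => g (-θ)) 2 volume :=
      hgL.comp_measurePreserving (Measure.measurePreserving_neg volume)
    exact (hgL.sub h2).ofReal
  have hab : -ω < ω := by linarith
  have hcoef : ∀ n : ℤ, fourierCoeffOn hab H n = 0 := by
    intro n
    set c : ℂ := Real.pi * Complex.I * n / ω with hcdef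
    have hω' : (ω : ℂ) ≠ 0 := by exact_mod_cast hω.ne'
    have he : ∀ x : ℝ, fourier (-n) (x : AddCircle (ω - -ω)) = Complex.exp (-c * x) := by
      intro x
      rw [fourier_coe_apply]
      congr 1
      push_cast
      rw [hcdef]
      field_simp
      ring
    rw [fourierCoeffOn_eq_integral]
    simp only [he]
    rw [smul_eq_zero]
    right
    have hi : ∀ (e : ℝ → ℂ) (_ : Continuous e) (G : ℝ → ℝ) (_ : MemLp G 2 volume),
        IntervalIntegrable (fun x => e x * (G x : ℂ)) volume (-ω) ω := by
      intro e hc G hG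
      rw [intervalIntegrable_iff_integrableOn_Icc_of_le hab.le]
      have h1 : Integrable (fun x => (G x : ℂ)) (volume.restrict (Set.Icc (-ω) ω)) :=
        ((hG.restrict (Set.Icc (-ω) ω)).integrable (by norm_num)).ofReal
      exact IntegrableOn.continuousOn_mul (hc.continuousOn) h1 isCompact_Icc
    have hgn : MemLp (fun θ => g (-θ)) 2 volume :=
      hgL.comp_measurePreserving (Measure.measurePreserving_neg volume)
    have h1 : ∀ x : ℝ, Complex.exp (-c * x) • H x
        = Complex.exp (-c * x) * (g x : ℂ) - Complex.exp (-c * x) * (g (-x) : ℂ) := by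
      intro x
      simp only [hH, smul_eq_mul]
      push_cast
      ring
    simp only [h1]
    rw [intervalIntegral.integral_sub (hi _ (by fun_prop) g hgL) (hi _ (by fun_prop) _ hgn)]
    have h2 : ∫ x in (-ω)..ω, Complex.exp (-c * x) * (g (-x) : ℂ)
        = ∫ x in (-ω)..ω, Complex.exp (c * x) * (g x : ℂ) := by
      have := intervalIntegral.integral_comp_neg (a := -ω) (b := ω)
        (fun x : ℝ => Complex.exp (c * x) * (g x : ℂ))
      rw [neg_neg] at this
      rw [← this]
      refine intervalIntegral.integral_congr fun x _ => ?_
      simp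
    rw [h2, ← intervalIntegral.integral_sub (hi _ (by fun_prop) g hgL) (hi _ (by fun_prop) g hgL)]
    have h3 : ∀ x : ℝ, Complex.exp (-c * x) * (g x : ℂ) - Complex.exp (c * x) * (g x : ℂ)
        = (-2 * Complex.I) *
          ((g x * Real.sin (n * Real.pi / ω * x) : ℝ) : ℂ) := by
      intro x
      have : Complex.exp (-c * x) - Complex.exp (c * x)
          = (-2 * Complex.I) * Complex.sin (n * Real.pi / ω * x) := by
        rw [Complex.sin]
        have e1 : -c * (x : ℂ) = -(n * Real.pi / ω * x) * Complex.I := by rw [hcdef]; ring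
        have e2 : c * (x : ℂ) = (n * Real.pi / ω * x) * Complex.I := by rw [hcdef]; ring
        rw [e1, e2]
        linear_combination (Complex.exp (-(n * Real.pi / ω * x) * Complex.I)
          - Complex.exp ((n * Real.pi / ω * x) * Complex.I)) * Complex.I_sq
      push_cast
      linear_combination (g x : ℂ) * this
    simp only [h3]
    rw [intervalIntegral.integral_const_mul, intervalIntegral.integral_ofReal, mul_eq_zero]
    right
    rw [Complex.ofReal_eq_zero, intervalIntegral.integral_of_le hab.le]
    have h4 : ∀ x, g x * Real.sin (n * Real.pi / ω * x) = (Set.Ioo 0 ω).indicator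
        (fun x => h x * Real.sin (n * Real.pi / ω * x)) x := fun x => by
      rw [hg]
      by_cases hx : x ∈ Set.Ioo 0 ω
      · simp [hx]
      · simp [hx]
    simp only [h4]
    have hsub : Set.Ioo 0 ω ⊆ Set.Ioc (-ω) ω := fun x hx => ⟨by linarith [hx.1], hx.2.le⟩
    rw [setIntegral_indicator measurableSet_Ioo, Set.inter_eq_right.2 hsub]
    rcases lt_trichotomy n 0 with hn | hn | hn
    · have h5 := h0 ⟨n.natAbs, Int.natAbs_pos.2 hn.ne⟩
      have h6 : ((n.natAbs : ℕ) : ℝ) = -(n : ℝ) := by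
        rw [Nat.cast_natAbs, abs_of_neg hn]
        push_cast
        ring
      rw [← neg_eq_zero, ← integral_neg]
      refine Eq.trans (integral_congr_ae (ae_of_all _ fun x => ?_)) h5
      simp only [PNat.mk_coe, h6]
      rw [← mul_neg, ← Real.sin_neg]
      congr 2
      ring
    · subst hn
      simp
    · have h5 := h0 ⟨n.natAbs, Int.natAbs_pos.2 hn.ne'⟩
      have h6 : ((n.natAbs : ℕ) : ℝ) = (n : ℝ) := by
        rw [Nat.cast_natAbs, abs_of_pos hn]
      simpa only [PNat.mk_coe, h6] using h5
  have hP := hasSum_sq_fourierCoeffOn hab (hHL.restrict (Set.Ioc (-ω) ω))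
  have hz : HasSum (fun i => ‖fourierCoeffOn hab H i‖ ^ 2) 0 := by
    simp [hcoef, hasSum_zero]
  have hP2 := hP.unique hz
  have hP3 : ∫ x in (-ω)..ω, ‖H x‖ ^ 2 = 0 := by
    rcases smul_eq_zero.1 hP2 with h3 | h3
    · exact absurd h3 (inv_ne_zero (by linarith))
    · exact h3
  rw [intervalIntegral.integral_of_le hab.le, integral_eq_zero_iff_of_nonneg] at hP3
  · have h4 := ae_restrict_of_ae_restrict_of_subset (s := Set.Ioo 0 ω) (t := Set.Ioc (-ω) ω)
      (fun x hx => ⟨by linarith [hx.1], hx.2.le⟩) hP3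
    filter_upwards [h4, ae_restrict_mem measurableSet_Ioo] with θ h5 hθ
    have h6 : g (-θ) = 0 := Set.indicator_of_notMem (fun hc => by linarith [hc.1, hθ.1]) _
    have h7 : g θ = h θ := Set.indicator_of_mem hθ _
    simp only [Pi.zero_apply, hH, h6, h7, sub_zero] at h5
    simpa using h5
  · exact fun x => by positivity
  · exact ((hHL.restrict _).integrable_norm_pow (by norm_num))

theorem integral_sin_mul_sin {ω : ℝ} (hω : 0 < ω) (j k : ℕ+) :
    ∫ θ in Set.Ioo 0 ω, Real.sin (j * Real.pi / ω * θ) * Real.sin (k * Real.pi / ω * θ)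
      = if j = k then ω / 2 else 0 := by
  have hcos : ∀ m : ℤ, m ≠ 0 → ∫ θ in (0 : ℝ)..ω, Real.cos (m * Real.pi / ω * θ) = 0 := by
    intro m hm
    have hm' : (m : ℝ) * Real.pi / ω ≠ 0 :=
      div_ne_zero (mul_ne_zero (by exact_mod_cast hm) Real.pi_ne_zero) hω.ne'
    rw [intervalIntegral.integral_comp_mul_left (fun x => Real.cos x) hm', integral_cos,
      div_mul_cancel₀ _ hω.ne', Real.sin_int_mul_pi]
    simp
  rw [← integral_Ioc_eq_integral_Ioo, ← intervalIntegral.integral_of_le hω.le]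
  have h1 : ∀ θ : ℝ, Real.sin (j * Real.pi / ω * θ) * Real.sin (k * Real.pi / ω * θ)
      = (1 / 2) * (Real.cos (((j : ℤ) - (k : ℤ) : ℤ) * Real.pi / ω * θ)
        - Real.cos (((j : ℤ) + (k : ℤ) : ℤ) * Real.pi / ω * θ)) := by
    intro θ
    have e1 : (((j : ℤ) - (k : ℤ) : ℤ) : ℝ) * Real.pi / ω * θ
        = j * Real.pi / ω * θ - k * Real.pi / ω * θ := by push_cast; ring
    have e2 : (((j : ℤ) + (k : ℤ) : ℤ) : ℝ) * Real.pi / ω * θ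
        = j * Real.pi / ω * θ + k * Real.pi / ω * θ := by push_cast; ring
    rw [e1, e2, Real.cos_sub, Real.cos_add]
    ring
  simp only [h1]
  rw [intervalIntegral.integral_const_mul, intervalIntegral.integral_sub
    (by apply Continuous.intervalIntegrable; fun_prop)
    (by apply Continuous.intervalIntegrable; fun_prop), hcos ((j : ℤ) + (k : ℤ)) (by positivity)]
  split_ifs with h
  · subst h
    simp
    ring
  · rw [hcos]
    · simp
    · intro hc
      apply h
      have : (j : ℕ) = (k : ℕ) := by omega
      exact PNat.eq this

/-- A square integrable function on `(0, ω)` is almost everywhere the sum of its sine series if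
the coefficients are summable. -/
theorem ae_eq_sine_series {ω : ℝ} (hω : 0 < ω) {h : ℝ → ℝ}
    (hL : MemLp h 2 (volume.restrict (Set.Ioo 0 ω))) {c : ℕ+ → ℝ} (hc : Summable fun k => |c k|)
    (h0 : ∀ k : ℕ+, ∫ θ in Set.Ioo 0 ω, h θ * Real.sin (k * Real.pi / ω * θ) = ω / 2 * c k) :
    ∀ᵐ θ ∂(volume.restrict (Set.Ioo 0 ω)), h θ = ∑' k, c k * Real.sin (k * Real.pi / ω * θ) := by
  have hb : ∀ k θ, ‖c k * Real.sin (k * Real.pi / ω * θ)‖ ≤ |c k| := by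
    intro k θ
    rw [norm_mul, Real.norm_eq_abs]
    exact mul_le_of_le_one_right (abs_nonneg _) (Real.abs_sin_le_one _)
  have hcont : Continuous fun θ => ∑' k, c k * Real.sin (k * Real.pi / ω * θ) :=
    continuous_tsum (fun k => by fun_prop) hc hb
  have hbd : ∀ θ, ‖∑' k, c k * Real.sin (k * Real.pi / ω * θ)‖ ≤ ∑' k, |c k| := fun θ =>
    tsum_of_norm_bounded hc.hasSum (fun k => hb k θ)
  have hS : MemLp (fun θ => ∑' k, c k * Real.sin (k * Real.pi / ω * θ)) 2
      (volume.restrict (Set.Ioo 0 ω)) :=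
    MemLp.of_bound hcont.aestronglyMeasurable _ (ae_of_all _ hbd)
  have := ae_eq_zero_of_sine_coeff hω (hL.sub hS) ?_
  · filter_upwards [this] with θ hθ
    simpa [sub_eq_zero] using hθ
  intro j
  have hI : ∀ g : ℝ → ℝ, MemLp g 2 (volume.restrict (Set.Ioo 0 ω)) →
      Integrable (fun θ => g θ * Real.sin (j * Real.pi / ω * θ))
        (volume.restrict (Set.Ioo 0 ω)) := by
    intro g hg
    refine (hg.integrable (by norm_num)).mul_bdd (c := 1) ?_ ?_
    · exact (by fun_prop : Continuous fun θ => Real.sin (j * Real.pi / ω * θ)).aestronglyMeasurable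
    · exact ae_of_all _ fun θ => Real.abs_sin_le_one _
  simp only [Pi.sub_apply, sub_mul]
  rw [integral_sub (hI _ hL) (hI _ hS), h0, sub_eq_zero]
  -- termwise integration of the sine series
  have hsum : HasSum (fun k => ∫ θ in Set.Ioo 0 ω, c k * Real.sin (k * Real.pi / ω * θ)
      * Real.sin (j * Real.pi / ω * θ))
      (∫ θ in Set.Ioo 0 ω, (∑' k, c k * Real.sin (k * Real.pi / ω * θ))
        * Real.sin (j * Real.pi / ω * θ)) := by
    refine hasSum_integral_of_dominated_convergence (fun k _ => |c k|) (fun k => ?_) (fun k => ?_)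
      ?_ ?_ ?_
    · exact (by fun_prop : Continuous fun θ => c k * Real.sin (k * Real.pi / ω * θ)
        * Real.sin (j * Real.pi / ω * θ)).aestronglyMeasurable
    · refine ae_of_all _ fun θ => ?_
      rw [norm_mul]
      exact (mul_le_of_le_one_right (norm_nonneg _) (Real.abs_sin_le_one _)).trans (hb k θ)
    · exact ae_of_all _ fun θ => hc
    · exact integrable_const _
    · exact ae_of_all _ fun θ =>
        ((Summable.of_norm_bounded hc (fun k => hb k θ)).hasSum).mul_right _
  refine (hsum.unique ?_).symm
  have h2 : (fun k : ℕ+ => ∫ θ in Set.Ioo 0 ω, c k * Real.sin (k * Real.pi / ω * θ)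
      * Real.sin (j * Real.pi / ω * θ)) = fun k => if k = j then ω / 2 * c j else 0 := by
    funext k
    simp only [mul_assoc (c k)]
    rw [integral_const_mul, integral_sin_mul_sin hω k j]
    split_ifs with h
    · rw [h, mul_comm]
    · simp
  rw [h2]
  exact hasSum_ite_eq j _

/-! ### Weights on the half-strip -/

/-- Continuous weights that vanish unless the first coordinate lies in a compact subinterval of
`(-∞, X)`. -/
structure IsWeight (X : ℝ) (κ : ℝ × ℝ → ℝ) : Prop where
  cont : Continuous κ
  supp : ∃ a b, b < X ∧ ∀ p : ℝ × ℝ, p.1 ∉ Set.Icc a b → κ p = 0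

theorem IsBump.isWeight {X : ℝ} {η : ℝ → ℝ} (h : IsBump X η) {σ : ℝ → ℝ} (hσ : Continuous σ) :
    IsWeight X fun p => η p.1 * σ p.2 := by
  obtain ⟨a, b, -, hb, hz⟩ := h.supp
  have := h.smooth.continuous
  exact ⟨by fun_prop, a, b, hb, fun p hp => by simp [hz _ hp]⟩

namespace IsWeight

variable {X ω : ℝ} {κ κ' : ℝ × ℝ → ℝ}

theorem mul_cont (h : IsWeight X κ) {g : ℝ × ℝ → ℝ} (hg : Continuous g) :
    IsWeight X fun p => g p * κ p := by
  obtain ⟨a, b, hb, hz⟩ := h.supp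
  exact ⟨hg.mul h.cont, a, b, hb, fun p hp => by simp [hz p hp]⟩

theorem add (h : IsWeight X κ) (h' : IsWeight X κ') : IsWeight X fun p => κ p + κ' p := by
  obtain ⟨a, b, hb, hz⟩ := h.supp
  obtain ⟨a', b', hb', hz'⟩ := h'.supp
  refine ⟨h.cont.add h'.cont, min a a', max b b', max_lt hb hb', fun p hx => ?_⟩
  rw [hz p, hz' p, add_zero]
  · exact fun hc => hx ⟨(min_le_right _ _).trans hc.1, hc.2.trans (le_max_right _ _)⟩
  · exact fun hc => hx ⟨(min_le_left _ _).trans hc.1, hc.2.trans (le_max_left _ _)⟩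

theorem bounded (h : IsWeight X κ) (ω : ℝ) : ∃ C, ∀ p ∈ halfStrip X ω, |κ p| ≤ C := by
  obtain ⟨a, b, hb, hz⟩ := h.supp
  have hK : IsCompact (Set.Icc a b ×ˢ Set.Icc (0 : ℝ) ω) := isCompact_Icc.prod isCompact_Icc
  obtain ⟨C, hC⟩ := hK.exists_bound_of_continuousOn h.cont.continuousOn
  refine ⟨max C 0, fun p hp => ?_⟩
  by_cases hx : p.1 ∈ Set.Icc a b
  · exact (hC p ⟨hx, hp.2.1.le, hp.2.2.le⟩).trans (le_max_left _ _)
  · rw [hz p hx, abs_zero]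
    exact le_max_right _ _

theorem integrableOn (h : IsWeight X κ) : IntegrableOn κ (halfStrip X ω) := by
  obtain ⟨a, b, hb, hz⟩ := h.supp
  have hK : IsCompact (Set.Icc a b ×ˢ Set.Icc (0 : ℝ) ω) := isCompact_Icc.prod isCompact_Icc
  have h1 : IntegrableOn κ (Set.Icc a b ×ˢ Set.Icc (0 : ℝ) ω) :=
    h.cont.continuousOn.integrableOn_compact hK
  refine h1.of_forall_sdiff_eq_zero (measurableSet_halfStrip X ω) fun p hp => hz p fun hc => ?_
  exact hp.2 ⟨hc, hp.1.2.1.le, hp.1.2.2.le⟩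

end IsWeight

theorem setIntegral_halfStrip {X ω : ℝ} {G : ℝ × ℝ → ℝ} (hG : IntegrableOn G (halfStrip X ω)) :
    ∫ p in halfStrip X ω, G p = ∫ x in Set.Iio X, ∫ θ in Set.Ioo 0 ω, G (x, θ) :=
  setIntegral_prod G hG

theorem setIntegral_halfStrip_symm {X ω : ℝ} {G : ℝ × ℝ → ℝ}
    (hG : IntegrableOn G (halfStrip X ω)) :
    ∫ p in halfStrip X ω, G p = ∫ θ in Set.Ioo 0 ω, ∫ x in Set.Iio X, G (x, θ) := by
  rw [setIntegral_halfStrip hG]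
  exact integral_integral_swap (f := fun x θ => G (x, θ))
    (by rw [Measure.prod_restrict]; exact hG)

/-! ### Integration by parts in logarithmic coordinates -/

theorem hasDerivAt_polarExp_fst (x θ : ℝ) :
    HasDerivAt (fun x : ℝ => polarExp (x, θ)) (polarExp (x, θ)) x := by
  have h : ∀ x : ℝ, polarExp (x, θ) = Complex.exp ((x : ℂ) + θ * Complex.I) := fun x => by
    rw [polarExp]
    congr 1
    apply Complex.ext <;> simp
  simp only [h]
  simpa using ((Complex.ofRealCLM.hasDerivAt (x := x)).add_const (θ * Complex.I)).cexp

theorem hasDerivAt_polarExp_snd (x θ : ℝ) :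
    HasDerivAt (fun θ : ℝ => polarExp (x, θ)) (Complex.I * polarExp (x, θ)) θ := by
  have h : ∀ θ : ℝ, polarExp (x, θ) = Complex.exp ((x : ℂ) + θ * Complex.I) := fun x => by
    rw [polarExp]
    congr 1
    apply Complex.ext <;> simp
  simp only [h]
  simpa [mul_comm] using
    (((Complex.ofRealCLM.hasDerivAt (x := θ)).mul_const Complex.I).const_add (x : ℂ)).cexp

section

variable {X ω : ℝ} {A : Set ℂ} {φ : ℂ → ℝ}

theorem fderiv_apply_eq (φ : ℂ → ℝ) (ζ v : ℂ) :
    fderiv ℝ φ ζ v = partial₁ φ ζ * v.re + partial₂ φ ζ * v.im := by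
  have : v = v.re • (1 : ℂ) + v.im • Complex.I := by
    apply Complex.ext <;> simp
  conv_lhs => rw [this]
  rw [map_add, map_smul, map_smul, partial₁, partial₂, smul_eq_mul, smul_eq_mul]
  ring

theorem IsTestFunction.hasFDerivAt (h : IsTestFunction A φ) (ζ : ℂ) :
    HasFDerivAt φ (fderiv ℝ φ ζ) ζ :=
  ((h.smooth.differentiable (by simp)) ζ).hasFDerivAt

theorem IsTestFunction.continuous_partial (h : IsTestFunction A φ) :
    Continuous (partial₁ φ) ∧ Continuous (partial₂ φ) := by
  have h1 : Continuous (fderiv ℝ φ) := h.smooth.continuous_fderiv (by simp)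
  exact ⟨h1.clm_apply continuous_const, h1.clm_apply continuous_const⟩

/-- The derivative of a function with gradient `(g₁, g₂)` along the first logarithmic coordinate,
the logarithm of the distance to the vertex. -/
def radial (g₁ g₂ : ℂ → ℝ) (p : ℝ × ℝ) : ℝ :=
  g₁ (polarExp p) * (polarExp p).re + g₂ (polarExp p) * (polarExp p).im

/-- The derivative of a function with gradient `(g₁, g₂)` along the second logarithmic coordinate,
the angle. -/
def angular (g₁ g₂ : ℂ → ℝ) (p : ℝ × ℝ) : ℝ :=
  g₂ (polarExp p) * (polarExp p).re - g₁ (polarExp p) * (polarExp p).im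

theorem IsTestFunction.hasDerivAt_fst (h : IsTestFunction A φ) (x θ : ℝ) :
    HasDerivAt (fun x => φ (polarExp (x, θ))) (radial (partial₁ φ) (partial₂ φ) (x, θ)) x := by
  have := (h.hasFDerivAt (polarExp (x, θ))).comp_hasDerivAt x (hasDerivAt_polarExp_fst x θ)
  rwa [fderiv_apply_eq] at this

theorem IsTestFunction.hasDerivAt_snd (h : IsTestFunction A φ) (x θ : ℝ) :
    HasDerivAt (fun θ => φ (polarExp (x, θ))) (angular (partial₁ φ) (partial₂ φ) (x, θ)) θ := by
  have := (h.hasFDerivAt (polarExp (x, θ))).comp_hasDerivAt θ (hasDerivAt_polarExp_snd x θ)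
  rw [fderiv_apply_eq] at this
  refine this.congr_deriv ?_
  simp [angular]
  ring

theorem IsTestFunction.eq_zero (h : IsTestFunction A φ) {ζ : ℂ} (hζ : ζ ∉ A) : φ ζ = 0 := by
  by_contra hc
  exact hζ (h.support_subset (subset_tsupport φ hc))

/-- Integration by parts of a test function of the domain against a field on the half-strip: no
condition on the field is needed at the sides, where the test function vanishes. -/
theorem IsTestFunction.integral_parts (h : IsTestFunction A φ) (hω : 0 < ω)
    (hω' : ω < 2 * Real.pi) (hAS : A ⊆ sector ω) {ξ η σ τ τ' : ℝ → ℝ} (hξ : IsBump X ξ)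
    (hη : IsBump X η) (hσ : Continuous σ) (hτ' : Continuous τ')
    (hτ : ∀ θ, HasDerivAt τ (τ' θ) θ) :
    ∫ p in halfStrip X ω, (radial (partial₁ φ) (partial₂ φ) p * (ξ p.1 * σ p.2) +
        angular (partial₁ φ) (partial₂ φ) p * (η p.1 * τ p.2))
      = - ∫ p in halfStrip X ω, φ (polarExp p) * (deriv ξ p.1 * σ p.2 + η p.1 * τ' p.2) := by
  have hcp := continuous_polarExp
  have hcφ : Continuous fun p => φ (polarExp p) := h.smooth.continuous.comp hcp
  obtain ⟨hc1, hc2⟩ := h.continuous_partial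
  have hcr : Continuous (radial (partial₁ φ) (partial₂ φ)) := by
    unfold radial
    have := Complex.continuous_re.comp hcp
    have := Complex.continuous_im.comp hcp
    fun_prop
  have hca : Continuous (angular (partial₁ φ) (partial₂ φ)) := by
    unfold angular
    have := Complex.continuous_re.comp hcp
    have := Complex.continuous_im.comp hcp
    fun_prop
  have hcτ : Continuous τ := continuous_iff_continuousAt.2 fun θ => (hτ θ).continuousAt
  have w1 := (hξ.isWeight hσ).mul_cont hcr
  have w2 := (hη.isWeight hcτ).mul_cont hca
  have w3 := (hξ.deriv.isWeight hσ).mul_cont hcφ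
  have w4 := (hη.isWeight hτ').mul_cont hcφ
  have e1 : ∫ p in halfStrip X ω, (radial (partial₁ φ) (partial₂ φ) p * (ξ p.1 * σ p.2)
      + φ (polarExp p) * (deriv ξ p.1 * σ p.2)) = 0 := by
    refine (setIntegral_halfStrip_symm (w1.add w3).integrableOn).trans ?_
    refine integral_eq_zero_of_ae (ae_of_all _ fun θ => ?_)
    change ∫ x in Set.Iio X, _ = 0
    rw [setIntegral_eq_integral_of_forall_compl_eq_zero]
    · have hd : ∀ x, HasDerivAt (fun x => φ (polarExp (x, θ)) * (ξ x * σ θ))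
          (radial (partial₁ φ) (partial₂ φ) (x, θ) * (ξ x * σ θ)
            + φ (polarExp (x, θ)) * (deriv ξ x * σ θ)) x := fun x =>
        (h.hasDerivAt_fst x θ).mul ((hξ.hasDerivAt x).mul_const _)
      have hcx : Continuous fun x : ℝ => ((x, θ) : ℝ × ℝ) := by fun_prop
      have hcφx := hcφ.comp hcx
      have hcrx := hcr.comp hcx
      have b1 : ∀ (ν : ℝ → ℝ) (_ : IsBump X ν) (g : ℝ → ℝ) (_ : Continuous g),
          Integrable fun x => g x * (ν x * σ θ) := by
        intro ν hν g hg
        refine Continuous.integrable_of_hasCompactSupport (hg.mul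
          (hν.smooth.continuous.mul continuous_const)) ?_
        exact hν.hasCompactSupport.mul_right.mul_left
      exact integral_eq_zero_of_hasDerivAt_of_integrable hd
        ((b1 ξ hξ _ hcrx).add (b1 _ hξ.deriv _ hcφx)) (b1 ξ hξ _ hcφx)
    · intro x hx
      have hx' : X ≤ x := not_lt.1 hx
      simp [hξ.eq_zero hx', hξ.deriv.eq_zero hx']
  have e2 : ∫ p in halfStrip X ω, (angular (partial₁ φ) (partial₂ φ) p * (η p.1 * τ p.2)
      + φ (polarExp p) * (η p.1 * τ' p.2)) = 0 := by
    refine (setIntegral_halfStrip (w2.add w4).integrableOn).trans ?_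
    refine integral_eq_zero_of_ae (ae_of_all _ fun x => ?_)
    change ∫ θ in Set.Ioo 0 ω, _ = 0
    have hd : ∀ θ, HasDerivAt (fun θ => φ (polarExp (x, θ)) * (η x * τ θ))
        (angular (partial₁ φ) (partial₂ φ) (x, θ) * (η x * τ θ)
          + φ (polarExp (x, θ)) * (η x * τ' θ)) θ := fun θ =>
      (h.hasDerivAt_snd x θ).mul ((hτ θ).const_mul _)
    have hcx : Continuous fun θ : ℝ => ((x, θ) : ℝ × ℝ) := by fun_prop
    have hcφx := hcφ.comp hcx
    have hcax := hca.comp hcx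
    rw [← integral_Ioc_eq_integral_Ioo, ← intervalIntegral.integral_of_le hω.le,
      intervalIntegral.integral_eq_sub_of_hasDerivAt (fun θ _ => hd θ)]
    · have z0 : φ (polarExp (x, 0)) = 0 := h.eq_zero fun hc => by
        have := (polarExp_mem_sector hω' (p := (x, 0)) le_rfl hω.le).1 (hAS hc)
        exact lt_irrefl _ this.1
      have z1 : φ (polarExp (x, ω)) = 0 := h.eq_zero fun hc => by
        have := (polarExp_mem_sector hω' (p := (x, ω)) hω.le le_rfl).1 (hAS hc)
        exact lt_irrefl _ this.2
      simp [z0, z1]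
    · apply Continuous.intervalIntegrable
      exact (hcax.mul (continuous_const.mul hcτ)).add (hcφx.mul (continuous_const.mul hτ'))
  rw [integral_add w1.integrableOn w3.integrableOn] at e1
  rw [integral_add w2.integrableOn w4.integrableOn] at e2
  rw [integral_add w1.integrableOn w2.integrableOn]
  simp only [mul_add]
  rw [integral_add w3.integrableOn w4.integrableOn]
  linarith

end

/-! ### Pairings of square integrable functions with weights -/

section

variable {X ω : ℝ} {A : Set ℂ} {κ : ℝ × ℝ → ℝ}

/-- The function on the sector whose pairing with `h` is that of the weight `κ` with
`h ∘ polarExp`. -/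
def planeWeight (κ : ℝ × ℝ → ℝ) (ζ : ℂ) : ℝ :=
  Real.exp (-2 * (polarLog ζ).1) * κ (polarLog ζ)

theorem exp_mul_planeWeight (hω : ω < 2 * Real.pi) {p : ℝ × ℝ} (hp : p ∈ halfStrip X ω)
    (h : ℂ → ℝ) : Real.exp (2 * p.1) * (h (polarExp p) * planeWeight κ (polarExp p))
      = h (polarExp p) * κ p := by
  rw [planeWeight, polarLog_polarExp hp.2.1.le (hp.2.2.trans hω)]
  have : Real.exp (2 * p.1) * Real.exp (-2 * p.1) = 1 := by
    rw [← Real.exp_add]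
    simp
  linear_combination (h (polarExp p) * κ p) * this

theorem IsWeight.integral_eq (hω : ω < 2 * Real.pi) (h : ℂ → ℝ) :
    ∫ p in halfStrip X ω, h (polarExp p) * κ p
      = ∫ ζ in sector ω ∩ Metric.ball 0 (Real.exp X), h ζ * planeWeight κ ζ := by
  rw [(integral_and_integrable_polarExp hω _).1]
  exact setIntegral_congr_fun (measurableSet_halfStrip X ω) fun p hp =>
    (exp_mul_planeWeight hω hp h).symm

theorem measurableSet_truncated (X ω : ℝ) :
    MeasurableSet (sector ω ∩ Metric.ball (0 : ℂ) (Real.exp X)) :=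
  ((isOpen_sector ω).inter Metric.isOpen_ball).measurableSet

theorem IsWeight.planeWeight_aesm (hκ : IsWeight X κ) :
    AEStronglyMeasurable (planeWeight κ)
      (volume.restrict (sector ω ∩ Metric.ball 0 (Real.exp X))) := by
  have h2 : Continuous fun p : ℝ × ℝ => Real.exp (-2 * p.1) * κ p :=
    (by fun_prop : Continuous fun p : ℝ × ℝ => Real.exp (-2 * p.1)).mul hκ.cont
  have h3 : ContinuousOn (planeWeight κ) (sector ω ∩ Metric.ball 0 (Real.exp X)) :=
    h2.comp_continuousOn ((continuousOn_polarLog ω).mono Set.inter_subset_left)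
  exact h3.aestronglyMeasurable (measurableSet_truncated X ω)

theorem IsWeight.planeWeight_bounded (hκ : IsWeight X κ) (ω : ℝ) :
    ∃ C, ∀ᵐ ζ ∂(volume.restrict (sector ω ∩ Metric.ball 0 (Real.exp X))),
      ‖planeWeight κ ζ‖ ≤ C := by
  obtain ⟨C, hC⟩ := (hκ.mul_cont (g := fun p => Real.exp (-2 * p.1)) (by fun_prop)).bounded ω
  refine ⟨C, ?_⟩
  filter_upwards [ae_restrict_mem (measurableSet_truncated X ω)] with ζ hζ
  exact hC _ (polarLog_mem_halfStrip hζ)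

instance isFiniteMeasure_truncated (X ω : ℝ) :
    IsFiniteMeasure ((volume : Measure ℂ).restrict (sector ω ∩ Metric.ball 0 (Real.exp X))) :=
  ⟨by
    rw [Measure.restrict_apply_univ]
    exact (measure_mono Set.inter_subset_right).trans_lt measure_ball_lt_top⟩

theorem IsWeight.integrableOn_mul (hκ : IsWeight X κ) (hω : ω < 2 * Real.pi) {h : ℂ → ℝ}
    (hh : MemLp h 2 (volume.restrict (sector ω ∩ Metric.ball 0 (Real.exp X)))) :
    IntegrableOn (fun p => h (polarExp p) * κ p) (halfStrip X ω) ∧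
    IntegrableOn (fun ζ => h ζ * planeWeight κ ζ) (sector ω ∩ Metric.ball 0 (Real.exp X)) := by
  obtain ⟨C, hC⟩ := hκ.planeWeight_bounded ω
  have h1 : IntegrableOn (fun ζ => h ζ * planeWeight κ ζ)
      (sector ω ∩ Metric.ball 0 (Real.exp X)) :=
    (hh.integrable (by norm_num)).mul_bdd hκ.planeWeight_aesm hC
  refine ⟨?_, h1⟩
  refine ((integral_and_integrable_polarExp hω _).2.1 h1).congr_fun (fun p hp => ?_)
    (measurableSet_halfStrip X ω)
  exact exp_mul_planeWeight hω hp h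

/-- Convergence in `L²` of the plane passes to the pairings with a weight on the half-strip. -/
theorem IsWeight.tendsto_integral (hκ : IsWeight X κ) (hω : ω < 2 * Real.pi) {h : ℂ → ℝ}
    {hn : ℕ → ℂ → ℝ}
    (hh : MemLp h 2 (volume.restrict (sector ω ∩ Metric.ball 0 (Real.exp X))))
    (hhn : ∀ n, MemLp (hn n) 2 (volume.restrict (sector ω ∩ Metric.ball 0 (Real.exp X))))
    (ht : Tendsto (fun n => eLpNorm (fun ζ => hn n ζ - h ζ) 2
      (volume.restrict (sector ω ∩ Metric.ball 0 (Real.exp X)))) atTop (𝓝 0)) :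
    Tendsto (fun n => ∫ p in halfStrip X ω, hn n (polarExp p) * κ p) atTop
      (𝓝 (∫ p in halfStrip X ω, h (polarExp p) * κ p)) := by
  simp only [IsWeight.integral_eq hω]
  obtain ⟨C, hC⟩ := hκ.planeWeight_bounded ω
  set μ := (volume : Measure ℂ).restrict (sector ω ∩ Metric.ball 0 (Real.exp X)) with hμ
  have hfin : (μ Set.univ) ^ (1 / ENNReal.toReal 1 - 1 / ENNReal.toReal 2) ≠ ⊤ := by
    refine ENNReal.rpow_ne_top_of_nonneg (by norm_num) (measure_ne_top _ _)
  -- on a set of finite measure, convergence in `L²` implies convergence in `L¹`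
  have h1 : Tendsto (fun n => eLpNorm (fun ζ => hn n ζ - h ζ) 1 μ) atTop (𝓝 0) := by
    have h2 := ENNReal.Tendsto.mul_const (b := (μ Set.univ) ^
      (1 / ENNReal.toReal 1 - 1 / ENNReal.toReal 2)) ht (Or.inr hfin)
    rw [zero_mul] at h2
    refine tendsto_of_tendsto_of_tendsto_of_le_of_le tendsto_const_nhds h2
      (fun _ => zero_le) fun n => ?_
    exact eLpNorm_le_eLpNorm_mul_rpow_measure_univ (by norm_num) ((hhn n).sub hh).1
  refine tendsto_integral_of_L1' _ (hκ.integrableOn_mul hω hh).2.aestronglyMeasurable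
    (.of_forall fun n => (hκ.integrableOn_mul hω (hhn n)).2) ?_
  have h3 := ENNReal.Tendsto.const_mul (a := ENNReal.ofReal C) h1
    (Or.inr ENNReal.ofReal_ne_top)
  rw [mul_zero] at h3
  refine tendsto_of_tendsto_of_tendsto_of_le_of_le tendsto_const_nhds h3
    (fun _ => zero_le) fun n => ?_
  refine eLpNorm_le_mul_eLpNorm_of_ae_le_mul ?_ 1
  filter_upwards [hC] with ζ hζ
  simp only [Pi.sub_apply, ← sub_mul]
  rw [norm_mul, mul_comm]
  gcongr

end

/-! ### Integration by parts for functions in `H¹₀` -/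

section

variable {X ω : ℝ} {A : Set ℂ} {u g₁ g₂ : ℂ → ℝ}

/-- A combination of the radial and angular derivatives in terms of the Cartesian components of the
gradient. -/
theorem radial_add_angular (g₁ g₂ : ℂ → ℝ) (a b : ℝ) (p : ℝ × ℝ) :
    radial g₁ g₂ p * a + angular g₁ g₂ p * b
      = g₁ (polarExp p) * ((polarExp p).re * a + -(polarExp p).im * b)
        + g₂ (polarExp p) * ((polarExp p).im * a + (polarExp p).re * b) := by
  rw [radial, angular]
  ring

theorem isWeight_fields {ξ η σ τ : ℝ → ℝ} (hξ : IsBump X ξ) (hη : IsBump X η)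
    (hσ : Continuous σ) (hτ : Continuous τ) :
    IsWeight X (fun p => (polarExp p).re * (ξ p.1 * σ p.2) + -(polarExp p).im * (η p.1 * τ p.2)) ∧
    IsWeight X
      (fun p => (polarExp p).im * (ξ p.1 * σ p.2) + (polarExp p).re * (η p.1 * τ p.2)) := by
  have hre := Complex.continuous_re.comp continuous_polarExp
  have him := Complex.continuous_im.comp continuous_polarExp
  exact ⟨((hξ.isWeight hσ).mul_cont hre).add ((hη.isWeight hτ).mul_cont him.neg),
    ((hξ.isWeight hσ).mul_cont him).add ((hη.isWeight hτ).mul_cont hre)⟩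

theorem MemLp.truncated (hAX : sector ω ∩ Metric.ball 0 (Real.exp X) ⊆ A) {h : ℂ → ℝ}
    (hh : MemLp h 2 (volume.restrict A)) :
    MemLp h 2 (volume.restrict (sector ω ∩ Metric.ball 0 (Real.exp X))) :=
  hh.mono_measure (Measure.restrict_mono hAX le_rfl)

theorem tendsto_eLpNorm_truncated (hAX : sector ω ∩ Metric.ball 0 (Real.exp X) ⊆ A) {h : ℂ → ℝ}
    {hn : ℕ → ℂ → ℝ}
    (ht : Tendsto (fun n => eLpNorm (fun ζ => hn n ζ - h ζ) 2 (volume.restrict A)) atTop (𝓝 0)) :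
    Tendsto (fun n => eLpNorm (fun ζ => hn n ζ - h ζ) 2
      (volume.restrict (sector ω ∩ Metric.ball 0 (Real.exp X)))) atTop (𝓝 0) :=
  tendsto_of_tendsto_of_tendsto_of_le_of_le tendsto_const_nhds ht (fun _ => zero_le)
    fun _ => eLpNorm_mono_measure _ (Measure.restrict_mono hAX le_rfl)

theorem IsTestFunction.memLp {φ : ℂ → ℝ} (h : IsTestFunction A φ) (S : Set ℂ) :
    MemLp φ 2 (volume.restrict S) ∧ MemLp (partial₁ φ) 2 (volume.restrict S) ∧
      MemLp (partial₂ φ) 2 (volume.restrict S) := by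
  have hc : HasCompactSupport (fderiv ℝ φ) := h.compact.fderiv ℝ
  refine ⟨(h.smooth.continuous.memLp_of_hasCompactSupport h.compact).restrict S,
    (h.continuous_partial.1.memLp_of_hasCompactSupport ?_).restrict S,
    (h.continuous_partial.2.memLp_of_hasCompactSupport ?_).restrict S⟩
  · exact hc.comp_left (g := fun L : ℂ →L[ℝ] ℝ => L 1) rfl
  · exact hc.comp_left (g := fun L : ℂ →L[ℝ] ℝ => L Complex.I) rfl

/-- Integration by parts of a function in `H¹₀` against a field on the half-strip; the boundary
terms at the sides vanish whatever the field. -/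
theorem IsH10With.integral_parts (hu : IsH10With A u g₁ g₂) (hω : 0 < ω)
    (hω' : ω < 2 * Real.pi) (hAS : A ⊆ sector ω)
    (hAX : sector ω ∩ Metric.ball 0 (Real.exp X) ⊆ A) {ξ η σ τ τ' : ℝ → ℝ} (hξ : IsBump X ξ)
    (hη : IsBump X η) (hσ : Continuous σ) (hτ' : Continuous τ')
    (hτ : ∀ θ, HasDerivAt τ (τ' θ) θ) :
    ∫ p in halfStrip X ω, (radial g₁ g₂ p * (ξ p.1 * σ p.2) +
        angular g₁ g₂ p * (η p.1 * τ p.2))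
      = - ∫ p in halfStrip X ω, u (polarExp p) * (deriv ξ p.1 * σ p.2 + η p.1 * τ' p.2) := by
  obtain ⟨φ, hφ, t0, t1, t2⟩ := hu.approx
  have hcτ : Continuous τ := continuous_iff_continuousAt.2 fun θ => (hτ θ).continuousAt
  obtain ⟨w1, w2⟩ := isWeight_fields hξ hη hσ hcτ
  have w3 := (hξ.deriv.isWeight hσ).add (hη.isWeight hτ')
  have m0 := MemLp.truncated hAX hu.memLp
  have m1 := MemLp.truncated hAX hu.memLp₁
  have m2 := MemLp.truncated hAX hu.memLp₂
  have n0 := fun n => ((hφ n).memLp (sector ω ∩ Metric.ball 0 (Real.exp X))).1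
  have n1 := fun n => ((hφ n).memLp (sector ω ∩ Metric.ball 0 (Real.exp X))).2.1
  have n2 := fun n => ((hφ n).memLp (sector ω ∩ Metric.ball 0 (Real.exp X))).2.2
  have l0 := w3.tendsto_integral hω' m0 n0 (tendsto_eLpNorm_truncated hAX t0)
  have l1 := w1.tendsto_integral hω' m1 n1 (tendsto_eLpNorm_truncated hAX t1)
  have l2 := w2.tendsto_integral hω' m2 n2 (tendsto_eLpNorm_truncated hAX t2)
  simp only [radial_add_angular]
  rw [integral_add (w1.integrableOn_mul hω' m1).1 (w2.integrableOn_mul hω' m2).1]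
  refine tendsto_nhds_unique (l1.add l2) (l0.neg.congr fun n => ?_)
  rw [← (hφ n).integral_parts hω hω' hAS hξ hη hσ hτ' hτ]
  simp only [radial_add_angular]
  rw [integral_add (w1.integrableOn_mul hω' (n1 n)).1 (w2.integrableOn_mul hω' (n2 n)).1]

/-! ### Test functions in product form -/

/-- The function `η (log ρ) χ (ϑ)` on the sector, extended by zero. -/
def productFun (ω : ℝ) (η χ : ℝ → ℝ) : ℂ → ℝ :=
  (sector ω).indicator fun ζ => η (polarLog ζ).1 * χ (polarLog ζ).2

theorem productFun_eventuallyEq {η χ : ℝ → ℝ} {ζ : ℂ} (hζ : ζ ∈ sector ω) :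
    productFun ω η χ =ᶠ[𝓝 ζ] fun ζ => η (sectorLog ζ).re * χ (sectorLog ζ).im := by
  filter_upwards [(isOpen_sector ω).mem_nhds hζ] with y hy
  rw [productFun, Set.indicator_of_mem hy]
  simp [sectorLog, polarLog]

theorem fderiv_productFun {η χ χ' : ℝ → ℝ} {ζ : ℂ} (hζ : ζ ∈ sector ω) (hη : IsBump X η)
    (hχ : ∀ θ, HasDerivAt χ (χ' θ) θ) (v : ℂ) :
    fderiv ℝ (productFun ω η χ) ζ v
      = deriv η (polarLog ζ).1 * χ (polarLog ζ).2 * (ζ⁻¹ * v).re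
        + η (polarLog ζ).1 * χ' (polarLog ζ).2 * (ζ⁻¹ * v).im := by
  have hre : (sectorLog ζ).re = (polarLog ζ).1 := by simp [sectorLog, polarLog]
  have him : (sectorLog ζ).im = (polarLog ζ).2 := by simp [sectorLog, polarLog]
  have hL : HasFDerivAt sectorLog ((ContinuousLinearMap.toSpanSingleton ℂ ζ⁻¹).restrictScalars ℝ :
      ℂ →L[ℝ] ℂ) ζ := (hasDerivAt_sectorLog hζ).hasFDerivAt.restrictScalars ℝ
  have h1 := (hη.hasDerivAt (sectorLog ζ).re).comp_hasFDerivAt ζ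
    (Complex.reCLM.hasFDerivAt.comp ζ hL)
  have h2 := (hχ (sectorLog ζ).im).comp_hasFDerivAt ζ
    (Complex.imCLM.hasFDerivAt.comp ζ hL)
  have h3 := (h1.mul h2).congr_of_eventuallyEq (productFun_eventuallyEq hζ)
  rw [h3.fderiv]
  simp [hre, him]
  ring

theorem contDiffAt_sectorLog {ζ : ℂ} (hζ : ζ ∈ sector ω) :
    ContDiffAt ℝ ((⊤ : ℕ∞) : WithTop ℕ∞) sectorLog ζ := by
  have h1 : ContDiffAt ℂ ((⊤ : ℕ∞) : WithTop ℕ∞)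
      (fun ζ : ℂ => Complex.log (-ζ) + Real.pi * Complex.I) ζ :=
    (((Complex.contDiffAt_log (sectorLog_eq hζ).2).comp ζ contDiff_neg.contDiffAt)).add
      contDiffAt_const
  refine (h1.restrict_scalars ℝ).congr_of_eventuallyEq ?_
  filter_upwards [(isOpen_sector ω).mem_nhds hζ] with y hy using (sectorLog_eq hy).1

/-- A product function is a test function if the support of its angular factor in `(0, ω)` is
compact. The values of `χ` outside `(0, ω)` do not matter. -/
theorem isTestFunction_productFun (hω' : ω < 2 * Real.pi)
    (hAX : sector ω ∩ Metric.ball 0 (Real.exp X) ⊆ A) {η χ : ℝ → ℝ} (hη : IsBump X η)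
    (hχ : ContDiff ℝ ((⊤ : ℕ∞) : WithTop ℕ∞) χ) {K : Set ℝ} (hK : IsCompact K)
    (hKω : K ⊆ Set.Ioo 0 ω) (hχK : ∀ θ ∈ Set.Ioo 0 ω, θ ∉ K → χ θ = 0) :
    IsTestFunction A (productFun ω η χ) := by
  obtain ⟨a, b, hab, hb, hz⟩ := hη.supp
  set T : Set ℂ := polarExp '' (Set.Icc a b ×ˢ K) with hT
  have hTc : IsCompact T := (isCompact_Icc.prod hK).image continuous_polarExp
  have hTs : T ⊆ sector ω ∩ Metric.ball 0 (Real.exp X) := by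
    rintro _ ⟨p, hp, rfl⟩
    exact polarExp_mem hω' ⟨hp.1.2.trans_lt hb, hKω hp.2⟩
  have hsupp : ∀ ζ, ζ ∉ T → productFun ω η χ ζ = 0 := by
    intro ζ hζ
    by_cases hs : ζ ∈ sector ω
    · rw [productFun, Set.indicator_of_mem hs]
      by_contra hc
      apply hζ
      refine ⟨polarLog ζ, ⟨?_, ?_⟩, polarExp_polarLog (ne_zero_of_mem_sector hs)⟩
      · by_contra h1
        exact hc (by rw [hz _ h1, zero_mul])
      · by_contra h1
        exact hc (by rw [hχK (polarLog ζ).2 hs h1, mul_zero])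
    · exact Set.indicator_of_notMem hs _
  have htT : tsupport (productFun ω η χ) ⊆ T := by
    refine closure_minimal (fun ζ hζ => ?_) hTc.isClosed
    by_contra hc
    exact hζ (hsupp ζ hc)
  refine ⟨contDiff_iff_contDiffAt.2 fun ζ => ?_, HasCompactSupport.of_support_subset_isCompact hTc
    ((subset_tsupport _).trans htT), htT.trans (hTs.trans hAX)⟩
  by_cases hζ : ζ ∈ T
  · have hs := (hTs hζ).1
    refine ContDiffAt.congr_of_eventuallyEq ?_ (productFun_eventuallyEq hs)
    have hL := contDiffAt_sectorLog hs
    exact (hη.smooth.contDiffAt.comp ζ (Complex.reCLM.contDiff.contDiffAt.comp ζ hL)).mul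
      (hχ.contDiffAt.comp ζ (Complex.imCLM.contDiff.contDiffAt.comp ζ hL))
  · refine (contDiffAt_const (c := (0 : ℝ))).congr_of_eventuallyEq ?_
    filter_upwards [hTc.isClosed.isOpen_compl.mem_nhds hζ] with y hy using hsupp y hy

/-- The weak formulation for a test function in product form. -/
theorem weak_productFun {f : ℂ → ℝ} (hω' : ω < 2 * Real.pi) (hA : IsOpen A)
    (hAS : A ⊆ sector ω) (hAX : sector ω ∩ Metric.ball 0 (Real.exp X) ⊆ A)
    (hw : ∀ ψ : ℂ → ℝ, IsTestFunction A ψ →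
      ∫ t in A, (g₁ t * partial₁ ψ t + g₂ t * partial₂ ψ t) = - ∫ t in A, f t * ψ t)
    {η χ χ' : ℝ → ℝ} (hη : IsBump X η)
    (hχ : ContDiff ℝ ((⊤ : ℕ∞) : WithTop ℕ∞) χ) (hχ' : ∀ θ, HasDerivAt χ (χ' θ) θ)
    {K : Set ℝ} (hK : IsCompact K)
    (hKω : K ⊆ Set.Ioo 0 ω) (hχK : ∀ θ ∈ Set.Ioo 0 ω, θ ∉ K → χ θ = 0) :
    ∫ p in halfStrip X ω, (radial g₁ g₂ p * (deriv η p.1 * χ p.2) +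
        angular g₁ g₂ p * (η p.1 * χ' p.2))
      = - ∫ p in halfStrip X ω, f (polarExp p) * (Real.exp (2 * p.1) * (η p.1 * χ p.2)) := by
  have hψ := isTestFunction_productFun hω' hAX hη hχ hK hKω hχK
  have key := hw _ hψ
  have hX : ∀ t ∈ A \ (sector ω ∩ Metric.ball 0 (Real.exp X)), X ≤ (polarLog t).1 := by
    rintro t ⟨h1, h2⟩
    by_contra hc
    refine h2 ⟨hAS h1, ?_⟩
    rw [mem_ball_zero_iff]
    exact (Real.log_lt_iff_lt_exp (norm_pos_iff.2 (ne_zero_of_mem_sector (hAS h1)))).1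
      (not_le.1 hc)
  rw [setIntegral_eq_of_subset_of_forall_sdiff_eq_zero hA.measurableSet hAX (fun t ht => ?_),
    setIntegral_eq_of_subset_of_forall_sdiff_eq_zero hA.measurableSet hAX (fun t ht => ?_),
    (integral_and_integrable_polarExp hω' _).1, (integral_and_integrable_polarExp hω' _).1] at key
  · refine Eq.trans (setIntegral_congr_fun (measurableSet_halfStrip X ω) fun p hp => ?_)
      (key.trans (congrArg Neg.neg (setIntegral_congr_fun (measurableSet_halfStrip X ω)
        fun p hp => ?_)))
    · have hs := (polarExp_mem hω' hp).1
      have hl := polarLog_polarExp hp.2.1.le (hp.2.2.trans hω')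
      simp only [partial₁, partial₂, fderiv_productFun hs hη hχ', hl]
      have hn : Real.exp (2 * p.1) * Complex.normSq (polarExp p)⁻¹ = 1 := by
        rw [map_inv₀, Complex.normSq_eq_norm_sq, norm_polarExp, ← Real.exp_nat_mul]
        exact mul_inv_cancel₀ (Real.exp_pos _).ne'
      have hi : ((polarExp p)⁻¹).re = (polarExp p).re * Complex.normSq (polarExp p)⁻¹ := by
        rw [Complex.inv_re, map_inv₀]
        rfl
      have hi' : ((polarExp p)⁻¹).im = -(polarExp p).im * Complex.normSq (polarExp p)⁻¹ := by
        rw [Complex.inv_im, map_inv₀]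
        rfl
      simp only [mul_one, Complex.mul_re, Complex.mul_im, Complex.I_re, Complex.I_im, mul_zero,
        zero_sub, add_zero, hi, hi', radial, angular]
      linear_combination (-((g₁ (polarExp p) * (polarExp p).re + g₂ (polarExp p) * (polarExp p).im)
        * (deriv η p.1 * χ p.2) + (g₂ (polarExp p) * (polarExp p).re - g₁ (polarExp p) *
        (polarExp p).im) * (η p.1 * χ' p.2))) * hn
    · have hs := (polarExp_mem hω' hp).1
      have hl := polarLog_polarExp hp.2.1.le (hp.2.2.trans hω')
      simp only [productFun, Set.indicator_of_mem hs, hl]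
      ring
  · rw [productFun, Set.indicator_of_mem (hAS ht.1), hη.eq_zero (hX t ht)]
    simp
  · simp only [partial₁, partial₂, fderiv_productFun (hAS ht.1) hη hχ', hη.eq_zero (hX t ht),
      hη.deriv.eq_zero (hX t ht)]
    simp

end

/-! ### Separation of variables for the Dirichlet solution -/

/-- A smooth odd function that vanishes near `0` and is the identity away from `0`. It serves to
cut off functions near their zeros. -/
def tame (y : ℝ) : ℝ := y * Real.smoothTransition (y ^ 2 - 1)

theorem contDiff_tame : ContDiff ℝ ((⊤ : ℕ∞) : WithTop ℕ∞) tame :=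
  contDiff_id.mul (Real.smoothTransition.contDiff.comp ((contDiff_id.pow 2).sub contDiff_const))

theorem tame_eq_zero {y : ℝ} (h : |y| ≤ 1) : tame y = 0 := by
  have : y ^ 2 ≤ 1 := by
    rw [← sq_abs]
    nlinarith [abs_nonneg y]
  rw [tame, Real.smoothTransition.zero_of_nonpos (by linarith), mul_zero]

theorem tame_eq_self {y : ℝ} (h : 2 ≤ |y|) : tame y = y := by
  have : 4 ≤ y ^ 2 := by
    rw [← sq_abs]
    nlinarith [abs_nonneg y]
  rw [tame, Real.smoothTransition.one_of_one_le (by linarith), mul_one]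

theorem abs_tame_le (y : ℝ) : |tame y| ≤ |y| := by
  rw [tame, abs_mul, abs_of_nonneg (Real.smoothTransition.nonneg _)]
  exact mul_le_of_le_one_right (abs_nonneg _) (Real.smoothTransition.le_one _)

theorem deriv_tame_eq_one {y : ℝ} (h : 2 < |y|) : deriv tame y = 1 := by
  have : tame =ᶠ[𝓝 y] id := by
    filter_upwards [(isOpen_lt continuous_const continuous_abs).mem_nhds h] with z hz
    exact tame_eq_self (le_of_lt hz)
  rw [this.deriv_eq, deriv_id]

theorem exists_bound_deriv_tame : ∃ C, ∀ y, |deriv tame y| ≤ C := by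
  have hc : Continuous (deriv tame) := contDiff_tame.continuous_deriv (by simp)
  obtain ⟨C, hC⟩ := (isCompact_Icc (a := (-2 : ℝ)) (b := 2)).exists_bound_of_continuousOn
    hc.continuousOn
  refine ⟨max C 1, fun y => ?_⟩
  by_cases hy : 2 < |y|
  · rw [deriv_tame_eq_one hy, abs_one]
    exact le_max_right _ _
  · exact (hC y (abs_le.1 (not_lt.1 hy))).trans (le_max_left _ _)

theorem ae_sin_ne_zero {s : ℝ} (hs : s ≠ 0) : ∀ᵐ p : ℝ × ℝ, Real.sin (s * p.2) ≠ 0 := by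
  have h1 : ∀ᵐ θ : ℝ, Real.sin (s * θ) ≠ 0 := by
    have hc : (Set.range fun n : ℤ => (n : ℝ) * Real.pi / s).Countable := Set.countable_range _
    filter_upwards [hc.ae_notMem volume] with θ hθ h0
    obtain ⟨n, hn⟩ := Real.sin_eq_zero_iff.1 h0
    exact hθ ⟨n, by simp only; rw [hn]; field_simp⟩
  exact Measure.quasiMeasurePreserving_snd.ae h1

section

variable {X ω : ℝ} {A : Set ℂ} {u f g₁ g₂ : ℂ → ℝ}

theorem integrableOn_fields (hω' : ω < 2 * Real.pi)
    (h1 : MemLp g₁ 2 (volume.restrict (sector ω ∩ Metric.ball 0 (Real.exp X))))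
    (h2 : MemLp g₂ 2 (volume.restrict (sector ω ∩ Metric.ball 0 (Real.exp X))))
    {ξ η σ τ : ℝ → ℝ} (hξ : IsBump X ξ) (hη : IsBump X η) (hσ : Continuous σ)
    (hτ : Continuous τ) :
    IntegrableOn (fun p => radial g₁ g₂ p * (ξ p.1 * σ p.2) + angular g₁ g₂ p * (η p.1 * τ p.2))
      (halfStrip X ω) := by
  obtain ⟨w1, w2⟩ := isWeight_fields hξ hη hσ hτ
  simp only [radial_add_angular]
  exact (w1.integrableOn_mul hω' h1).1.add (w2.integrableOn_mul hω' h2).1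

theorem IsBump.zero (X : ℝ) : IsBump X fun _ => 0 :=
  ⟨contDiff_const, X - 1, X - 1, le_rfl, by linarith, fun _ _ => rfl⟩

/-- The weak formulation also holds for `η (log ρ) sin (s ϑ)`, which vanishes on the sides of the
sector but whose support touches them. -/
theorem weak_sin (hω : 0 < ω) (hω' : ω < 2 * Real.pi) (hA : IsOpen A)
    (hAS : A ⊆ sector ω) (hAX : sector ω ∩ Metric.ball 0 (Real.exp X) ⊆ A)
    (hf : MemLp f 2 (volume.restrict A)) (h1 : MemLp g₁ 2 (volume.restrict A))
    (h2 : MemLp g₂ 2 (volume.restrict A))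
    (hw : ∀ ψ : ℂ → ℝ, IsTestFunction A ψ →
      ∫ t in A, (g₁ t * partial₁ ψ t + g₂ t * partial₂ ψ t) = - ∫ t in A, f t * ψ t)
    {η : ℝ → ℝ} (hη : IsBump X η) {s : ℝ} (hs : 0 < s) (hsω : Real.sin (s * ω) = 0) :
    ∫ p in halfStrip X ω, (radial g₁ g₂ p * (deriv η p.1 * Real.sin (s * p.2)) +
        angular g₁ g₂ p * (η p.1 * (s * Real.cos (s * p.2))))
      = - ∫ p in halfStrip X ω, f (polarExp p) *
          (Real.exp (2 * p.1) * (η p.1 * Real.sin (s * p.2))) := by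
  -- the cut-off functions `χ n` equal `sin (s θ)` where `|sin (s θ)| ≥ 2 / (n + 1)`
  set χ : ℕ → ℝ → ℝ := fun n θ => tame (((n : ℝ) + 1) * Real.sin (s * θ)) / ((n : ℝ) + 1) with hχ
  set χ' : ℕ → ℝ → ℝ := fun n θ => deriv tame (((n : ℝ) + 1) * Real.sin (s * θ)) *
    (s * Real.cos (s * θ)) with hχ'
  have hpos : ∀ n : ℕ, (0 : ℝ) < (n : ℝ) + 1 := fun n => by positivity
  have hsin : ∀ θ, HasDerivAt (fun θ => Real.sin (s * θ)) (s * Real.cos (s * θ)) θ := fun θ => by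
    have := ((hasDerivAt_id θ).const_mul s).sin
    simpa [mul_comm] using this
  have hsinc : ContDiff ℝ ((⊤ : ℕ∞) : WithTop ℕ∞) fun θ => Real.sin (s * θ) :=
    Real.contDiff_sin.comp (contDiff_const.mul contDiff_id)
  have hχs : ∀ n, ContDiff ℝ ((⊤ : ℕ∞) : WithTop ℕ∞) (χ n) := fun n =>
    (contDiff_tame.comp (contDiff_const.mul hsinc)).div_const _
  have hχd : ∀ n θ, HasDerivAt (χ n) (χ' n θ) θ := by
    intro n θ
    have h3 : HasDerivAt tame (deriv tame (((n : ℝ) + 1) * Real.sin (s * θ)))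
        (((n : ℝ) + 1) * Real.sin (s * θ)) :=
      ((contDiff_tame.differentiable (by simp)) _).hasDerivAt
    have h4 := (h3.comp θ ((hsin θ).const_mul ((n : ℝ) + 1))).div_const ((n : ℝ) + 1)
    refine h4.congr_deriv ?_
    have := (hpos n).ne'
    simp only [hχ']
    field_simp
  have hχc : ∀ n, Continuous (χ' n) := fun n => by
    have : Continuous (deriv tame) := contDiff_tame.continuous_deriv (by simp)
    simp only [hχ']
    fun_prop
  have hweak : ∀ n : ℕ, ∫ p in halfStrip X ω, (radial g₁ g₂ p * (deriv η p.1 * χ n p.2) +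
        angular g₁ g₂ p * (η p.1 * χ' n p.2))
      = - ∫ p in halfStrip X ω, f (polarExp p) * (Real.exp (2 * p.1) * (η p.1 * χ n p.2)) := by
    intro n
    let K : Set ℝ := Set.Icc 0 ω ∩ {θ | 1 ≤ |((n : ℝ) + 1) * Real.sin (s * θ)|}
    have hK : IsCompact K := isCompact_Icc.inter_right
      (isClosed_le continuous_const (by fun_prop))
    have hKω : K ⊆ Set.Ioo 0 ω := by
      rintro θ ⟨hθ, hθ'⟩
      refine ⟨lt_of_le_of_ne hθ.1 ?_, lt_of_le_of_ne hθ.2 ?_⟩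
      · rintro rfl
        simp at hθ'
        linarith
      · rintro rfl
        simp [hsω] at hθ'
        linarith
    have hχK : ∀ θ ∈ Set.Ioo 0 ω, θ ∉ K → χ n θ = 0 := by
      intro θ hθ hθK
      have : |((n : ℝ) + 1) * Real.sin (s * θ)| ≤ 1 := by
        by_contra hc
        exact hθK ⟨⟨hθ.1.le, hθ.2.le⟩, (not_le.1 hc).le⟩
      simp only [hχ, tame_eq_zero this, zero_div]
    exact weak_productFun hω' hA hAS hAX hw hη (hχs n) (hχd n) hK hKω hχK
  have m1 := MemLp.truncated hAX h1
  have m2 := MemLp.truncated hAX h2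
  have mf := MemLp.truncated hAX hf
  obtain ⟨C, hC⟩ := exists_bound_deriv_tame
  have hC0 : 0 ≤ C := (abs_nonneg _).trans (hC 0)
  have hχb : ∀ n θ, |χ n θ| ≤ 1 := by
    intro n θ
    simp only [hχ]
    rw [abs_div, abs_of_pos (hpos n), div_le_one (hpos n)]
    refine (abs_tame_le _).trans ?_
    rw [abs_mul, abs_of_pos (hpos n)]
    exact mul_le_of_le_one_right (hpos n).le (Real.abs_sin_le_one _)
  have hχ'b : ∀ n θ, |χ' n θ| ≤ C * s := by
    intro n θ
    simp only [hχ']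
    rw [abs_mul, abs_mul, abs_of_pos hs]
    exact mul_le_mul (hC _) (mul_le_of_le_one_right hs.le (Real.abs_cos_le_one _))
      (by positivity) hC0
  have hlim : ∀ θ, Real.sin (s * θ) ≠ 0 → ∀ᶠ n : ℕ in atTop, χ n θ = Real.sin (s * θ) ∧
      χ' n θ = s * Real.cos (s * θ) := by
    intro θ hθ
    have h3 : Tendsto (fun n : ℕ => ((n : ℝ) + 1) * |Real.sin (s * θ)|) atTop atTop :=
      (tendsto_atTop_add_const_right _ _ tendsto_natCast_atTop_atTop).atTop_mul_const
        (abs_pos.2 hθ)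
    filter_upwards [h3.eventually_gt_atTop 2] with n hn
    have h4 : 2 < |((n : ℝ) + 1) * Real.sin (s * θ)| := by
      rwa [abs_mul, abs_of_pos (hpos n)]
    simp only [hχ, hχ']
    rw [tame_eq_self h4.le, deriv_tame_eq_one h4, mul_div_cancel_left₀ _ (hpos n).ne', one_mul]
    exact ⟨rfl, rfl⟩
  have hae := ae_restrict_of_ae (s := halfStrip X ω) (ae_sin_ne_zero hs.ne')
  have L1 : Tendsto (fun n => ∫ p in halfStrip X ω, (radial g₁ g₂ p * (deriv η p.1 * χ n p.2) +
        angular g₁ g₂ p * (η p.1 * χ' n p.2))) atTop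
      (𝓝 (∫ p in halfStrip X ω, (radial g₁ g₂ p * (deriv η p.1 * Real.sin (s * p.2)) +
        angular g₁ g₂ p * (η p.1 * (s * Real.cos (s * p.2)))))) := by
    have i1 : IntegrableOn (fun p => radial g₁ g₂ p * (deriv η p.1 * (1 : ℝ)) +
        angular g₁ g₂ p * (0 * (0 : ℝ))) (halfStrip X ω) :=
      integrableOn_fields hω' m1 m2 hη.deriv (IsBump.zero X) (σ := fun _ => 1) (τ := fun _ => 0)
        continuous_const continuous_const
    have i2 : IntegrableOn (fun p => radial g₁ g₂ p * (0 * (0 : ℝ)) +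
        angular g₁ g₂ p * (η p.1 * (C * s))) (halfStrip X ω) :=
      integrableOn_fields hω' m1 m2 (IsBump.zero X) hη (σ := fun _ => 0) (τ := fun _ => C * s)
        continuous_const continuous_const
    refine tendsto_integral_of_dominated_convergence _ (fun n => ?_) (i1.norm.add i2.norm)
      (fun n => ?_) ?_
    · exact (integrableOn_fields hω' m1 m2 hη.deriv hη (hχs n).continuous
        (hχc n)).aestronglyMeasurable
    · refine ae_of_all _ fun p => (norm_add_le _ _).trans ?_
      simp only [Pi.add_apply, mul_zero, add_zero, zero_add, mul_one, norm_mul, Real.norm_eq_abs]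
      rw [abs_of_nonneg hC0, abs_of_pos hs]
      refine add_le_add ?_ ?_
      · exact mul_le_mul_of_nonneg_left (mul_le_of_le_one_right (abs_nonneg _) (hχb n _))
          (abs_nonneg _)
      · exact mul_le_mul_of_nonneg_left (mul_le_mul_of_nonneg_left (hχ'b n _) (abs_nonneg _))
          (abs_nonneg _)
    · filter_upwards [hae] with p hp
      refine tendsto_const_nhds.congr' ?_
      filter_upwards [hlim _ hp] with n hn
      rw [hn.1, hn.2]
  have L2 : Tendsto (fun n => ∫ p in halfStrip X ω, f (polarExp p) *
      (Real.exp (2 * p.1) * (η p.1 * χ n p.2))) atTop (𝓝 (∫ p in halfStrip X ω, f (polarExp p) *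
      (Real.exp (2 * p.1) * (η p.1 * Real.sin (s * p.2))))) := by
    have hw0 : ∀ σ : ℝ → ℝ, Continuous σ → IntegrableOn (fun p => f (polarExp p) *
        (Real.exp (2 * p.1) * (η p.1 * σ p.2))) (halfStrip X ω) := fun σ hσ =>
      (((hη.isWeight hσ).mul_cont (g := fun p => Real.exp (2 * p.1))
        (by fun_prop)).integrableOn_mul hω' mf).1
    refine tendsto_integral_of_dominated_convergence _ (fun n => ?_)
      (hw0 (fun _ => 1) continuous_const).norm (fun n => ?_) ?_
    · exact (hw0 _ (hχs n).continuous).aestronglyMeasurable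
    · refine ae_of_all _ fun p => ?_
      simp only [norm_mul, Real.norm_eq_abs, abs_one]
      gcongr
      exact hχb n _
    · filter_upwards [hae] with p hp
      refine tendsto_const_nhds.congr' ?_
      filter_upwards [hlim _ hp] with n hn
      rw [hn.1]
  exact tendsto_nhds_unique L1 (L2.neg.congr fun n => (hweak n).symm)

/-- Separation of variables for the Dirichlet solution: the weak form of the ordinary differential
equation satisfied by its sine coefficients. -/
theorem IsDirichletSolution.weak_ode (hω : 0 < ω) (hω' : ω < 2 * Real.pi) (hA : IsOpen A)
    (hAS : A ⊆ sector ω) (hAX : sector ω ∩ Metric.ball 0 (Real.exp X) ⊆ A)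
    (hf : MemLp f 2 (volume.restrict A)) (hu : IsDirichletSolution A f u)
    {η : ℝ → ℝ} (hη : IsBump X η) {s : ℝ} (hs : 0 < s) (hsω : Real.sin (s * ω) = 0) :
    ∫ p in halfStrip X ω, u (polarExp p) *
        ((deriv (deriv η) p.1 - s ^ 2 * η p.1) * Real.sin (s * p.2))
      = ∫ p in halfStrip X ω, f (polarExp p) *
          (Real.exp (2 * p.1) * (η p.1 * Real.sin (s * p.2))) := by
  obtain ⟨g₁, g₂, hH, hw⟩ := hu
  have e1 := weak_sin hω hω' hA hAS hAX hf hH.memLp₁ hH.memLp₂ hw hη hs hsω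
  have hcos : ∀ θ, HasDerivAt (fun θ => s * Real.cos (s * θ)) (-(s ^ 2 * Real.sin (s * θ))) θ :=
    fun θ => by
      have := (((hasDerivAt_id θ).const_mul s).cos).const_mul s
      refine this.congr_deriv ?_
      simp
      ring
  have e2 := hH.integral_parts hω hω' hAS hAX hη.deriv hη (σ := fun θ => Real.sin (s * θ))
    (by fun_prop) (by fun_prop) hcos
  rw [e1, neg_inj] at e2
  rw [e2]
  refine integral_congr_ae (ae_of_all _ fun p => ?_)
  simp only
  ring

/-- The sine coefficients of a function in `H¹₀` of the corner domain stay bounded, in an averaged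
sense, as the vertex is approached: this is where the finiteness of the energy is used. -/
theorem IsDirichletSolution.bounded_coeff (hω : 0 < ω) (hω' : ω < 2 * Real.pi)
    (hAS : A ⊆ sector ω) (hAX : sector ω ∩ Metric.ball 0 (Real.exp X) ⊆ A)
    (hu : IsDirichletSolution A f u) {s : ℝ} (hs : 0 < s) :
    ∃ C, ∀ η, IsBump X η →
      |∫ p in halfStrip X ω, u (polarExp p) * (η p.1 * Real.sin (s * p.2))|
        ≤ C * (1 + ∫ x, η x ^ 2) := by
  obtain ⟨g₁, g₂, hH, -⟩ := hu
  have m1 := MemLp.truncated hAX hH.memLp₁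
  have m2 := MemLp.truncated hAX hH.memLp₂
  -- the Dirichlet integral is invariant under the change of variables
  have hE : IntegrableOn (fun p : ℝ × ℝ => Real.exp (2 * p.1) * (g₁ (polarExp p) ^ 2
      + g₂ (polarExp p) ^ 2)) (halfStrip X ω) :=
    (integral_and_integrable_polarExp hω' _).2.1
      ((m1.integrable_sq).add (m2.integrable_sq))
  set E := ∫ p in halfStrip X ω, Real.exp (2 * p.1) * (g₁ (polarExp p) ^ 2
      + g₂ (polarExp p) ^ 2) with hEdef
  have hE0 : 0 ≤ E := integral_nonneg fun p => by positivity
  refine ⟨(E + ω) / s, fun η hη => ?_⟩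
  have hsin : ∀ θ, HasDerivAt (fun θ => -Real.cos (s * θ)) (s * Real.sin (s * θ)) θ := fun θ => by
    have := (((hasDerivAt_id θ).const_mul s).cos).neg
    refine this.congr_deriv ?_
    simp
    ring
  have e1 := hH.integral_parts hω hω' hAS hAX (IsBump.zero X) hη (σ := fun _ => 0)
    continuous_const (by fun_prop) hsin
  have i1 := integrableOn_fields hω' m1 m2 (IsBump.zero X) hη (σ := fun _ => 0)
    (τ := fun θ => -Real.cos (s * θ)) continuous_const (by fun_prop)
  simp only [mul_zero, zero_add] at e1 i1
  have hη2 : IntegrableOn (fun p : ℝ × ℝ => η p.1 ^ 2) (halfStrip X ω) := by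
    have h3 := ((hη.mul_smooth hη.smooth).isWeight (σ := fun _ => 1)
      continuous_const).integrableOn (ω := ω)
    refine h3.congr_fun (fun p _ => ?_) (measurableSet_halfStrip X ω)
    simp only
    ring
  have e2 : ∫ p in halfStrip X ω, η p.1 ^ 2 = ω * ∫ x, η x ^ 2 := by
    rw [setIntegral_halfStrip hη2]
    simp only [integral_const, smul_eq_mul]
    rw [integral_const_mul, setIntegral_eq_integral_of_forall_compl_eq_zero (fun x hx => by
      rw [hη.eq_zero (not_lt.1 hx)]; simp)]
    simp [hω.le]
  have e3 : ∫ p in halfStrip X ω, u (polarExp p) * (η p.1 * Real.sin (s * p.2))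
      = -(1 / s) * ∫ p in halfStrip X ω, angular g₁ g₂ p * (η p.1 * -Real.cos (s * p.2)) := by
    rw [e1]
    rw [neg_mul_neg, ← integral_const_mul]
    refine integral_congr_ae (ae_of_all _ fun p => ?_)
    field_simp
  have e4 : |∫ p in halfStrip X ω, angular g₁ g₂ p * (η p.1 * -Real.cos (s * p.2))|
      ≤ E + ω * ∫ x, η x ^ 2 := by
    rw [← e2, hEdef, ← integral_add hE hη2]
    refine (abs_integral_le_integral_abs).trans (integral_mono i1.abs (hE.add hη2) fun p => ?_)
    have hn : Real.exp (2 * p.1) = (polarExp p).re ^ 2 + (polarExp p).im ^ 2 := by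
      have h5 := norm_polarExp p
      have h6 := Complex.normSq_eq_norm_sq (polarExp p)
      rw [h5, Complex.normSq_apply, ← Real.exp_nat_mul] at h6
      push_cast at h6
      rw [← h6]
      ring
    simp only [angular]
    rw [hn]
    set P := (polarExp p).re
    set Q := (polarExp p).im
    set G₁ := g₁ (polarExp p)
    set G₂ := g₂ (polarExp p)
    set c := Real.cos (s * p.2)
    have hc : c ^ 2 ≤ 1 := Real.cos_sq_le_one _
    have hηc : (η p.1 * c) ^ 2 ≤ η p.1 ^ 2 := by
      rw [mul_pow]
      exact mul_le_of_le_one_right (sq_nonneg _) hc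
    rw [abs_le]
    constructor <;>
      nlinarith [sq_nonneg (G₁ * P + G₂ * Q), sq_nonneg (G₂ * P - G₁ * Q - η p.1 * c),
        sq_nonneg (G₂ * P - G₁ * Q + η p.1 * c), sq_nonneg (G₂ * P - G₁ * Q),
        sq_nonneg (η p.1 * c), sq_nonneg (η p.1)]
  rw [e3, abs_mul, abs_neg, abs_of_pos (by positivity : 0 < 1 / s)]
  have h0 : 0 ≤ ∫ x, η x ^ 2 := integral_nonneg fun x => sq_nonneg _
  calc 1 / s * _ ≤ 1 / s * (E + ω * ∫ x, η x ^ 2) := by gcongr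
    _ ≤ 1 / s * ((E + ω) * (1 + ∫ x, η x ^ 2)) := by
        gcongr
        nlinarith
    _ = _ := by ring

end

/-! ### Green's formula on the half-strip -/

/-- `E` is twice continuously differentiable in each of its two variables, with Laplacian `L`. -/
def HasLaplace {V : Type*} [NormedAddCommGroup V] [NormedSpace ℝ V] (E L : ℝ × ℝ → V) : Prop :=
  ∃ E₁ E₁₁ E₂ E₂₂ : ℝ × ℝ → V, Continuous E ∧ Continuous E₁ ∧ Continuous E₁₁ ∧ Continuous E₂ ∧
    Continuous E₂₂ ∧ (∀ x θ, HasDerivAt (fun x => E (x, θ)) (E₁ (x, θ)) x) ∧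
    (∀ x θ, HasDerivAt (fun x => E₁ (x, θ)) (E₁₁ (x, θ)) x) ∧
    (∀ x θ, HasDerivAt (fun θ => E (x, θ)) (E₂ (x, θ)) θ) ∧
    (∀ x θ, HasDerivAt (fun θ => E₂ (x, θ)) (E₂₂ (x, θ)) θ) ∧ ∀ p, L p = E₁₁ p + E₂₂ p

namespace HasLaplace

variable {V V' : Type*} [NormedAddCommGroup V] [NormedSpace ℝ V] [NormedAddCommGroup V']
  [NormedSpace ℝ V'] {E E' L L' : ℝ × ℝ → V}

theorem map (h : HasLaplace E L) (T : V →L[ℝ] V') :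
    HasLaplace (fun p => T (E p)) (fun p => T (L p)) := by
  obtain ⟨E₁, E₁₁, E₂, E₂₂, c, c1, c11, c2, c22, h1, h11, h2, h22, hL⟩ := h
  refine ⟨fun p => T (E₁ p), fun p => T (E₁₁ p), fun p => T (E₂ p), fun p => T (E₂₂ p),
    by fun_prop, by fun_prop, by fun_prop, by fun_prop, by fun_prop,
    fun x θ => T.hasFDerivAt.comp_hasDerivAt x (h1 x θ),
    fun x θ => T.hasFDerivAt.comp_hasDerivAt x (h11 x θ),
    fun x θ => T.hasFDerivAt.comp_hasDerivAt θ (h2 x θ),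
    fun x θ => T.hasFDerivAt.comp_hasDerivAt θ (h22 x θ), fun p => by simp only [hL, map_add]⟩

theorem add (h : HasLaplace E L) (h' : HasLaplace E' L') :
    HasLaplace (fun p => E p + E' p) (fun p => L p + L' p) := by
  obtain ⟨E₁, E₁₁, E₂, E₂₂, c, c1, c11, c2, c22, h1, h11, h2, h22, hL⟩ := h
  obtain ⟨E₁', E₁₁', E₂', E₂₂', c', c1', c11', c2', c22', h1', h11', h2', h22', hL'⟩ := h'
  refine ⟨fun p => E₁ p + E₁' p, fun p => E₁₁ p + E₁₁' p, fun p => E₂ p + E₂' p,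
    fun p => E₂₂ p + E₂₂' p, by fun_prop, by fun_prop, by fun_prop, by fun_prop, by fun_prop,
    fun x θ => (h1 x θ).add (h1' x θ), fun x θ => (h11 x θ).add (h11' x θ),
    fun x θ => (h2 x θ).add (h2' x θ), fun x θ => (h22 x θ).add (h22' x θ),
    fun p => by simp only [hL, hL']; abel⟩

theorem zero : HasLaplace (fun _ => (0 : V)) (fun _ => 0) :=
  ⟨fun _ => 0, fun _ => 0, fun _ => 0, fun _ => 0, continuous_const, continuous_const,
    continuous_const, continuous_const, continuous_const, fun _ _ => hasDerivAt_const _ _,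
    fun _ _ => hasDerivAt_const _ _, fun _ _ => hasDerivAt_const _ _,
    fun _ _ => hasDerivAt_const _ _, fun _ => (add_zero _).symm⟩

theorem sum {ι : Type*} (s : Finset ι) {E L : ι → ℝ × ℝ → V} (h : ∀ i, HasLaplace (E i) (L i)) :
    HasLaplace (fun p => ∑ i ∈ s, E i p) (fun p => ∑ i ∈ s, L i p) := by
  classical
  induction s using Finset.induction_on with
  | empty => simpa using zero
  | insert a s ha ih =>
    simp only [Finset.sum_insert ha]
    exact (h a).add ih

theorem const_mul {E L : ℝ × ℝ → ℂ} (h : HasLaplace E L) (c : ℂ) :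
    HasLaplace (fun p => c * E p) (fun p => c * L p) :=
  h.map ((ContinuousLinearMap.mul ℂ ℂ c).restrictScalars ℝ)

theorem continuous {E L : ℝ × ℝ → V} (h : HasLaplace E L) : Continuous E ∧ Continuous L := by
  obtain ⟨E₁, E₁₁, E₂, E₂₂, c, c1, c11, c2, c22, h1, h11, h2, h22, hL⟩ := h
  refine ⟨c, ?_⟩
  rw [funext hL]
  exact c11.add c22

/-- Green's formula for a function that vanishes on the sides of the half-strip, tested with
`η(x) sin (s θ)`. -/
theorem green {q L : ℝ × ℝ → ℝ} (h : HasLaplace q L) {X ω : ℝ} (hω : 0 < ω)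
    (h0 : ∀ x, q (x, 0) = 0) (h1 : ∀ x, q (x, ω) = 0) {s : ℝ} (hsω : Real.sin (s * ω) = 0)
    {η : ℝ → ℝ} (hη : IsBump X η) :
    ∫ p in halfStrip X ω, q p * ((deriv (deriv η) p.1 - s ^ 2 * η p.1) * Real.sin (s * p.2))
      = ∫ p in halfStrip X ω, L p * (η p.1 * Real.sin (s * p.2)) := by
  obtain ⟨E₁, E₁₁, E₂, E₂₂, c, c1, c11, c2, c22, d1, d11, d2, d22, hL⟩ := h
  have hcs : Continuous fun θ => Real.sin (s * θ) := by fun_prop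
  have w0 := (hη.isWeight hcs).mul_cont c
  have w1 := (hη.isWeight hcs).mul_cont c11
  have w2 := (hη.isWeight hcs).mul_cont c22
  have w3 := (hη.deriv.deriv.isWeight hcs).mul_cont c
  have e1 : ∫ p in halfStrip X ω, (q p * (deriv (deriv η) p.1 * Real.sin (s * p.2))
      - E₁₁ p * (η p.1 * Real.sin (s * p.2))) = 0 := by
    refine (setIntegral_halfStrip_symm (w3.integrableOn.sub w1.integrableOn)).trans ?_
    refine integral_eq_zero_of_ae (ae_of_all _ fun θ => ?_)
    change ∫ x in Set.Iio X, _ = 0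
    rw [setIntegral_eq_integral_of_forall_compl_eq_zero]
    · have hcx : Continuous fun x : ℝ => ((x, θ) : ℝ × ℝ) := by fun_prop
      have cx := c.comp hcx
      have c1x := c1.comp hcx
      have c11x := c11.comp hcx
      have hd : ∀ x, HasDerivAt (fun x => (q (x, θ) * deriv η x - E₁ (x, θ) * η x)
          * Real.sin (s * θ)) (q (x, θ) * (deriv (deriv η) x * Real.sin (s * θ))
            - E₁₁ (x, θ) * (η x * Real.sin (s * θ))) x := by
        intro x
        refine ((((d1 x θ).mul (hη.deriv.hasDerivAt x)).sub
          ((d11 x θ).mul (hη.hasDerivAt x))).mul_const (Real.sin (s * θ))).congr_deriv ?_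
        ring
      have b1 : ∀ (ν : ℝ → ℝ) (_ : IsBump X ν) (g : ℝ → ℝ) (_ : Continuous g),
          Integrable fun x => g x * ν x := by
        intro ν hν g hg
        refine Continuous.integrable_of_hasCompactSupport (hg.mul hν.smooth.continuous) ?_
        exact hν.hasCompactSupport.mul_left
      refine integral_eq_zero_of_hasDerivAt_of_integrable hd ?_
        (((b1 _ hη.deriv _ cx).sub (b1 _ hη _ c1x)).mul_const _)
      have := ((b1 _ hη.deriv.deriv _ cx).sub (b1 _ hη _ c11x)).mul_const (Real.sin (s * θ))
      refine this.congr (ae_of_all _ fun x => ?_)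
      simp only [Pi.sub_apply, Function.comp_apply]
      ring
    · intro x hx
      have hx' : X ≤ x := not_lt.1 hx
      simp [hη.eq_zero hx', hη.deriv.deriv.eq_zero hx']
  have e2 : ∫ p in halfStrip X ω, (E₂₂ p * (η p.1 * Real.sin (s * p.2))
      + s ^ 2 * (q p * (η p.1 * Real.sin (s * p.2)))) = 0 := by
    refine (setIntegral_halfStrip (w2.add (w0.mul_cont (g := fun _ => s ^ 2)
      continuous_const)).integrableOn).trans ?_
    refine integral_eq_zero_of_ae (ae_of_all _ fun x => ?_)
    change ∫ θ in Set.Ioo 0 ω, _ = 0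
    have hcx : Continuous fun θ : ℝ => ((x, θ) : ℝ × ℝ) := by fun_prop
    have cx := c.comp hcx
    have c22x := c22.comp hcx
    have hd : ∀ θ, HasDerivAt (fun θ => (E₂ (x, θ) * Real.sin (s * θ)
        - s * (q (x, θ) * Real.cos (s * θ))) * η x)
        (E₂₂ (x, θ) * (η x * Real.sin (s * θ)) + s ^ 2 * (q (x, θ) * (η x * Real.sin (s * θ))))
        θ := by
      intro θ
      have hid : HasDerivAt (fun θ : ℝ => s * θ) s θ := by
        simpa using (hasDerivAt_id θ).const_mul s
      refine ((((d22 x θ).mul hid.sin).sub (((d2 x θ).mul hid.cos).const_mul s)).mul_const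
        (η x)).congr_deriv ?_
      ring
    rw [← integral_Ioc_eq_integral_Ioo, ← intervalIntegral.integral_of_le hω.le,
      intervalIntegral.integral_eq_sub_of_hasDerivAt (fun θ _ => hd θ)]
    · simp [h0, h1, hsω]
    · apply Continuous.intervalIntegrable
      exact (c22x.mul (continuous_const.mul hcs)).add
        (continuous_const.mul (cx.mul (continuous_const.mul hcs)))
  rw [integral_sub w3.integrableOn w1.integrableOn] at e1
  rw [integral_add w2.integrableOn (w0.integrableOn.const_mul _), integral_const_mul] at e2
  have e3 : ∫ p in halfStrip X ω, q p * ((deriv (deriv η) p.1 - s ^ 2 * η p.1) *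
      Real.sin (s * p.2)) = (∫ p in halfStrip X ω, q p * (deriv (deriv η) p.1 *
      Real.sin (s * p.2))) - s ^ 2 * ∫ p in halfStrip X ω, q p * (η p.1 * Real.sin (s * p.2)) := by
    rw [← integral_const_mul, ← integral_sub w3.integrableOn (w0.integrableOn.const_mul _)]
    refine integral_congr_ae (ae_of_all _ fun p => ?_)
    simp only
    ring
  have e4 : ∫ p in halfStrip X ω, L p * (η p.1 * Real.sin (s * p.2))
      = (∫ p in halfStrip X ω, E₁₁ p * (η p.1 * Real.sin (s * p.2)))
        + ∫ p in halfStrip X ω, E₂₂ p * (η p.1 * Real.sin (s * p.2)) := by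
    rw [← integral_add w1.integrableOn w2.integrableOn]
    refine integral_congr_ae (ae_of_all _ fun p => ?_)
    simp only [hL]
    ring
  rw [e3, e4]
  linarith

end HasLaplace

/-! ### The special functions in logarithmic coordinates -/

/-- The complex number `x + i θ`, the logarithm of `polarExp (x, θ)`. -/
def logPoint (p : ℝ × ℝ) : ℂ := ⟨p.1, p.2⟩

theorem hasDerivAt_logPoint_fst (x θ : ℝ) : HasDerivAt (fun x => logPoint (x, θ)) 1 x := by
  have : (fun x => logPoint (x, θ)) = fun x : ℝ => (x : ℂ) + θ * Complex.I := by
    funext x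
    apply Complex.ext <;> simp [logPoint]
  rw [this]
  exact (Complex.ofRealCLM.hasDerivAt (x := x)).add_const _

theorem hasDerivAt_logPoint_snd (x θ : ℝ) :
    HasDerivAt (fun θ => logPoint (x, θ)) Complex.I θ := by
  have : (fun θ => logPoint (x, θ)) = fun θ : ℝ => (x : ℂ) + θ * Complex.I := by
    funext x
    apply Complex.ext <;> simp [logPoint]
  rw [this]
  simpa using ((Complex.ofRealCLM.hasDerivAt (x := θ)).mul_const Complex.I).const_add (x : ℂ)

theorem continuous_logPoint : Continuous logPoint := Complex.equivRealProdCLM.symm.continuous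

/-- The function `ζ ^ a * conj ζ ^ b` in logarithmic coordinates, for real exponents `a` and `b`. -/
def monom (a b : ℝ) (p : ℝ × ℝ) : ℂ :=
  Complex.exp (a * logPoint p + b * conj (logPoint p))

theorem monom_eq (a b : ℝ) (p : ℝ × ℝ) :
    monom a b p
      = Complex.exp ((a + b : ℝ) * p.1) * Complex.exp ((a - b : ℝ) * p.2 * Complex.I) := by
  rw [monom, ← Complex.exp_add]
  congr 1
  apply Complex.ext <;> simp [logPoint] <;> ring

theorem hasLaplace_monom (a b : ℝ) :
    HasLaplace (monom a b) fun p => (4 * a * b : ℝ) * monom a b p := by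
  have hc : Continuous (monom a b) := by
    unfold monom
    have := continuous_logPoint
    fun_prop
  have hconj : ∀ {g : ℝ → ℂ} {g' : ℂ} {x : ℝ}, HasDerivAt g g' x →
      HasDerivAt (fun x => conj (g x)) (conj g') x := fun {g g' x} h =>
    Complex.conjCLE.toContinuousLinearMap.hasFDerivAt.comp_hasDerivAt x h
  have h1 : ∀ x θ, HasDerivAt (fun x => monom a b (x, θ)) ((a + b) * monom a b (x, θ)) x := by
    intro x θ
    have hd := hasDerivAt_logPoint_fst x θ
    refine (((hd.const_mul (a : ℂ)).fun_add ((hconj hd).const_mul (b : ℂ))).cexp).congr_deriv ?_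
    simp only [map_one, monom]
    ring
  have h2 : ∀ x θ, HasDerivAt (fun θ => monom a b (x, θ))
      (((a - b) * Complex.I) * monom a b (x, θ)) θ := by
    intro x θ
    have hd := hasDerivAt_logPoint_snd x θ
    refine (((hd.const_mul (a : ℂ)).fun_add ((hconj hd).const_mul (b : ℂ))).cexp).congr_deriv ?_
    simp only [Complex.conj_I, monom]
    ring
  refine ⟨fun p => (a + b) * monom a b p, fun p => (a + b) * ((a + b) * monom a b p),
    fun p => ((a - b) * Complex.I) * monom a b p,
    fun p => ((a - b) * Complex.I) * (((a - b) * Complex.I) * monom a b p), hc, by fun_prop,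
    by fun_prop, by fun_prop, by fun_prop, h1, fun x θ => (h1 x θ).const_mul _, h2,
    fun x θ => (h2 x θ).const_mul _, fun p => ?_⟩
  push_cast
  linear_combination (-(a - b) ^ 2 * monom a b p : ℂ) * Complex.I_sq

/-- At a resonance, the logarithmic term `ζ ^ a log ζ` is harmonic. -/
theorem hasLaplace_log (a : ℝ) :
    HasLaplace (fun p => logPoint p * monom a 0 p) fun _ => 0 := by
  have hcl := continuous_logPoint
  have hc : Continuous (monom a 0) := by
    unfold monom
    fun_prop
  have h1 : ∀ x θ, HasDerivAt (fun x => monom a 0 (x, θ)) (a * monom a 0 (x, θ)) x := by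
    intro x θ
    have hd := hasDerivAt_logPoint_fst x θ
    have := ((hd.const_mul (a : ℂ))).cexp
    simpa [monom, mul_comm] using this
  have h2 : ∀ x θ, HasDerivAt (fun θ => monom a 0 (x, θ))
      ((a * Complex.I) * monom a 0 (x, θ)) θ := by
    intro x θ
    have hd := hasDerivAt_logPoint_snd x θ
    have := ((hd.const_mul (a : ℂ))).cexp
    simpa [monom, mul_comm] using this
  refine ⟨fun p => (1 + a * logPoint p) * monom a 0 p,
    fun p => (2 * a + a ^ 2 * logPoint p) * monom a 0 p,
    fun p => Complex.I * ((1 + a * logPoint p) * monom a 0 p),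
    fun p => Complex.I * (Complex.I * ((2 * a + a ^ 2 * logPoint p) * monom a 0 p)),
    by fun_prop, by fun_prop, by fun_prop, by fun_prop, by fun_prop, fun x θ => ?_,
    fun x θ => ?_, fun x θ => ?_, fun x θ => ?_, fun p => ?_⟩
  · refine ((hasDerivAt_logPoint_fst x θ).mul (h1 x θ)).congr_deriv ?_
    ring
  · refine ((((hasDerivAt_logPoint_fst x θ).const_mul (a : ℂ)).const_add 1).mul
      (h1 x θ)).congr_deriv ?_
    ring
  · refine ((hasDerivAt_logPoint_snd x θ).mul (h2 x θ)).congr_deriv ?_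
    ring
  · refine (((((hasDerivAt_logPoint_snd x θ).const_mul (a : ℂ)).const_add 1).mul
      (h2 x θ)).const_mul Complex.I).congr_deriv ?_
    ring
  · linear_combination (-(2 * a + a ^ 2 * logPoint p) * monom a 0 p) * Complex.I_sq

theorem norm_monom (a b : ℝ) (p : ℝ × ℝ) : ‖monom a b p‖ = Real.exp ((a + b) * p.1) := by
  rw [monom_eq, norm_mul, Complex.norm_exp, Complex.norm_exp]
  simp

/-- The special function attached to the pair `α`, in logarithmic coordinates. The pair `(0, 0)`,
which is not an index, is given the value `1`, so that a sum over the pairs of given total degree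
needs no side condition. -/
def pairZ (ω δ : ℝ) (α : ℕ × ℕ) (p : ℝ × ℝ) : ℂ :=
  if h : α ≠ (0, 0) then Z ω δ (.inl ⟨α, h⟩) (polarExp p) else 1

theorem Z_inr_polarExp {ω δ : ℝ} (k : ℕ+) {p : ℝ × ℝ} (h0 : 0 ≤ p.2)
    (h1 : p.2 < 2 * Real.pi) :
    Z ω δ (.inr k) (polarExp p) = monom (k * Real.pi / ω) 0 p := by
  change Complex.exp _ = _
  rw [sectorLog_polarExp h0 h1]
  simp [monom, logPoint]

theorem polarExp_pow (a b : ℕ) (p : ℝ × ℝ) :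
    polarExp p ^ a * conj (polarExp p) ^ b = monom a b p := by
  rw [polarExp, monom, ← Complex.exp_conj, ← Complex.exp_nat_mul, ← Complex.exp_nat_mul,
    ← Complex.exp_add]
  simp [logPoint]

theorem polarExp_pow' (a : ℕ) (p : ℝ × ℝ) : polarExp p ^ a = monom a 0 p := by
  simpa using polarExp_pow a 0 p

/-- The three shapes of the special function of a pair: a logarithmic term at a resonance, a
divided difference near a resonance, a monomial otherwise. -/
theorem pairZ_cases {ω δ : ℝ} (hω : 0 < ω) (hδ : 0 < δ) (hδπ : δ < Real.pi) (α : ℕ × ℕ) :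
    (∃ s : ℝ, α.2 = 0 ∧ Real.sin (s * ω) = 0 ∧ |(α.1 : ℝ) - s| ≤ δ / ω ∧ ((α.1 : ℝ) = s ∧
      ∀ p : ℝ × ℝ, 0 ≤ p.2 → p.2 < 2 * Real.pi → pairZ ω δ α p = logPoint p * monom α.1 0 p)) ∨
    (∃ s : ℝ, α.2 = 0 ∧ Real.sin (s * ω) = 0 ∧ |(α.1 : ℝ) - s| ≤ δ / ω ∧ ((α.1 : ℝ) ≠ s ∧
      ∀ p : ℝ × ℝ, 0 ≤ p.2 → p.2 < 2 * Real.pi →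
        pairZ ω δ α p = (((α.1 : ℝ) - s : ℝ) : ℂ)⁻¹ * (monom α.1 0 p - monom s 0 p))) ∨
    ((α.2 = 0 → ∀ k : ℕ, 0 < k → δ < |(α.1 : ℝ) * ω - k * Real.pi|) ∧
      ∀ p, pairZ ω δ α p = monom α.1 α.2 p) := by
  by_cases hα : α = (0, 0)
  · refine Or.inr (Or.inr ⟨fun _ k hk => ?_, fun p => ?_⟩)
    · rw [hα]
      have : (1 : ℝ) ≤ k := by exact_mod_cast hk
      have h2 : Real.pi ≤ k * Real.pi := by nlinarith [Real.pi_pos]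
      simp only [Nat.cast_zero, zero_mul, zero_sub, abs_neg]
      rw [abs_of_nonneg (by positivity)]
      linarith
    · simp [pairZ, hα, monom]
  · by_cases h : α.2 = 0 ∧ ∃ k : ℕ, IsNear ω δ α.1 k
    · -- the definition picks the resonant integer by choice; only its defining property matters
      have hk := h.2.choose_spec
      set k := h.2.choose with hkdef
      have hs : Real.sin (k * Real.pi / ω * ω) = 0 := by
        rw [div_mul_cancel₀ _ hω.ne', Real.sin_nat_mul_pi]
      have hle : |(α.1 : ℝ) - k * Real.pi / ω| ≤ δ / ω := by
        rw [le_div_iff₀ hω, ← abs_of_pos hω, ← abs_mul, abs_of_pos hω, sub_mul,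
          div_mul_cancel₀ _ hω.ne']
        exact hk.2
      by_cases he : (α.1 : ℝ) = k * Real.pi / ω
      · refine Or.inl ⟨_, h.1, hs, hle, he, fun p h0 h1 => ?_⟩
        rw [pairZ, dif_pos hα]
        simp only [Z]
        rw [dif_pos h]
        simp only [← hkdef]
        rw [if_pos he, sectorLog_polarExp h0 h1, polarExp_pow', mul_comm]
        rfl
      · refine Or.inr (Or.inl ⟨_, h.1, hs, hle, he, fun p h0 h1 => ?_⟩)
        rw [pairZ, dif_pos hα]
        simp only [Z]
        rw [dif_pos h]
        simp only [← hkdef]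
        rw [if_neg he, polarExp_pow', sectorPow, sectorLog_polarExp h0 h1, div_eq_inv_mul]
        congr 2
        simp [monom, logPoint]
    · refine Or.inr (Or.inr ⟨fun h2 k hk0 => ?_, fun p => ?_⟩)
      · by_contra hc
        exact h ⟨h2, k, hk0, not_lt.1 hc⟩
      · rw [pairZ, dif_pos hα]
        simp only [Z]
        rw [dif_neg h, polarExp_pow]

theorem monom_re (a b x θ : ℝ) :
    (monom a b (x, θ)).re = Real.exp ((a + b) * x) * Real.cos ((a - b) * θ) := by
  rw [monom]
  simp only [Complex.exp_re, logPoint]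
  congr 2 <;> simp <;> ring

theorem monom_im (a b x θ : ℝ) :
    (monom a b (x, θ)).im = Real.exp ((a + b) * x) * Real.sin ((a - b) * θ) := by
  rw [monom]
  simp only [Complex.exp_im, logPoint]
  congr 2 <;> simp <;> ring

/-- A lower bound for the sine at a distance at least `δ` from the multiples `k π`, `k ≥ 1`. The
condition `δ ≤ y` accounts for the multiple `0`. -/
theorem le_abs_sin_of_dist {y δ : ℝ} (hδy : δ ≤ y) (hδ : 0 < δ)
    (h : ∀ k : ℕ, 0 < k → δ < |y - k * Real.pi|) : 2 * δ / Real.pi ≤ |Real.sin y| := by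
  set k := round (y / Real.pi)
  have hpi := Real.pi_pos
  have h1 : |y - k * Real.pi| ≤ Real.pi / 2 := by
    have h2 := abs_sub_round (y / Real.pi)
    have h3 : y - k * Real.pi = (y / Real.pi - k) * Real.pi := by
      rw [sub_mul, div_mul_cancel₀ _ hpi.ne']
    rw [h3, abs_mul, abs_of_pos hpi]
    nlinarith
  have h2 : δ ≤ |y - k * Real.pi| := by
    rcases le_or_gt k 0 with hk | hk
    · have : (k : ℝ) ≤ 0 := by exact_mod_cast hk
      rw [abs_of_nonneg (by nlinarith)]
      nlinarith
    · have h3 := h k.toNat (by omega)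
      have h4 : ((k.toNat : ℕ) : ℝ) = (k : ℝ) := by
        exact_mod_cast congrArg (Int.cast : ℤ → ℝ) (Int.toNat_of_nonneg hk.le)
      rw [h4] at h3
      exact h3.le
  have h3 : |Real.sin y| = |Real.sin (y - k * Real.pi)| := by
    rw [Real.sin_sub_int_mul_pi, abs_mul]
    simp
  rw [h3]
  refine le_trans ?_ (Real.mul_abs_le_abs_sin h1)
  rw [mul_div_right_comm]
  gcongr

theorem abs_cos_eq_one {y : ℝ} (h : Real.sin y = 0) : |Real.cos y| = 1 := by
  have := Real.sin_sq_add_cos_sq y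
  rw [h] at this
  rw [← sq_eq_sq₀ (abs_nonneg _) zero_le_one, sq_abs]
  linarith

variable {ω δ : ℝ}

/-- The special function of the pair `(N, 0)` agrees on the strip with a harmonic function whose
imaginary part vanishes on the side `θ = 0` and is bounded below on the side `θ = ω`, uniformly
in `N`. This uniformity is what the treatment of near resonances achieves. -/
theorem exists_pairZ_model (hω : 0 < ω) (hδ : 0 < δ) (hδω : δ < ω / 2) (hδπ : δ < Real.pi / 2)
    {N : ℕ} (hN : 0 < N) :
    ∃ (E : ℝ × ℝ → ℂ) (D : ℝ), HasLaplace E (fun _ => 0) ∧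
      (∀ p : ℝ × ℝ, 0 ≤ p.2 → p.2 < 2 * Real.pi → pairZ ω δ (N, 0) p = E p) ∧
      2 * δ / Real.pi ≤ |D| ∧ (∀ x, (E (x, 0)).im = 0) ∧
      ∀ x, (E (x, ω)).im = Real.exp (N * x) * D := by
  have hpi := Real.pi_pos
  have hN1 : (1 : ℝ) ≤ N := by exact_mod_cast hN
  have hharm : ∀ a : ℝ, HasLaplace (monom a 0) (fun _ => 0) := fun a => by
    simpa using hasLaplace_monom a 0
  have hle : 2 * δ / Real.pi ≤ 2 * ω / Real.pi := by gcongr; linarith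
  rcases pairZ_cases hω hδ (by linarith) (N, 0) with ⟨s, -, hs, hd, he, h⟩ | ⟨s, -, hs, hd, he, h⟩
    | ⟨h0, h⟩
  · refine ⟨_, ω * Real.cos (N * ω), hasLaplace_log N, h, ?_, fun x => ?_, fun x => ?_⟩
    · simp only at he
      rw [he, abs_mul, abs_cos_eq_one hs, mul_one, abs_of_pos hω, div_le_iff₀ hpi]
      nlinarith [Real.pi_gt_three]
    · rw [Complex.mul_im, monom_im, monom_re]
      simp [logPoint]
    · simp only at he
      rw [Complex.mul_im, monom_im, monom_re, add_zero, sub_zero, he, hs]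
      simp [logPoint]
      ring
  · simp only at he hd
    have hne : (N : ℝ) - s ≠ 0 := sub_ne_zero.2 he
    have hE : HasLaplace (fun p => ((((N : ℝ) - s)⁻¹ : ℝ) : ℂ) *
        (monom N 0 p + (-1) * monom s 0 p)) (fun _ => 0) := by
      simpa only [mul_zero, add_zero] using
        ((hharm N).add ((hharm s).const_mul (-1))).const_mul ((((N : ℝ) - s)⁻¹ : ℝ) : ℂ)
    refine ⟨_, ((N : ℝ) - s)⁻¹ * Real.sin (N * ω), hE, fun p h0 h1 => ?_, ?_,
        fun x => ?_, fun x => ?_⟩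
    · rw [h p h0 h1, Complex.ofReal_inv, neg_one_mul, ← sub_eq_add_neg]
    · have h1 : Real.sin (N * ω) = Real.sin ((N - s) * ω) * Real.cos (s * ω) := by
        rw [show (N : ℝ) * ω = (N - s) * ω + s * ω by ring, Real.sin_add, hs, mul_zero, add_zero]
      have hy : |((N : ℝ) - s) * ω| ≤ Real.pi / 2 := by
        rw [abs_mul, abs_of_pos hω]
        have := (le_div_iff₀ hω).1 hd
        linarith
      have h2 := Real.mul_abs_le_abs_sin hy
      rw [abs_mul, abs_of_pos hω] at h2
      rw [h1, abs_mul, abs_mul, abs_cos_eq_one hs, mul_one, abs_inv]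
      refine hle.trans ?_
      rw [inv_mul_eq_div, le_div_iff₀ (abs_pos.2 hne)]
      refine le_trans (le_of_eq ?_) h2
      ring
    · rw [Complex.im_ofReal_mul, neg_one_mul, Complex.add_im, Complex.neg_im, monom_im, monom_im]
      simp
    · rw [Complex.im_ofReal_mul, neg_one_mul, Complex.add_im, Complex.neg_im, monom_im, monom_im,
        sub_zero, sub_zero, hs, add_zero]
      ring
  · refine ⟨monom N 0, Real.sin (N * ω), hharm N, fun p _ _ => by simpa using h p, ?_, fun x => ?_,
      fun x => ?_⟩
    · refine le_abs_sin_of_dist ?_ hδ (fun k hk => h0 rfl k hk)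
      nlinarith
    · simp [monom_im]
    · simp [monom_im]

theorem norm_logPoint_le (p : ℝ × ℝ) : ‖logPoint p‖ ≤ |p.1| + |p.2| :=
  Complex.norm_le_abs_re_add_abs_im _

/-- A bound for the special functions that is uniform in the index up to the homogeneity. -/
theorem norm_pairZ_le (hω : 0 < ω) (hδ : 0 < δ) (hδω : δ < ω / 2) (hδπ : δ < Real.pi / 2)
    (α : ℕ × ℕ) {p : ℝ × ℝ} (h0 : 0 ≤ p.2) (h1 : p.2 < 2 * Real.pi) :
    ‖pairZ ω δ α p‖ ≤ Real.exp (2 * ‖logPoint p‖) * Real.exp (((α.1 : ℝ) + α.2) * p.1) := by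
  have hpi := Real.pi_pos
  set r := ‖logPoint p‖ with hr
  have hr0 : 0 ≤ r := norm_nonneg _
  have hre : r ≤ Real.exp r := (by linarith [Real.add_one_le_exp r])
  have h2r : Real.exp (2 * r) = Real.exp r * Real.exp r := by rw [← Real.exp_add]; ring_nf
  have h1r : 1 ≤ Real.exp r := Real.one_le_exp hr0
  rcases pairZ_cases hω hδ (by linarith) α with ⟨s, ha, hs, hd, he, h⟩ | ⟨s, ha, hs, hd, he, h⟩
    | ⟨-, h⟩
  · rw [h p h0 h1, norm_mul, norm_monom, ha, ← hr]
    simp only [add_zero, Nat.cast_zero]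
    gcongr
    nlinarith
  · have hne : (α.1 : ℝ) - s ≠ 0 := sub_ne_zero.2 he
    rw [h p h0 h1, norm_mul, norm_inv, Complex.norm_real, Real.norm_eq_abs, ha]
    have hd1 : |(α.1 : ℝ) - s| ≤ 1 := hd.trans ((div_le_one hω).2 (by linarith))
    have e1 : monom α.1 0 p - monom s 0 p
        = -(monom α.1 0 p * (Complex.exp ((s - α.1 : ℝ) * logPoint p) - 1)) := by
      have : monom s 0 p = monom α.1 0 p * Complex.exp ((s - α.1 : ℝ) * logPoint p) := by
        rw [monom, monom, ← Complex.exp_add]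
        congr 1
        push_cast
        ring
      rw [this]
      ring
    have e2 := Complex.norm_exp_sub_sum_le_norm_mul_exp ((s - α.1 : ℝ) * logPoint p) 1
    simp only [Finset.range_one, Finset.sum_singleton, pow_zero, Nat.factorial_zero, Nat.cast_one,
      div_one, pow_one, norm_mul, Complex.norm_real, Real.norm_eq_abs] at e2
    rw [abs_sub_comm s, ← hr] at e2
    rw [e1, norm_neg, norm_mul, norm_monom, add_zero, Nat.cast_zero, add_zero,
      inv_mul_le_iff₀ (abs_pos.2 hne)]
    have e3 : Real.exp (|(α.1 : ℝ) - s| * r) ≤ Real.exp r :=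
      Real.exp_le_exp.2 (mul_le_of_le_one_left hr0 hd1)
    calc Real.exp (α.1 * p.1) * ‖Complex.exp ((s - α.1 : ℝ) * logPoint p) - 1‖
        ≤ Real.exp (α.1 * p.1) * (|(α.1 : ℝ) - s| * Real.exp r * Real.exp r) := by
          gcongr
          refine e2.trans ?_
          gcongr
      _ = _ := by rw [h2r]; ring
  · rw [h p, norm_monom]
    refine le_mul_of_one_le_left (Real.exp_pos _).le ?_
    rw [h2r]
    nlinarith

/-! ### Power series in `ζ` and `conj ζ` -/

/-- Multiplication by the linear form `c ζ + d conj ζ` preserves the homogeneous polynomials in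
`ζ`, `conj ζ` with coefficients bounded by one, when `|c| + |d| ≤ 1`. -/
theorem exists_expansion_mul {n : ℕ} {P : ℂ → ℂ} {c d : ℂ} (hcd : ‖c‖ + ‖d‖ ≤ 1)
    (h : ∃ K : ℕ × ℕ → ℂ, (∀ p, ‖K p‖ ≤ 1) ∧
      ∀ ζ, P ζ = ∑ p ∈ antidiagonal n, K p * (ζ ^ p.1 * conj ζ ^ p.2)) :
    ∃ K : ℕ × ℕ → ℂ, (∀ p, ‖K p‖ ≤ 1) ∧ ∀ ζ, (c * ζ + d * conj ζ) * P ζ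
      = ∑ p ∈ antidiagonal (n + 1), K p * (ζ ^ p.1 * conj ζ ^ p.2) := by
  obtain ⟨K, hK, hP⟩ := h
  refine ⟨fun p => c * (if p.1 = 0 then 0 else K (p.1 - 1, p.2)) +
    d * (if p.2 = 0 then 0 else K (p.1, p.2 - 1)), fun p => ?_, fun ζ => ?_⟩
  · have h1 : ‖(if p.1 = 0 then 0 else K (p.1 - 1, p.2))‖ ≤ 1 := by
      split_ifs
      · simp
      · exact hK _
    have h2 : ‖(if p.2 = 0 then 0 else K (p.1, p.2 - 1))‖ ≤ 1 := by
      split_ifs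
      · simp
      · exact hK _
    refine (norm_add_le _ _).trans ?_
    rw [norm_mul, norm_mul]
    nlinarith [norm_nonneg c, norm_nonneg d]
  · simp only [add_mul, Finset.sum_add_distrib]
    rw [Finset.Nat.sum_antidiagonal_succ, Finset.Nat.sum_antidiagonal_succ']
    simp only [if_true, mul_zero, zero_mul, zero_add, Nat.add_eq_zero_iff, one_ne_zero, and_false,
      if_false, Nat.add_sub_cancel]
    rw [hP, Finset.mul_sum, Finset.mul_sum]
    congr 1 <;> refine Finset.sum_congr rfl fun p _ => ?_ <;> ring

/-- A monomial in the Cartesian coordinates is a homogeneous polynomial in `ζ` and `conj ζ` whose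
coefficients are bounded by one. -/
theorem exists_monomial_expansion (i j : ℕ) :
    ∃ K : ℕ × ℕ → ℂ, (∀ p, ‖K p‖ ≤ 1) ∧ ∀ ζ : ℂ, (ζ.re : ℂ) ^ i * (ζ.im : ℂ) ^ j
      = ∑ p ∈ antidiagonal (i + j), K p * (ζ ^ p.1 * conj ζ ^ p.2) := by
  induction i with
  | zero =>
    induction j with
    | zero => exact ⟨fun _ => 1, fun _ => by simp, fun ζ => by simp⟩
    | succ j ih =>
      have h := exists_expansion_mul (c := -(Complex.I / 2)) (d := Complex.I / 2)
        (by simp; norm_num) ih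
      obtain ⟨K, hK, h⟩ := h
      refine ⟨K, hK, fun ζ => ?_⟩
      have him : (ζ.im : ℂ) = -(Complex.I / 2) * ζ + Complex.I / 2 * conj ζ := by
        rw [Complex.im_eq_sub_conj, div_eq_iff (by simp)]
        linear_combination (ζ - conj ζ) * Complex.I_sq
      rw [← add_assoc, ← h, ← him]
      ring
  | succ i ih =>
    have h := exists_expansion_mul (c := 1 / 2) (d := 1 / 2) (by simp; norm_num) ih
    obtain ⟨K, hK, h⟩ := h
    refine ⟨K, hK, fun ζ => ?_⟩
    rw [show i + 1 + j = i + j + 1 by ring, ← h, Complex.re_eq_add_conj]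
    ring

/-- Polynomial factors are absorbed by an increase of the base. -/
theorem exists_mul_pow_le {r R : ℝ} (hr : 0 ≤ r) (hrR : r < R) :
    ∃ C, 0 < C ∧ ∀ n : ℕ, ((n : ℝ) + 1) * r ^ n ≤ C * R ^ n := by
  have hR : 0 < R := hr.trans_lt hrR
  have h1 : |r / R| < 1 := by
    rw [abs_of_nonneg (by positivity), div_lt_one hR]
    exact hrR
  have h2 := (tendsto_self_mul_const_pow_of_abs_lt_one h1).add
    (tendsto_pow_atTop_nhds_zero_of_abs_lt_one h1)
  obtain ⟨C, hC⟩ := h2.bddAbove_range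
  refine ⟨max C 1, by positivity, fun n => ?_⟩
  have h3 := hC ⟨n, rfl⟩
  simp only at h3
  have h4 : ((n : ℝ) + 1) * r ^ n = (n * (r / R) ^ n + (r / R) ^ n) * R ^ n := by
    rw [div_pow]
    field_simp
  rw [h4]
  gcongr
  exact h3.trans (le_max_left _ _)

/-- Conversion of a real power series in the Cartesian coordinates into the real part of a series
of homogeneous polynomials in `ζ` and `conj ζ`. -/
theorem exists_complex_coefficients {c : ℕ × ℕ → ℝ} {C r R : ℝ} (hr : 0 < r) (hrR : r < R)
    (hc : ∀ α, |c α| ≤ C * r ^ (α.1 + α.2)) :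
    ∃ (F : ℕ × ℕ → ℂ) (C' : ℝ), 0 < C' ∧ (∀ p, ‖F p‖ ≤ C' * R ^ (p.1 + p.2)) ∧
      ∀ (ζ : ℂ) (y : ℝ), HasSum (fun α : ℕ × ℕ => c α * ζ.re ^ α.1 * ζ.im ^ α.2) y →
        HasSum (fun n => (∑ p ∈ antidiagonal n, F p * (ζ ^ p.1 * conj ζ ^ p.2)).re) y := by
  choose K hK hKe using exists_monomial_expansion
  have hC0 : 0 ≤ C := by
    have := (abs_nonneg _).trans (hc (0, 0))
    simpa using this
  obtain ⟨C₂, hC₂, hpow⟩ := exists_mul_pow_le hr.le hrR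
  refine ⟨fun p => ∑ α ∈ antidiagonal (p.1 + p.2), (c α : ℂ) * K α.1 α.2 p,
    (C + 1) * C₂, by positivity, fun p => ?_, fun ζ y h => ?_⟩
  · refine (norm_sum_le _ _).trans ?_
    have h1 : ∀ α ∈ antidiagonal (p.1 + p.2), ‖(c α : ℂ) * K α.1 α.2 p‖
        ≤ C * r ^ (p.1 + p.2) := by
      intro α hα
      rw [norm_mul, Complex.norm_real, Real.norm_eq_abs]
      have h2 := hc α
      rw [Finset.HasAntidiagonal.mem_antidiagonal.1 hα] at h2
      exact (mul_le_of_le_one_right (abs_nonneg _) (hK _ _ _)).trans h2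
    refine (Finset.sum_le_sum h1).trans ?_
    rw [Finset.sum_const, Finset.Nat.card_antidiagonal, nsmul_eq_mul]
    have h3 := hpow (p.1 + p.2)
    calc ((p.1 + p.2 + 1 : ℕ) : ℝ) * (C * r ^ (p.1 + p.2))
        = C * ((((p.1 + p.2 : ℕ) : ℝ) + 1) * r ^ (p.1 + p.2)) := by push_cast; ring
      _ ≤ (C + 1) * (C₂ * R ^ (p.1 + p.2)) := by
          have h4 : 0 ≤ (((p.1 + p.2 : ℕ) : ℝ) + 1) * r ^ (p.1 + p.2) := by positivity
          nlinarith
      _ = _ := by ring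
  · have h1 := (Finset.HasAntidiagonal.sigmaAntidiagonalEquivProd.hasSum_iff.2 h).sigma
      (fun n => hasSum_fintype _)
    convert h1 using 1
    funext n
    rw [Finset.univ_eq_attach]
    refine Eq.trans ?_ (Finset.sum_attach (antidiagonal n)
      (fun α => c α * ζ.re ^ α.1 * ζ.im ^ α.2)).symm
    have h2 : ∑ p ∈ antidiagonal n, (∑ α ∈ antidiagonal (p.1 + p.2), (c α : ℂ) * K α.1 α.2 p)
        * (ζ ^ p.1 * conj ζ ^ p.2)
        = ((∑ α ∈ antidiagonal n, c α * ζ.re ^ α.1 * ζ.im ^ α.2 : ℝ) : ℂ) := by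
      have h3 : ∀ p ∈ antidiagonal n, (∑ α ∈ antidiagonal (p.1 + p.2), (c α : ℂ) * K α.1 α.2 p)
          * (ζ ^ p.1 * conj ζ ^ p.2)
          = ∑ α ∈ antidiagonal n, (c α : ℂ) * (K α.1 α.2 p * (ζ ^ p.1 * conj ζ ^ p.2)) := by
        intro p hp
        rw [Finset.HasAntidiagonal.mem_antidiagonal.1 hp, Finset.sum_mul]
        exact Finset.sum_congr rfl fun α _ => by ring
      rw [Finset.sum_congr rfl h3, Finset.sum_comm]
      push_cast
      refine Finset.sum_congr rfl fun α hα => ?_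
      rw [← Finset.mul_sum, mul_assoc, hKe, Finset.HasAntidiagonal.mem_antidiagonal.1 hα]
    rw [h2, Complex.ofReal_re]

/-! ### The regular part of the solution -/

theorem pairZ_eq_monom {ω δ : ℝ} (hω : 0 < ω) (hδ : 0 < δ) (hδπ : δ < Real.pi) {α : ℕ × ℕ}
    (h : α.2 ≠ 0) (p : ℝ × ℝ) : pairZ ω δ α p = monom α.1 α.2 p := by
  rcases pairZ_cases hω hδ hδπ α with ⟨_, h', _⟩ | ⟨_, h', _⟩ | ⟨-, h'⟩
  · exact absurd h' h
  · exact absurd h' h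
  · exact h' p

theorem monom_eq_mul (a b x θ : ℝ) :
    monom a b (x, θ) = (Real.exp ((a + b) * x) : ℂ) * monom a b (0, θ) := by
  rw [monom_eq, monom_eq]
  push_cast
  simp

theorem monom_succ_succ (a b : ℕ) (p : ℝ × ℝ) :
    monom (a + 1 : ℕ) (b + 1 : ℕ) p = (Real.exp (2 * p.1) : ℂ) * monom a b p := by
  rw [monom, monom, Complex.ofReal_exp, ← Complex.exp_add]
  congr 1
  apply Complex.ext <;> simp [logPoint] <;> ring

theorem sum_antidiagonal_fst (N : ℕ) (x : ℂ) :
    ∑ α ∈ antidiagonal (N + 2), (if α.1 = 0 then x else 0) = x := by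
  rw [Finset.Nat.sum_antidiagonal_succ]
  simp

theorem sum_antidiagonal_snd (N : ℕ) (x : ℂ) :
    ∑ α ∈ antidiagonal (N + 2), (if α.2 = 0 then x else 0) = x := by
  rw [Finset.Nat.sum_antidiagonal_succ']
  simp

/-- The coefficients of the part of the expansion that is indexed by pairs. Each homogeneous block
of the expansion is a particular solution of the Poisson equation, corrected by `conj ζ ^ N` to
vanish on the side `ϑ = 0` and by the special function of `(N, 0)` to vanish on `ϑ = ω`. -/
theorem exists_pair_coefficients {ω δ : ℝ} (hω : 0 < ω) (hω' : ω < 2 * Real.pi) (hδ : 0 < δ)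
    (hδω : δ < ω / 2) (hδπ : δ < Real.pi / 2) {F : ℕ × ℕ → ℂ} {C r R : ℝ} (hC : 0 < C)
    (hr : 0 < r) (hrR : r < R) (hF : ∀ p, ‖F p‖ ≤ C * r ^ (p.1 + p.2)) :
    ∃ a : ℕ × ℕ → ℂ, (∃ C', 0 < C' ∧ ∀ α, ‖a α‖ ≤ C' * R ^ (α.1 + α.2)) ∧
      (∀ ℓ, (a (ℓ, 0)).im = 0) ∧ (∀ α, α.1 + α.2 < 2 → a α = 0) ∧
      ∃ q : ℕ → ℝ × ℝ → ℝ, (∀ N p, 0 ≤ p.2 → p.2 ≤ ω →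
        q N p = (∑ α ∈ antidiagonal (N + 2), a α * pairZ ω δ α p).im) ∧
        (∀ N x, q N (x, 0) = 0) ∧ (∀ N x, q N (x, ω) = 0) ∧
        ∀ N, HasLaplace (q N) fun p => Real.exp (2 * p.1) *
          (∑ α ∈ antidiagonal N, F α * monom α.1 α.2 p).re := by
  choose E D hE hZ hD hE0 hEω using fun N : ℕ => exists_pairZ_model hω hδ hδω hδπ
    (Nat.succ_pos (N + 1))
  -- the coefficients of a particular solution; the quotient vanishes if `α.1 = 0` or `α.2 = 0`
  set H : ℕ × ℕ → ℂ := fun α => F (α.1 - 1, α.2 - 1) / (4 * α.1 * α.2) with hH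
  -- in degree `N + 2`, the traces of the particular solution on the sides are `P N exp ((N + 2) x)`
  -- and `Q N exp ((N + 2) x)`
  set P : ℕ → ℝ := fun N => (∑ α ∈ antidiagonal (N + 2), H α).re with hP
  set Q : ℕ → ℝ := fun N => (∑ α ∈ antidiagonal (N + 2), H α * monom α.1 α.2 (0, ω)).re with hQ
  -- the multiplier of the special function of `(N + 2, 0)` that cancels the trace on `θ = ω`
  set d : ℕ → ℝ := fun N => (P N * Real.cos (((N + 2 : ℕ) : ℝ) * ω) - Q N) / D N with hd
  set a : ℕ × ℕ → ℂ := fun α => if α.1 + α.2 < 2 then 0 else Complex.I * H α +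
    (if α.1 = 0 then -(Complex.I * P (α.2 - 2)) else 0) + (if α.2 = 0 then (d (α.1 - 2) : ℂ) else 0)
    with ha
  have hHz : ∀ α, α.1 = 0 ∨ α.2 = 0 → H α = 0 := by
    rintro α (h | h) <;> simp [hH, h]
  have hmem : ∀ {N : ℕ} {α : ℕ × ℕ}, α ∈ antidiagonal N → α.1 + α.2 = N := fun h =>
    Finset.HasAntidiagonal.mem_antidiagonal.1 h
  have hmemR : ∀ {N : ℕ} {α : ℕ × ℕ}, α ∈ antidiagonal N → (α.1 : ℝ) + α.2 = N := fun h => by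
    exact_mod_cast hmem h
  refine ⟨a, ?_, fun ℓ => ?_, fun α h => if_pos h, fun N p =>
    (∑ α ∈ antidiagonal (N + 2), H α * monom α.1 α.2 p).re + -P N * (monom 0 (N + 2 : ℕ) p).re
      + d N * (E N p).im, fun N p h0 h1 => ?_, fun N x => ?_, fun N x => ?_, fun N => ?_⟩
  · obtain ⟨C₂, hC₂, hpow⟩ := exists_mul_pow_le hr.le hrR
    have hpi := Real.pi_pos
    set C₁ := C / r ^ 2 with hC₁
    have hC₁0 : 0 < C₁ := by positivity
    have hHb : ∀ α, ‖H α‖ ≤ C₁ * r ^ (α.1 + α.2) := by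
      intro α
      by_cases h : α.1 = 0 ∨ α.2 = 0
      · rw [hHz α h, norm_zero]
        positivity
      · push Not at h
        obtain ⟨m, hm⟩ := Nat.exists_eq_succ_of_ne_zero h.1
        obtain ⟨n, hn⟩ := Nat.exists_eq_succ_of_ne_zero h.2
        have h1 : ‖H α‖ ≤ ‖F (m, n)‖ := by
          simp only [hH, hm, hn, Nat.succ_eq_add_one, Nat.add_sub_cancel]
          rw [norm_div]
          refine div_le_self (norm_nonneg _) ?_
          rw [norm_mul, norm_mul, Complex.norm_natCast, Complex.norm_natCast]
          push_cast
          rw [Complex.norm_ofNat]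
          nlinarith [(Nat.cast_nonneg m : (0 : ℝ) ≤ m), (Nat.cast_nonneg n : (0 : ℝ) ≤ n),
            mul_nonneg (Nat.cast_nonneg m : (0 : ℝ) ≤ m) (Nat.cast_nonneg n : (0 : ℝ) ≤ n)]
        refine (h1.trans (hF _)).trans (le_of_eq ?_)
        rw [hC₁, hm, hn]
        simp only [Nat.succ_eq_add_one]
        field_simp
        ring
    have hsumb : ∀ (N : ℕ) (g : ℕ × ℕ → ℂ), (∀ α, ‖g α‖ ≤ 1) →
        |(∑ α ∈ antidiagonal N, H α * g α).re| ≤ C₁ * (((N : ℝ) + 1) * r ^ N) := by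
      intro N g hg
      refine (Complex.abs_re_le_norm _).trans ((norm_sum_le _ _).trans ?_)
      have h1 : ∀ α ∈ antidiagonal N, ‖H α * g α‖ ≤ C₁ * r ^ N := by
        intro α hα
        rw [norm_mul, ← hmem hα]
        exact (mul_le_of_le_one_right (norm_nonneg _) (hg _)).trans (hHb α)
      refine (Finset.sum_le_sum h1).trans (le_of_eq ?_)
      rw [Finset.sum_const, Finset.Nat.card_antidiagonal, nsmul_eq_mul]
      push_cast
      ring
    have hPb : ∀ N, |P N| ≤ C₁ * ((((N + 2 : ℕ) : ℝ) + 1) * r ^ (N + 2)) := fun N => by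
      simpa [hP] using hsumb (N + 2) (fun _ => 1) (fun _ => by simp)
    have hQb : ∀ N, |Q N| ≤ C₁ * ((((N + 2 : ℕ) : ℝ) + 1) * r ^ (N + 2)) := fun N =>
      hsumb (N + 2) (fun α => monom α.1 α.2 (0, ω)) (fun α => by rw [norm_monom]; simp)
    have hdb : ∀ N, |d N| ≤ (Real.pi / δ) * C₁ * ((((N + 2 : ℕ) : ℝ) + 1) * r ^ (N + 2)) := by
      intro N
      have hD0 : 0 < |D N| := lt_of_lt_of_le (by positivity) (hD N)
      simp only [hd]
      rw [abs_div, div_le_iff₀ hD0]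
      have h1 : |P N * Real.cos (((N + 2 : ℕ) : ℝ) * ω) - Q N| ≤ |P N| + |Q N| := by
        refine (norm_sub_le (P N * Real.cos (((N + 2 : ℕ) : ℝ) * ω)) (Q N)).trans ?_
        rw [Real.norm_eq_abs, Real.norm_eq_abs, abs_mul]
        gcongr
        exact mul_le_of_le_one_right (abs_nonneg _) (Real.abs_cos_le_one _)
      have h2 : 0 ≤ C₁ * ((((N + 2 : ℕ) : ℝ) + 1) * r ^ (N + 2)) := by positivity
      have h3 : 2 ≤ Real.pi / δ * |D N| := by
        calc (2 : ℝ) = Real.pi / δ * (2 * δ / Real.pi) := by field_simp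
          _ ≤ _ := by gcongr; exact hD N
      nlinarith [hPb N, hQb N]
    refine ⟨C₁ * (2 + Real.pi / δ) * C₂, by positivity, fun α => ?_⟩
    by_cases h : α.1 + α.2 < 2
    · simp only [ha, if_pos h, norm_zero]
      have := hr.trans hrR
      positivity
    · simp only [ha, if_neg h]
      set T := C₁ * (((α.1 + α.2 : ℕ) : ℝ) + 1) * r ^ (α.1 + α.2) with hT
      have hT0 : 0 ≤ T := by positivity
      have b1 : ‖Complex.I * H α‖ ≤ T := by
        rw [norm_mul, Complex.norm_I, one_mul]
        refine (hHb α).trans ?_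
        rw [hT]
        have : (1 : ℝ) ≤ ((α.1 + α.2 : ℕ) : ℝ) + 1 := by
          have := (Nat.cast_nonneg (α.1 + α.2) : (0 : ℝ) ≤ _)
          linarith
        have h5 : 0 ≤ C₁ * r ^ (α.1 + α.2) := by positivity
        nlinarith
      have b2 : ‖(if α.1 = 0 then -(Complex.I * P (α.2 - 2)) else 0 : ℂ)‖ ≤ T := by
        split_ifs with h1
        · rw [norm_neg, norm_mul, Complex.norm_I, one_mul, Complex.norm_real, Real.norm_eq_abs]
          have h2 := hPb (α.2 - 2)
          rw [Nat.sub_add_cancel (by omega)] at h2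
          rw [hT, h1, zero_add, mul_assoc]
          exact h2
        · simpa using hT0
      have b3 : ‖(if α.2 = 0 then (d (α.1 - 2) : ℂ) else 0)‖ ≤ Real.pi / δ * T := by
        split_ifs with h1
        · rw [Complex.norm_real, Real.norm_eq_abs]
          have h2 := hdb (α.1 - 2)
          rw [Nat.sub_add_cancel (by omega)] at h2
          rw [hT, h1, add_zero]
          refine h2.trans (le_of_eq ?_)
          ring
        · rw [norm_zero]
          positivity
      refine (norm_add₃_le).trans ?_
      have h6 := hpow (α.1 + α.2)
      calc _ ≤ T + T + Real.pi / δ * T := by gcongr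
        _ = C₁ * (2 + Real.pi / δ) * ((((α.1 + α.2 : ℕ) : ℝ) + 1) * r ^ (α.1 + α.2)) := by
            rw [hT]
            ring
        _ ≤ C₁ * (2 + Real.pi / δ) * (C₂ * R ^ (α.1 + α.2)) := by gcongr
        _ = _ := by ring
  · simp only [ha]
    split_ifs with h1 h2
    · simp
    · omega
    · rw [hHz (ℓ, 0) (Or.inr rfl)]
      simp
  · have h2 : p.2 < 2 * Real.pi := h1.trans_lt hω'
    have hterm : ∀ α ∈ antidiagonal (N + 2), a α * pairZ ω δ α p = Complex.I *
        (H α * monom α.1 α.2 p) + (if α.1 = 0 then -(Complex.I * P N) * monom 0 (N + 2 : ℕ) p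
        else 0) + (if α.2 = 0 then (d N : ℂ) * E N p else 0) := by
      intro α hα
      have hs := hmem hα
      simp only [ha, if_neg (show ¬ α.1 + α.2 < 2 by omega)]
      by_cases hα2 : α.2 = 0
      · have hα1 : α.1 = N + 2 := by omega
        have he : α = (N + 2, 0) := Prod.ext hα1 hα2
        have hα1' : α.1 ≠ 0 := by omega
        rw [hHz α (Or.inr hα2), if_neg hα1', if_pos hα2, if_neg hα1', if_pos hα2, he,
          hZ N p h0 h2]
        simp
      · rw [if_neg hα2, if_neg hα2, pairZ_eq_monom hω hδ (by linarith [Real.pi_pos]) hα2]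
        by_cases hα1 : α.1 = 0
        · have : α.2 = N + 2 := by omega
          rw [if_pos hα1, if_pos hα1, hα1, this]
          simp only [Nat.add_sub_cancel, Nat.cast_zero]
          ring
        · rw [if_neg hα1, if_neg hα1]
          ring
    rw [Finset.sum_congr rfl hterm, Finset.sum_add_distrib, Finset.sum_add_distrib,
      ← Finset.mul_sum, sum_antidiagonal_fst, sum_antidiagonal_snd]
    simp
  · have h1 : ∀ α ∈ antidiagonal (N + 2), H α * monom α.1 α.2 (x, 0)
        = (Real.exp ((N + 2 : ℕ) * x) : ℂ) * H α := by
      intro α hα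
      have : monom α.1 α.2 (0, 0) = 1 := by rw [monom_eq]; simp
      rw [monom_eq_mul, hmemR hα, this]
      ring
    simp only
    rw [Finset.sum_congr rfl h1, ← Finset.mul_sum, Complex.re_ofReal_mul, hE0, monom_re]
    simp [hP]
    ring
  · have h1 : ∀ α ∈ antidiagonal (N + 2), H α * monom α.1 α.2 (x, ω)
        = (Real.exp ((N + 2 : ℕ) * x) : ℂ) * (H α * monom α.1 α.2 (0, ω)) := by
      intro α hα
      rw [monom_eq_mul, hmemR hα]
      ring
    have hD0 : D N ≠ 0 := abs_pos.1 (lt_of_lt_of_le (by have := Real.pi_pos; positivity) (hD N))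
    simp only
    rw [Finset.sum_congr rfl h1, ← Finset.mul_sum, Complex.re_ofReal_mul, hEω, monom_re, zero_add,
      zero_sub]
    simp only [neg_mul, Real.cos_neg]
    change Real.exp _ * Q N + _ + _ = 0
    simp only [hd]
    field_simp
    ring
  · have l1 := (HasLaplace.sum (antidiagonal (N + 2)) fun α : ℕ × ℕ =>
      (hasLaplace_monom α.1 α.2).const_mul (H α)).map Complex.reCLM
    have l2 := ((hasLaplace_monom 0 (N + 2 : ℕ)).map Complex.reCLM).map
      (ContinuousLinearMap.mul ℝ ℝ (-P N))
    have l3 := ((hE N).map Complex.imCLM).map (ContinuousLinearMap.mul ℝ ℝ (d N))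
    have l4 := (l1.add l2).add l3
    have h5 : ∀ p, Real.exp (2 * p.1) * (∑ α ∈ antidiagonal N, F α * monom α.1 α.2 p).re
        = Complex.reCLM (∑ α ∈ antidiagonal (N + 2),
            H α * ((4 * α.1 * α.2 : ℝ) * monom α.1 α.2 p))
          + ContinuousLinearMap.mul ℝ ℝ (-P N) (Complex.reCLM
            ((4 * 0 * (N + 2 : ℕ) : ℝ) * monom 0 (N + 2 : ℕ) p))
          + ContinuousLinearMap.mul ℝ ℝ (d N) (Complex.imCLM 0) := by
      intro p
      have h1 : ∑ α ∈ antidiagonal (N + 2), H α * ((4 * α.1 * α.2 : ℝ) * monom α.1 α.2 p)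
          = (Real.exp (2 * p.1) : ℂ) * ∑ α ∈ antidiagonal N, F α * monom α.1 α.2 p := by
        rw [Finset.Nat.sum_antidiagonal_succ, Finset.Nat.sum_antidiagonal_succ',
          hHz _ (Or.inl rfl), hHz (_, 0) (Or.inr rfl), zero_mul, zero_mul, zero_add, zero_add,
          Finset.mul_sum]
        refine Finset.sum_congr rfl fun α _ => ?_
        simp only [hH, Nat.add_sub_cancel]
        rw [monom_succ_succ]
        have e1 : ((α.1 + 1 : ℕ) : ℂ) ≠ 0 := Nat.cast_ne_zero.2 (Nat.succ_ne_zero _)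
        have e2 : ((α.2 + 1 : ℕ) : ℂ) ≠ 0 := Nat.cast_ne_zero.2 (Nat.succ_ne_zero _)
        rw [div_mul_eq_mul_div, div_eq_iff (mul_ne_zero (mul_ne_zero (by norm_num) e1) e2)]
        push_cast
        ring
      rw [h1, Complex.reCLM_apply, Complex.re_ofReal_mul]
      simp
    rw [funext h5]
    exact l4

/-! ### Series dominated near the vertex -/

/-- The series `∑ g i` is dominated by a convergent numerical series on each part `p.1 ≤ b`,
`b < X`, of the half-strip. -/
def IsDominated {ι : Type*} (X ω : ℝ) (g : ι → ℝ × ℝ → ℝ) : Prop :=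
  ∀ b < X, ∃ B : ι → ℝ, Summable B ∧ ∀ i, ∀ p ∈ halfStrip X ω, p.1 ≤ b → |g i p| ≤ B i

namespace IsDominated

variable {ι : Type*} {X ω : ℝ} {g : ι → ℝ × ℝ → ℝ}

theorem summable (h : IsDominated X ω g) {p : ℝ × ℝ} (hp : p ∈ halfStrip X ω) :
    Summable fun i => g i p := by
  obtain ⟨B, hB, hb⟩ := h p.1 hp.1
  exact Summable.of_norm_bounded hB fun i => hb i p hp le_rfl

theorem bounded (h : IsDominated X ω g) {b : ℝ} (hb : b < X) :
    ∃ C, ∀ p ∈ halfStrip X ω, p.1 ≤ b → |∑' i, g i p| ≤ C := by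
  obtain ⟨B, hB, hB'⟩ := h b hb
  exact ⟨∑' i, B i, fun p hp hpb =>
    (Real.norm_eq_abs _).ge.trans (tsum_of_norm_bounded hB.hasSum fun i => hB' i p hp hpb)⟩

theorem continuousOn (h : IsDominated X ω g) (hg : ∀ i, Continuous (g i)) :
    ContinuousOn (fun p => ∑' i, g i p) (halfStrip X ω) := by
  intro p hp
  obtain ⟨b, hb, hbX⟩ := exists_between (show p.1 < X from hp.1)
  obtain ⟨B, hB, hB'⟩ := h b hbX
  have h1 : ContinuousOn (fun p => ∑' i, g i p) (halfStrip b ω) :=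
    continuousOn_tsum (fun i => (hg i).continuousOn) hB fun i q hq =>
      hB' i q ⟨lt_trans hq.1 hbX, hq.2⟩ (le_of_lt hq.1)
  have hopen : IsOpen (halfStrip b ω) := isOpen_Iio.prod isOpen_Ioo
  exact (h1.continuousAt (hopen.mem_nhds ⟨hb, hp.2⟩)).continuousWithinAt

/-- Termwise integration against a weight. -/
theorem integral_mul (h : IsDominated X ω g) [Countable ι] (hg : ∀ i, Continuous (g i))
    {κ : ℝ × ℝ → ℝ} (hκ : IsWeight X κ) :
    IntegrableOn (fun p => (∑' i, g i p) * κ p) (halfStrip X ω) ∧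
    HasSum (fun i => ∫ p in halfStrip X ω, g i p * κ p)
      (∫ p in halfStrip X ω, (∑' i, g i p) * κ p) := by
  obtain ⟨a, b, hb, hz⟩ := hκ.supp
  obtain ⟨B, hB, hB'⟩ := h b hb
  have hm := measurableSet_halfStrip X ω
  have hκi : Integrable (fun p => |κ p|) (volume.restrict (halfStrip X ω)) :=
    hκ.integrableOn.abs
  have hle : ∀ i, ∀ p ∈ halfStrip X ω, ‖g i p * κ p‖ ≤ B i * |κ p| := fun i p hp => by
    rw [norm_mul, Real.norm_eq_abs, Real.norm_eq_abs]
    by_cases hx : p.1 ∈ Set.Icc a b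
    · exact mul_le_mul_of_nonneg_right (hB' i p hp hx.2) (abs_nonneg _)
    · simp [hz p hx]
  refine ⟨?_, ?_⟩
  · refine (hκi.const_mul (∑' i, B i)).mono' ?_ ?_
    · exact ((h.continuousOn hg).mul hκ.cont.continuousOn).aestronglyMeasurable hm
    · filter_upwards [ae_restrict_mem hm] with p hp
      rw [← tsum_mul_right, ← tsum_mul_right]
      exact tsum_of_norm_bounded (hB.mul_right _).hasSum fun i => hle i p hp
  · refine hasSum_integral_of_dominated_convergence (fun i p => B i * |κ p|)
      (fun i => ((hg i).mul hκ.cont).aestronglyMeasurable) (fun i => ?_)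
      (ae_of_all _ fun p => hB.mul_right _) ?_ ?_
    · filter_upwards [ae_restrict_mem hm] with p hp
      exact hle i p hp
    · simp only [tsum_mul_right]
      exact hκi.const_mul _
    · filter_upwards [ae_restrict_mem hm] with p hp
      exact (h.summable hp).hasSum.mul_right _

end IsDominated

/-- Domination by a geometric series with a linear factor. The exponent `2 |x|` makes room for the
logarithmic growth of the special functions at the vertex, which the factor `exp (2 x)` absorbs. -/
theorem isDominated_of_le {X ω R K : ℝ} {m : ℕ} (hR : 0 < R) (hRX : R ≤ Real.exp (-X))
    {g : ℕ → ℝ × ℝ → ℝ}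
    (hg : ∀ N, ∀ p ∈ halfStrip X ω,
      |g N p| ≤ K * ((N + 1 + m : ℕ) * R ^ N * Real.exp (2 * |p.1| + (N + 2) * p.1))) :
    IsDominated X ω g := by
  intro b hb
  obtain ⟨y, hby, hyX⟩ := exists_between hb
  have hlt : R * Real.exp b < R * Real.exp y :=
    mul_lt_mul_of_pos_left (Real.exp_lt_exp.2 hby) hR
  have hlt1 : R * Real.exp y < 1 := by
    calc R * Real.exp y ≤ Real.exp (-X) * Real.exp y := by gcongr
      _ = Real.exp (y - X) := by rw [← Real.exp_add]; congr 1; ring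
      _ < 1 := Real.exp_lt_one_iff.2 (by linarith)
  obtain ⟨C, hC, hle⟩ := exists_mul_pow_le (r := R * Real.exp b) (by positivity) hlt
  refine ⟨fun N => |K| * (1 + m) * Real.exp (4 * |b|) * (C * (R * Real.exp y) ^ N),
    ((summable_geometric_of_lt_one (by positivity) hlt1).mul_left C).mul_left _,
    fun N p hp hpb => (hg N p hp).trans ?_⟩
  have e1 : Real.exp (2 * |p.1| + (N + 2) * p.1) ≤ Real.exp (4 * |b|) * Real.exp b ^ N := by
    rw [← Real.exp_nat_mul, ← Real.exp_add]
    refine Real.exp_le_exp.2 ?_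
    have : (N : ℝ) * p.1 ≤ N * b := by gcongr
    have : 2 * |p.1| + 2 * p.1 ≤ 4 * |b| := by
      have := le_abs_self b
      have := abs_nonneg b
      cases abs_cases p.1 <;> linarith
    linarith
  have e2 : ((N + 1 + m : ℕ) : ℝ) ≤ (1 + m) * (N + 1) := by
    push_cast
    have : 0 ≤ (m : ℝ) * N := by positivity
    linarith
  calc K * ((N + 1 + m : ℕ) * R ^ N * Real.exp (2 * |p.1| + (N + 2) * p.1))
      ≤ |K| * (((1 + m) * (N + 1)) * R ^ N * (Real.exp (4 * |b|) * Real.exp b ^ N)) := by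
        gcongr
        exact le_abs_self K
    _ = |K| * (1 + m) * Real.exp (4 * |b|) * ((N + 1) * (R * Real.exp b) ^ N) := by
        rw [mul_pow]
        ring
    _ ≤ |K| * (1 + m) * Real.exp (4 * |b|) * (C * (R * Real.exp y) ^ N) := by
        exact mul_le_mul_of_nonneg_left (hle N) (by positivity)

theorem summable_exp_coeff {X ω : ℝ} (hω : 0 < ω) {b : ℕ+ → ℝ}
    (hb : ∀ y < X, ∃ C, ∀ k : ℕ+, |b k| ≤ C * Real.exp (-(k * Real.pi / ω * y))) {x : ℝ}
    (hx : x < X) : Summable fun k : ℕ+ => |b k * Real.exp (k * Real.pi / ω * x)| := by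
  obtain ⟨y, hxy, hyX⟩ := exists_between hx
  obtain ⟨C, hC⟩ := hb y hyX
  have hr : Real.exp (-(Real.pi / ω * (y - x))) < 1 := Real.exp_lt_one_iff.2 (by
    have := Real.pi_pos
    have : 0 < Real.pi / ω * (y - x) := mul_pos (by positivity) (by linarith)
    linarith)
  have hs := (summable_geometric_of_lt_one (Real.exp_pos _).le hr).mul_left C
  refine Summable.of_nonneg_of_le (fun _ => abs_nonneg _) (fun k => ?_)
    (hs.comp_injective PNat.coe_injective)
  rw [abs_mul, abs_of_pos (Real.exp_pos _)]
  calc |b k| * Real.exp (k * Real.pi / ω * x)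
      ≤ C * Real.exp (-(k * Real.pi / ω * y)) * Real.exp (k * Real.pi / ω * x) := by
        gcongr
        exact hC k
    _ = _ := by
        rw [Function.comp_apply, ← Real.exp_nat_mul, mul_assoc, ← Real.exp_add]
        congr 2
        ring

/-- Domination of a series of separated harmonic functions. -/
theorem isDominated_sine {X ω : ℝ} (hω : 0 < ω) {b : ℕ+ → ℝ}
    (hb : ∀ y < X, ∃ C, ∀ k : ℕ+, |b k| ≤ C * Real.exp (-(k * Real.pi / ω * y))) :
    IsDominated X ω fun (k : ℕ+) p =>
      b k * Real.exp (k * Real.pi / ω * p.1) * Real.sin (k * Real.pi / ω * p.2) := by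
  intro x hx
  refine ⟨_, summable_exp_coeff hω hb hx, fun k p _ hpx => ?_⟩
  rw [abs_mul]
  refine (mul_le_of_le_one_right (abs_nonneg _) (Real.abs_sin_le_one _)).trans ?_
  rw [abs_mul, abs_mul, abs_of_pos (Real.exp_pos _), abs_of_pos (Real.exp_pos _)]
  have := Real.pi_pos
  gcongr

/-! ### Sine coefficients of harmonic functions on the half-strip -/

section

variable {X ω : ℝ} {D : ℝ × ℝ → ℝ}

theorem IsBump.translate {η : ℝ → ℝ} (h : IsBump X η) {j : ℝ} (hj : 0 ≤ j) :
    IsBump X fun x => η (x + j) := by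
  obtain ⟨a, b, hab, hb, hz⟩ := h.supp
  refine ⟨h.smooth.comp (contDiff_id.add contDiff_const), a - j, b - j, by linarith, by linarith,
    fun x hx => hz _ fun hc => hx ⟨by linarith [hc.1], by linarith [hc.2]⟩⟩

theorem IsBump.mono {Y : ℝ} {η : ℝ → ℝ} (h : IsBump Y η) (hYX : Y ≤ X) : IsBump X η := by
  obtain ⟨a, b, hab, hb, hz⟩ := h.supp
  exact ⟨h.smooth, a, b, hab, hb.trans_le hYX, hz⟩

/-- A bump function that has positive integrals against all positive continuous functions. -/
theorem exists_bump_integral_pos (X : ℝ) : ∃ η, IsBump X η ∧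
    ∀ g : ℝ → ℝ, Continuous g → (∀ x, 0 < g x) → 0 < ∫ x, g x * η x := by
  let η : ContDiffBump (X - 4) := ⟨1, 2, by norm_num, by norm_num⟩
  have hη : IsBump X η := by
    refine ⟨η.contDiff, X - 6, X - 2, by linarith, by linarith, fun x hx => ?_⟩
    refine η.zero_of_le_dist ?_
    rw [Real.dist_eq]
    by_contra hc
    have := abs_lt.1 (not_le.1 hc)
    have h2 : η.rOut = 2 := rfl
    rw [h2] at this
    exact hx ⟨by linarith, by linarith⟩
  refine ⟨η, hη, fun g hg hpos => ?_⟩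
  have hc : Continuous fun x => g x * η x := hg.mul hη.smooth.continuous
  refine hc.integral_pos_of_hasCompactSupport_nonneg_nonzero hη.hasCompactSupport.mul_left
    (fun x => mul_nonneg (hpos x).le η.nonneg) (x := X - 4) ?_
  have : η (X - 4) = 1 := η.one_of_mem_closedBall (Metric.mem_closedBall_self zero_le_one)
  rw [this, mul_one]
  exact (hpos _).ne'

theorem locallyIntegrableOn_section
    (hD : ∀ κ, IsWeight X κ → IntegrableOn (fun p => D p * κ p) (halfStrip X ω)) {σ : ℝ → ℝ}
    (hσ : Continuous σ) :
    LocallyIntegrableOn (fun x => ∫ θ in Set.Ioo 0 ω, D (x, θ) * σ θ) (Set.Iio X) := by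
  intro x₀ hx₀
  have hx₀' : x₀ < X := hx₀
  set ε := (X - x₀) / 3 with hε
  have hε0 : 0 < ε := by rw [hε]; linarith
  -- a continuous cut-off that is `1` near `x₀`
  let χ : ℝ → ℝ := fun x => max 0 (min 1 (2 - |x - x₀| / ε))
  have hχ : Continuous χ := by fun_prop
  have hw : IsWeight X fun p => χ p.1 * σ p.2 := by
    refine ⟨by fun_prop, x₀ - 2 * ε, x₀ + 2 * ε, by rw [hε]; linarith, fun p hp => ?_⟩
    have : 2 * ε ≤ |p.1 - x₀| := by
      by_contra hc
      have := abs_lt.1 (not_le.1 hc)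
      exact hp ⟨by linarith, by linarith⟩
    have : 2 ≤ |p.1 - x₀| / ε := (le_div_iff₀ hε0).2 this
    have : χ p.1 = 0 := max_eq_left ((min_le_right _ _).trans (by linarith))
    simp [this]
  have h1 : IntegrableOn (fun x => ∫ θ in Set.Ioo 0 ω, D (x, θ) * (χ x * σ θ)) (Set.Iio X) := by
    have := hD _ hw
    rw [IntegrableOn, halfStrip, Measure.volume_eq_prod, ← Measure.prod_restrict] at this
    exact this.integral_prod_left
  refine ⟨Set.Iio X ∩ Metric.ball x₀ ε,
    inter_mem self_mem_nhdsWithin (mem_nhdsWithin_of_mem_nhds (Metric.ball_mem_nhds _ hε0)), ?_⟩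
  refine (h1.mono_set Set.inter_subset_left).congr_fun (fun x hx => ?_)
    (measurableSet_Iio.inter Metric.isOpen_ball.measurableSet)
  have : |x - x₀| / ε ≤ 1 := by
    have := hx.2
    rw [Metric.mem_ball, Real.dist_eq] at this
    exact (div_le_one hε0).2 this.le
  have : χ x = 1 := by
    have h2 : min 1 (2 - |x - x₀| / ε) = 1 := min_eq_left (by linarith)
    simp [χ, h2]
  simp only [this, one_mul]

/-- The pairing with a product weight is that of a section. -/
theorem integral_section
    (hD : ∀ κ, IsWeight X κ → IntegrableOn (fun p => D p * κ p) (halfStrip X ω)) {σ η : ℝ → ℝ}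
    (hσ : Continuous σ) (hη : IsBump X η) :
    ∫ p in halfStrip X ω, D p * (η p.1 * σ p.2)
      = ∫ x, (∫ θ in Set.Ioo 0 ω, D (x, θ) * σ θ) * η x := by
  rw [setIntegral_halfStrip (hD _ (hη.isWeight hσ))]
  have h1 : ∫ x in Set.Iio X, (∫ θ in Set.Ioo 0 ω, D (x, θ) * σ θ) * η x
      = ∫ x, (∫ θ in Set.Ioo 0 ω, D (x, θ) * σ θ) * η x :=
    setIntegral_eq_integral_of_forall_compl_eq_zero fun x hx => by
      rw [hη.eq_zero (not_lt.1 hx), mul_zero]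
  rw [← h1]
  refine integral_congr_ae (ae_of_all _ fun x => ?_)
  simp only
  rw [← integral_mul_const]
  congr 1
  ext θ
  ring

/-- A sine coefficient of a weakly harmonic function on the half-strip has no growing part if it
is bounded in the mean along translates of a bump. -/
theorem ae_section_eq_exp {s : ℝ} (hs : 0 < s)
    (hD : ∀ κ, IsWeight X κ → IntegrableOn (fun p => D p * κ p) (halfStrip X ω))
    (hode : ∀ η, IsBump X η →
      ∫ p in halfStrip X ω, D p * ((deriv (deriv η) p.1 - s ^ 2 * η p.1) * Real.sin (s * p.2)) = 0)
    (hb : ∃ C, ∀ η, IsBump (X - 1) η →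
      |∫ p in halfStrip X ω, D p * (η p.1 * Real.sin (s * p.2))|
        ≤ C * (1 + (∫ x, η x ^ 2) + ∫ x, |η x|)) :
    ∃ b, ∀ᵐ x, x ∈ Set.Iio X →
      ∫ θ in Set.Ioo 0 ω, D (x, θ) * Real.sin (s * θ) = b * Real.exp (s * x) := by
  have hsin : Continuous fun θ => Real.sin (s * θ) := by fun_prop
  have hW := locallyIntegrableOn_section hD hsin
  obtain ⟨b, d, hbd⟩ := ae_eq_exp_of_weak_ode hs.ne' hW fun η hη => by
    have h1 : IsBump X fun x => deriv (deriv η) x - s ^ 2 * η x := by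
      have := hη.deriv.deriv.add (hη.const_smul (-s ^ 2))
      convert this using 2 with x
      simp
      ring
    rw [← integral_section hD hsin h1]
    exact hode η hη
  obtain ⟨C, hC⟩ := hb
  obtain ⟨η, hη, hpos⟩ := exists_bump_integral_pos (X - 1)
  set K := C * (1 + (∫ x, η x ^ 2) + ∫ x, |η x|) with hK
  set Ip := ∫ x, Real.exp (s * x) * η x with hIp
  set Im := ∫ x, Real.exp (-s * x) * η x with hIm
  have hImpos : 0 < Im := hpos _ (by fun_prop) fun x => Real.exp_pos _
  have hIppos : 0 < Ip := hpos _ (by fun_prop) fun x => Real.exp_pos _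
  have hint : ∀ c : ℝ, Integrable fun x => Real.exp (c * x) * η x := fun c =>
    Continuous.integrable_of_hasCompactSupport
      ((by fun_prop : Continuous fun x => Real.exp (c * x)).mul hη.smooth.continuous)
      hη.hasCompactSupport.mul_left
  have htr : ∀ (c : ℝ) (j : ℝ), ∫ x, Real.exp (c * x) * η (x + j)
      = Real.exp (-(c * j)) * ∫ x, Real.exp (c * x) * η x := fun c j => by
    rw [← integral_const_mul, ← integral_add_right_eq_self
      (fun x => Real.exp (-(c * j)) * (Real.exp (c * x) * η x)) j]
    congr 1
    ext x
    rw [← mul_assoc, ← Real.exp_add]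
    congr 2
    ring
  have hintj : ∀ (c : ℝ) (j : ℝ), Integrable fun x => Real.exp (c * x) * η (x + j) := fun c j => by
    have := ((hint c).comp_add_right j).const_mul (Real.exp (-(c * j)))
    refine this.congr (ae_of_all _ fun x => ?_)
    simp only
    rw [← mul_assoc, ← Real.exp_add]
    congr 2
    ring
  -- along the translate of the bump by `-n`, the growing part is multiplied by `exp (s n)`
  have hkey : ∀ n : ℕ, |d| * Im * Real.exp s ^ n ≤ K + |b| * Ip := by
    intro n
    have hn : (0 : ℝ) ≤ n := n.cast_nonneg
    have h1 := hC _ (hη.translate hn)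
    rw [integral_section hD hsin ((hη.translate hn).mono (sub_le_self _ zero_le_one)),
      integral_add_right_eq_self (fun x => η x ^ 2) (n : ℝ),
      integral_add_right_eq_self (fun x => |η x|) (n : ℝ), ← hK] at h1
    have h2 : ∫ x, (∫ θ in Set.Ioo 0 ω, D (x, θ) * Real.sin (s * θ)) * η (x + n)
        = b * (Real.exp (-(s * n)) * Ip) + d * (Real.exp (s * n) * Im) := by
      have h3 : (fun x => (∫ θ in Set.Ioo 0 ω, D (x, θ) * Real.sin (s * θ)) * η (x + n))
          =ᵐ[volume] fun x => b * (Real.exp (s * x) * η (x + n))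
            + d * (Real.exp (-s * x) * η (x + n)) := by
        filter_upwards [hbd] with x hx
        by_cases hxX : x ∈ Set.Iio X
        · rw [hx hxX]
          ring_nf
        · have : η (x + n) = 0 := hη.eq_zero (by
            have : X ≤ x := not_lt.1 hxX
            linarith)
          simp [this]
      rw [integral_congr_ae h3, integral_add ((hintj _ _).const_mul _) ((hintj _ _).const_mul _),
        integral_const_mul, integral_const_mul, htr, htr]
      simp only [hIp, hIm]
      ring_nf
    rw [h2] at h1
    have h4 : |d| * Im * Real.exp s ^ n = |d * (Real.exp (s * n) * Im)| := by
      rw [abs_mul, abs_mul, abs_of_pos hImpos, abs_of_pos (Real.exp_pos _), ← Real.exp_nat_mul,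
        mul_comm (n : ℝ)]
      ring
    have h5 : |b * (Real.exp (-(s * n)) * Ip)| ≤ |b| * Ip := by
      rw [abs_mul, abs_mul, abs_of_pos hIppos, abs_of_pos (Real.exp_pos _)]
      gcongr
      refine mul_le_of_le_one_left hIppos.le (Real.exp_le_one_iff.2 ?_)
      have := mul_nonneg hs.le hn
      linarith
    rw [h4]
    have h6 := abs_sub_abs_le_abs_add (d * (Real.exp (s * n) * Im)) (b * (Real.exp (-(s * n)) * Ip))
    rw [add_comm] at h6
    linarith
  have hd : d = 0 := by
    by_contra hd
    have hpos : 0 < |d| * Im := mul_pos (abs_pos.2 hd) hImpos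
    obtain ⟨n, hn⟩ := pow_unbounded_of_one_lt ((K + |b| * Ip) / (|d| * Im))
      (Real.one_lt_exp_iff.2 hs)
    rw [div_lt_iff₀ hpos] at hn
    linarith [hkey n]
  refine ⟨b, ?_⟩
  filter_upwards [hbd] with x hx hxX
  rw [hx hxX, hd, zero_mul, add_zero]

/-- A function on the half-strip whose sine coefficients are exponentials is the sum of its sine
series. The bound of the coefficients comes from one section close to the end of the
half-strip. -/
theorem ae_eq_sine_sum (hω : 0 < ω)
    (hDm : AEStronglyMeasurable D (volume.restrict (halfStrip X ω)))
    (hD2 : ∀ᵐ x, x ∈ Set.Iio X →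
      MemLp (fun θ => D (x, θ)) 2 (volume.restrict (Set.Ioo 0 ω))) {b : ℕ+ → ℝ}
    (hb : ∀ k : ℕ+, ∀ᵐ x, x ∈ Set.Iio X →
      ∫ θ in Set.Ioo 0 ω, D (x, θ) * Real.sin (k * Real.pi / ω * θ)
        = ω / 2 * b k * Real.exp (k * Real.pi / ω * x)) :
    (∀ y < X, ∃ C, ∀ k : ℕ+, |b k| ≤ C * Real.exp (-(k * Real.pi / ω * y))) ∧
    ∀ᵐ p ∂(volume.restrict (halfStrip X ω)), D p = ∑' k : ℕ+,
      b k * Real.exp (k * Real.pi / ω * p.1) * Real.sin (k * Real.pi / ω * p.2) := by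
  have hbound : ∀ y < X, ∃ C, ∀ k : ℕ+, |b k| ≤ C * Real.exp (-(k * Real.pi / ω * y)) := by
    intro y hy
    have hall := ae_all_iff.2 hb
    have hne : (volume.restrict (Set.Ioo y X)) ≠ 0 := by
      rw [Ne, Measure.restrict_eq_zero, Real.volume_Ioo]
      simp [hy]
    have : (ae (volume.restrict (Set.Ioo y X))).NeBot := ae_neBot.2 hne
    obtain ⟨x, hx, hx2, hxb⟩ := ((ae_restrict_mem measurableSet_Ioo).and
      ((ae_restrict_of_ae hD2).and (ae_restrict_of_ae (s := Set.Ioo y X) hall))).exists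
    have hI := (hx2 hx.2).integrable (by norm_num)
    refine ⟨2 / ω * ∫ θ in Set.Ioo 0 ω, |D (x, θ)|, fun k => ?_⟩
    have h1 : |ω / 2 * b k * Real.exp (k * Real.pi / ω * x)|
        ≤ ∫ θ in Set.Ioo 0 ω, |D (x, θ)| := by
      rw [← hxb k hx.2]
      refine norm_integral_le_of_norm_le (G := ℝ) hI.abs (ae_of_all _ fun θ => ?_)
      rw [norm_mul]
      exact mul_le_of_le_one_right (abs_nonneg _) (Real.abs_sin_le_one _)
    rw [abs_mul, abs_mul, abs_of_pos (Real.exp_pos _), abs_of_pos (by positivity : 0 < ω / 2)] at h1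
    have h2 : Real.exp (k * Real.pi / ω * y) ≤ Real.exp (k * Real.pi / ω * x) := by
      have := Real.pi_pos
      have := hx.1.le
      gcongr
    rw [Real.exp_neg, ← div_eq_mul_inv, le_div_iff₀ (Real.exp_pos _)]
    calc |b k| * Real.exp (k * Real.pi / ω * y) ≤ |b k| * Real.exp (k * Real.pi / ω * x) := by
          gcongr
      _ = 2 / ω * (ω / 2 * |b k| * Real.exp (k * Real.pi / ω * x)) := by
          field_simp
      _ ≤ _ := by gcongr
  refine ⟨hbound, ?_⟩
  have hdom := isDominated_sine hω hbound
  set H : ℝ × ℝ → ℝ := fun p => ∑' k : ℕ+,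
      b k * Real.exp (k * Real.pi / ω * p.1) * Real.sin (k * Real.pi / ω * p.2) with hH
  have hHm : AEStronglyMeasurable H (volume.restrict (halfStrip X ω)) :=
    (hdom.continuousOn fun k => by fun_prop).aestronglyMeasurable (measurableSet_halfStrip X ω)
  have hprod : (volume : Measure (ℝ × ℝ)).restrict (halfStrip X ω)
      = (volume.restrict (Set.Iio X)).prod (volume.restrict (Set.Ioo 0 ω)) := by
    rw [halfStrip, Measure.volume_eq_prod, Measure.prod_restrict]
  have hzero : (fun p => D p - H p) =ᵐ[volume.restrict (halfStrip X ω)] 0 := by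
    have hdm := hDm.sub hHm
    refine hdm.ae_eq_mk.trans ?_
    have hmk := hdm.ae_eq_mk
    have hsm := hdm.stronglyMeasurable_mk
    set G := hdm.mk _ with hG
    have hmeas : MeasurableSet {p | G p = (0 : ℝ × ℝ → ℝ) p} :=
      hsm.measurable (measurableSet_singleton 0)
    rw [hprod] at hmk ⊢
    refine (Measure.ae_prod_iff_ae_ae hmeas).2 ?_
    have h1 := Measure.ae_ae_of_ae_prod hmk
    filter_upwards [h1, ae_restrict_mem measurableSet_Iio, ae_restrict_of_ae hD2,
      ae_restrict_of_ae (ae_all_iff.2 hb)] with x hx hxX hx2 hxb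
    have h2 := ae_eq_sine_series hω (hx2 hxX) (summable_exp_coeff hω hbound hxX) fun k => by
      rw [hxb k hxX]
      ring
    filter_upwards [hx, h2] with θ h3 h4
    rw [← h3]
    exact sub_eq_zero.2 h4
  filter_upwards [hzero] with p hp
  exact sub_eq_zero.1 hp

end

/-! ### Expansion of the Dirichlet solution in logarithmic coordinates -/

section

variable {X ω : ℝ} {A : Set ℂ} {f u : ℂ → ℝ} {q L : ℕ → ℝ × ℝ → ℝ}

/-- The pairings of a dominated series with products `η (x) sin (s θ)` are bounded by the `L¹` norm
of `η`, uniformly for supports in `x < X - 1`. -/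
theorem IsDominated.integral_le (h : IsDominated X ω q) (hω : 0 < ω) :
    ∃ C, 0 ≤ C ∧ ∀ s η, IsBump (X - 1) η →
      |∫ p in halfStrip X ω, (∑' N, q N p) * (η p.1 * Real.sin (s * p.2))|
        ≤ C * ∫ x, |η x| := by
  obtain ⟨K, hK⟩ := h.bounded (sub_one_lt X)
  refine ⟨|K| * ω, by positivity, fun s η hη => ?_⟩
  have hη' : IsBump X η := hη.mono (sub_one_lt X).le
  have hw : IsWeight X fun p => |η p.1| := by
    obtain ⟨a, b, -, hb, hz⟩ := hη'.supp
    have := hη.smooth.continuous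
    exact ⟨by fun_prop, a, b, hb, fun p hp => by simp [hz _ hp]⟩
  have hi : ∫ p in halfStrip X ω, |η p.1| = ω * ∫ x, |η x| := by
    have h1 : ∫ x in Set.Iio X, |η x| = ∫ x, |η x| :=
      setIntegral_eq_integral_of_forall_compl_eq_zero fun x hx => by
        rw [hη'.eq_zero (not_lt.1 hx), abs_zero]
    rw [setIntegral_halfStrip hw.integrableOn, ← h1, ← integral_const_mul]
    simp [hω.le]
  rw [mul_assoc, ← hi, ← integral_const_mul]
  refine norm_integral_le_of_norm_le (G := ℝ) (hw.integrableOn.const_mul _) ?_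
  filter_upwards [ae_restrict_mem (measurableSet_halfStrip X ω)] with p hp
  rw [norm_mul, norm_mul, Real.norm_eq_abs, Real.norm_eq_abs, Real.norm_eq_abs]
  by_cases hx : p.1 ≤ X - 1
  · have h1 := (hK p hp hx).trans (le_abs_self K)
    have h2 := Real.abs_sin_le_one (s * p.2)
    gcongr
    exact mul_le_of_le_one_right (abs_nonneg _) h2
  · rw [hη.eq_zero (not_le.1 hx).le]
    simp

/-- The sections of a square integrable function on the sector are square integrable. -/
theorem ae_memLp_section (hω' : ω < 2 * Real.pi)
    (hu : MemLp u 2 (volume.restrict (sector ω ∩ Metric.ball 0 (Real.exp X)))) :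
    ∀ᵐ x, x ∈ Set.Iio X →
      MemLp (fun θ => u (polarExp (x, θ))) 2 (volume.restrict (Set.Ioo 0 ω)) := by
  have hm : AEStronglyMeasurable (fun p => u (polarExp p)) (volume.restrict (halfStrip X ω)) :=
    hu.1.comp_quasiMeasurePreserving (quasiMeasurePreserving_polarExp hω')
  have hi : IntegrableOn (fun p => Real.exp (2 * p.1) * u (polarExp p) ^ 2) (halfStrip X ω) :=
    (integral_and_integrable_polarExp hω' _).2.1 hu.integrable_sq
  rw [IntegrableOn] at hi
  rw [halfStrip, Measure.volume_eq_prod, ← Measure.prod_restrict] at hm hi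
  rw [← ae_restrict_iff' measurableSet_Iio]
  filter_upwards [hi.prod_right_ae, hm.prodMk_left] with x h1 h2
  refine (memLp_two_iff_integrable_sq h2).2 ?_
  have := h1.const_mul (Real.exp (2 * x))⁻¹
  refine this.congr (ae_of_all _ fun θ => ?_)
  simp only
  rw [inv_mul_cancel_left₀ (Real.exp_pos _).ne']

/-- The difference of the Dirichlet solution and of a particular solution that vanishes on the
sides is the sum of its sine series, whose coefficients do not grow at the vertex. -/
theorem IsDirichletSolution.ae_eq_series (hω : 0 < ω) (hω' : ω < 2 * Real.pi) (hA : IsOpen A)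
    (hAS : A ⊆ sector ω) (hAX : sector ω ∩ Metric.ball 0 (Real.exp X) ⊆ A)
    (hf : MemLp f 2 (volume.restrict A)) (hu : IsDirichletSolution A f u)
    (hq : IsDominated X ω q) (hL : IsDominated X ω L) (hqL : ∀ N, HasLaplace (q N) (L N))
    (h0 : ∀ N x, q N (x, 0) = 0) (h1 : ∀ N x, q N (x, ω) = 0)
    (hfL : ∀ᵐ p ∂(volume.restrict (halfStrip X ω)),
      HasSum (fun N => L N p) (Real.exp (2 * p.1) * f (polarExp p))) :
    ∃ b : ℕ+ → ℝ, (∀ y < X, ∃ C, ∀ k : ℕ+, |b k| ≤ C * Real.exp (-(k * Real.pi / ω * y))) ∧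
      ∀ᵐ p ∂(volume.restrict (halfStrip X ω)), u (polarExp p) = (∑' N, q N p) + ∑' k : ℕ+,
        b k * Real.exp (k * Real.pi / ω * p.1) * Real.sin (k * Real.pi / ω * p.2) := by
  have hqc : ∀ N, Continuous (q N) := fun N => (hqL N).continuous.1
  have hLc : ∀ N, Continuous (L N) := fun N => (hqL N).continuous.2
  have hu2 : MemLp u 2 (volume.restrict (sector ω ∩ Metric.ball 0 (Real.exp X))) := by
    obtain ⟨g₁, g₂, hH, -⟩ := hu
    exact MemLp.truncated hAX hH.memLp
  set D : ℝ × ℝ → ℝ := fun p => u (polarExp p) - ∑' N, q N p with hDdef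
  have hD : ∀ κ, IsWeight X κ → IntegrableOn (fun p => D p * κ p) (halfStrip X ω) ∧
      ∫ p in halfStrip X ω, D p * κ p = (∫ p in halfStrip X ω, u (polarExp p) * κ p)
        - ∫ p in halfStrip X ω, (∑' N, q N p) * κ p := fun κ hκ => by
    have e1 := (hκ.integrableOn_mul hω' hu2).1
    have e2 := (hq.integral_mul hqc hκ).1
    simp only [hDdef, sub_mul]
    exact ⟨e1.sub e2, integral_sub e1 e2⟩
  have hode : ∀ s > 0, Real.sin (s * ω) = 0 → ∀ η, IsBump X η → ∫ p in halfStrip X ω,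
      D p * ((deriv (deriv η) p.1 - s ^ 2 * η p.1) * Real.sin (s * p.2)) = 0 := by
    intro s hs hsω η hη
    have hsin : Continuous fun θ => Real.sin (s * θ) := by fun_prop
    have hη2 : IsBump X fun x => deriv (deriv η) x - s ^ 2 * η x := by
      have := hη.deriv.deriv.add (hη.const_smul (-s ^ 2))
      convert this using 2 with x
      simp
      ring
    rw [(hD _ (hη2.isWeight hsin)).2, hu.weak_ode hω hω' hA hAS hAX hf hη hs hsω, sub_eq_zero]
    have e1 := (hq.integral_mul hqc (hη2.isWeight hsin)).2
    simp only [fun N => (hqL N).green hω (h0 N) (h1 N) hsω hη] at e1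
    have e2 := (hL.integral_mul hLc (hη.isWeight hsin)).2
    rw [e1.unique e2]
    refine integral_congr_ae ?_
    filter_upwards [hfL] with p hp
    rw [hp.tsum_eq]
    ring
  obtain ⟨K, hK0, hK⟩ := hq.integral_le hω
  have hs0 : ∀ k : ℕ+, 0 < (k : ℝ) * Real.pi / ω := fun k => by
    have := Real.pi_pos
    have : (0 : ℝ) < k := Nat.cast_pos.2 k.pos
    positivity
  have hsec : ∀ k : ℕ+, ∃ b, ∀ᵐ x, x ∈ Set.Iio X →
      ∫ θ in Set.Ioo 0 ω, D (x, θ) * Real.sin (k * Real.pi / ω * θ)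
        = b * Real.exp (k * Real.pi / ω * x) := by
    intro k
    have hsin : Continuous fun θ => Real.sin (k * Real.pi / ω * θ) := by fun_prop
    refine ae_section_eq_exp (hs0 k) (fun κ hκ => (hD κ hκ).1) (hode _ (hs0 k) ?_) ?_
    · rw [div_mul_cancel₀ _ hω.ne']
      exact Real.sin_nat_mul_pi k
    · obtain ⟨C, hC⟩ := hu.bounded_coeff hω hω' hAS hAX (hs0 k)
      refine ⟨|C| + K, fun η hη => ?_⟩
      have hη' : IsBump X η := hη.mono (sub_one_lt X).le
      rw [(hD _ (hη'.isWeight hsin)).2]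
      have i1 : 0 ≤ ∫ x, η x ^ 2 := integral_nonneg fun x => sq_nonneg _
      have i2 : 0 ≤ ∫ x, |η x| := integral_nonneg fun x => abs_nonneg _
      calc _ ≤ C * (1 + ∫ x, η x ^ 2) + K * ∫ x, |η x| :=
            (abs_sub _ _).trans (add_le_add (hC η hη') (hK _ η hη))
        _ ≤ |C| * (1 + (∫ x, η x ^ 2) + ∫ x, |η x|) + K * (1 + (∫ x, η x ^ 2) + ∫ x, |η x|) := by
            have := le_abs_self C
            refine add_le_add (mul_le_mul this (by linarith) (by linarith) (abs_nonneg _))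
              (mul_le_mul_of_nonneg_left (by linarith) hK0)
        _ = _ := by ring
  choose b hb using hsec
  have hD2 : ∀ᵐ x, x ∈ Set.Iio X →
      MemLp (fun θ => D (x, θ)) 2 (volume.restrict (Set.Ioo 0 ω)) := by
    filter_upwards [ae_memLp_section hω' hu2] with x hx hxX
    refine (hx hxX).sub ?_
    obtain ⟨K, hK⟩ := hq.bounded (show x < X from hxX)
    refine MemLp.of_bound (ContinuousOn.aestronglyMeasurable ?_ measurableSet_Ioo) K ?_
    · exact (hq.continuousOn hqc).comp (by fun_prop) fun θ hθ => ⟨hxX, hθ⟩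
    · filter_upwards [ae_restrict_mem measurableSet_Ioo] with θ hθ
      exact hK (x, θ) ⟨hxX, hθ⟩ le_rfl
  have hDm : AEStronglyMeasurable D (volume.restrict (halfStrip X ω)) :=
    (hu2.1.comp_quasiMeasurePreserving (quasiMeasurePreserving_polarExp hω')).sub
      ((hq.continuousOn hqc).aestronglyMeasurable (measurableSet_halfStrip X ω))
  obtain ⟨hbd, hae⟩ := ae_eq_sine_sum (b := fun k => 2 / ω * b k) hω hDm hD2 fun k => by
    filter_upwards [hb k] with x hx hxX
    rw [hx hxX]
    field_simp
  refine ⟨_, hbd, ?_⟩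
  filter_upwards [hae] with p hp
  rw [← hp, hDdef]
  ring

end

/-! ### Summation of the expansion -/

section

variable {X ω δ R C : ℝ}

theorem norm_pairZ_le_of_mem (hω : 0 < ω) (hω' : ω < 2 * Real.pi) (hδ : 0 < δ) (hδω : δ < ω / 2)
    (hδπ : δ < Real.pi / 2) (α : ℕ × ℕ) {p : ℝ × ℝ} (hp : p ∈ halfStrip X ω) :
    ‖pairZ ω δ α p‖ ≤ Real.exp (2 * ω) *
      Real.exp (2 * |p.1| + ((α.1 : ℝ) + α.2) * p.1) := by
  refine (norm_pairZ_le hω hδ hδω hδπ α hp.2.1.le (hp.2.2.trans hω')).trans ?_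
  rw [← Real.exp_add, ← Real.exp_add]
  refine Real.exp_le_exp.2 ?_
  have h1 := norm_logPoint_le p
  rw [abs_of_pos hp.2.1] at h1
  have h2 : p.2 < ω := hp.2.2
  linarith

theorem isDominated_pair (hω : 0 < ω) (hω' : ω < 2 * Real.pi) (hδ : 0 < δ) (hδω : δ < ω / 2)
    (hδπ : δ < Real.pi / 2) (hR : 0 < R) (hRX : R ≤ Real.exp (-X)) {a : ℕ × ℕ → ℂ}
    (ha : ∀ α, ‖a α‖ ≤ C * R ^ (α.1 + α.2)) {q : ℕ → ℝ × ℝ → ℝ}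
    (hq : ∀ N p, 0 ≤ p.2 → p.2 ≤ ω →
      q N p = (∑ α ∈ antidiagonal (N + 2), a α * pairZ ω δ α p).im) :
    IsDominated X ω q := by
  refine isDominated_of_le (K := C * R ^ 2 * Real.exp (2 * ω)) (m := 2) hR hRX fun N p hp => ?_
  rw [hq N p hp.2.1.le hp.2.2.le]
  refine (Complex.abs_im_le_norm _).trans ((norm_sum_le _ _).trans ?_)
  have h1 : ∀ α ∈ antidiagonal (N + 2), ‖a α * pairZ ω δ α p‖ ≤ C * R ^ (N + 2) *
      (Real.exp (2 * ω) * Real.exp (2 * |p.1| + (N + 2) * p.1)) := fun α hα => by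
    have h2 := ha α
    have h3 := norm_pairZ_le_of_mem hω hω' hδ hδω hδπ α hp
    have h4 := Finset.HasAntidiagonal.mem_antidiagonal.1 hα
    have h5 : (α.1 : ℝ) + α.2 = N + 2 := by exact_mod_cast h4
    rw [h4] at h2
    rw [h5] at h3
    rw [norm_mul]
    exact mul_le_mul h2 h3 (norm_nonneg _) ((norm_nonneg _).trans h2)
  refine (Finset.sum_le_sum h1).trans (le_of_eq ?_)
  rw [Finset.sum_const, Finset.Nat.card_antidiagonal, nsmul_eq_mul]
  push_cast
  ring

theorem isDominated_monom (hR : 0 < R) (hRX : R ≤ Real.exp (-X)) {F : ℕ × ℕ → ℂ}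
    (hF : ∀ α, ‖F α‖ ≤ C * R ^ (α.1 + α.2)) :
    IsDominated X ω fun N p => Real.exp (2 * p.1) *
      (∑ α ∈ antidiagonal N, F α * monom α.1 α.2 p).re := by
  refine isDominated_of_le (K := C) (m := 0) hR hRX fun N p _ => ?_
  have hC : 0 ≤ C := by simpa using (norm_nonneg _).trans (hF (0, 0))
  rw [abs_mul, abs_of_pos (Real.exp_pos _)]
  have h1 : ∀ α ∈ antidiagonal N, ‖F α * monom α.1 α.2 p‖ ≤ C * R ^ N * Real.exp (N * p.1) :=
    fun α hα => by
      have h2 := hF α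
      have h4 := Finset.HasAntidiagonal.mem_antidiagonal.1 hα
      have h5 : (α.1 : ℝ) + α.2 = N := by exact_mod_cast h4
      rw [h4] at h2
      rw [norm_mul, norm_monom, h5]
      gcongr
  have h2 := (Complex.abs_re_le_norm _).trans ((norm_sum_le _ _).trans (Finset.sum_le_sum h1))
  rw [Finset.sum_const, Finset.Nat.card_antidiagonal, nsmul_eq_mul] at h2
  calc _ ≤ Real.exp (2 * p.1) * (((N + 1 : ℕ) : ℝ) * (C * R ^ N * Real.exp (N * p.1))) := by
        gcongr
    _ = C * ((N + 1 + 0 : ℕ) * R ^ N * Real.exp (2 * p.1 + N * p.1)) := by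
        rw [Real.exp_add]
        push_cast
        ring
    _ ≤ _ := by
        have h3 : Real.exp (2 * p.1 + N * p.1) ≤ Real.exp (2 * |p.1| + (N + 2) * p.1) :=
          Real.exp_le_exp.2 (by
            have := neg_abs_le p.1
            have := abs_nonneg p.1
            cases abs_cases p.1 <;> linarith)
        gcongr

/-- Regrouping of the part of the expansion indexed by pairs into its homogeneous blocks. -/
theorem hasSum_pair (hω : 0 < ω) (hω' : ω < 2 * Real.pi) (hδ : 0 < δ) (hδω : δ < ω / 2)
    (hδπ : δ < Real.pi / 2) (hR : 0 < R) (hRX : R ≤ Real.exp (-X)) {a : ℕ × ℕ → ℂ}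
    (ha : ∀ α, ‖a α‖ ≤ C * R ^ (α.1 + α.2)) (ha0 : ∀ α, α.1 + α.2 < 2 → a α = 0)
    {q : ℕ → ℝ × ℝ → ℝ} (hq : ∀ N p, 0 ≤ p.2 → p.2 ≤ ω →
      q N p = (∑ α ∈ antidiagonal (N + 2), a α * pairZ ω δ α p).im)
    {p : ℝ × ℝ} (hp : p ∈ halfStrip X ω) :
    ∃ s : ℂ, HasSum (fun α : {α : ℕ × ℕ // α ≠ (0, 0)} => a α * Z ω δ (.inl α) (polarExp p)) s ∧
      s.im = ∑' N, q N p := by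
  have hx : R * Real.exp p.1 < 1 := by
    calc R * Real.exp p.1 ≤ Real.exp (-X) * Real.exp p.1 := by gcongr
      _ = Real.exp (p.1 - X) := by rw [← Real.exp_add]; congr 1; ring
      _ < 1 := Real.exp_lt_one_iff.2 (by linarith [show p.1 < X from hp.1])
  have hgeo := summable_geometric_of_lt_one (by positivity) hx
  have hs : Summable fun α : ℕ × ℕ => a α * pairZ ω δ α p := by
    have hg := (hgeo.mul_of_nonneg hgeo (fun n => by positivity) fun n => by positivity).mul_left
      (C * Real.exp (2 * ω) * Real.exp (2 * |p.1|))
    refine Summable.of_norm_bounded hg fun α => ?_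
    rw [norm_mul]
    refine (mul_le_mul (ha α) (norm_pairZ_le_of_mem hω hω' hδ hδω hδπ α hp) (norm_nonneg _)
      ((norm_nonneg _).trans (ha α))).trans (le_of_eq ?_)
    rw [Real.exp_add, add_mul, Real.exp_add, Real.exp_nat_mul, Real.exp_nat_mul]
    ring
  obtain ⟨s, hs⟩ := hs
  refine ⟨s, ?_, ?_⟩
  · have h1 := (hasSum_subtype_iff_of_support_subset (s := {α : ℕ × ℕ | α ≠ (0, 0)}) ?_).2 hs
    · refine h1.congr_fun fun α => ?_
      have : pairZ ω δ α p = Z ω δ (.inl α) (polarExp p) :=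
        dif_pos (show (α : ℕ × ℕ) ≠ (0, 0) from α.2)
      rw [Function.comp_apply, this]
    · intro α hα h0
      rw [h0] at hα
      exact hα (by simp [ha0])
  · have h1 := (Finset.HasAntidiagonal.sigmaAntidiagonalEquivProd.hasSum_iff.2 hs).sigma
      (fun n => hasSum_fintype _)
    have h2 : HasSum (fun n => ∑ α ∈ antidiagonal n, a α * pairZ ω δ α p) s := by
      convert h1 using 1
      funext n
      rw [Finset.univ_eq_attach]
      exact (Finset.sum_attach (antidiagonal n) (fun α => a α * pairZ ω δ α p)).symm
    have h3 := (hasSum_nat_add_iff' 2).2 h2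
    have h4 : ∑ n ∈ Finset.range 2, ∑ α ∈ antidiagonal n, a α * pairZ ω δ α p = 0 :=
      Finset.sum_eq_zero fun n hn => Finset.sum_eq_zero fun α hα => by
        rw [ha0 α, zero_mul]
        rw [Finset.HasAntidiagonal.mem_antidiagonal.1 hα]
        exact Finset.mem_range.1 hn
    rw [h4, sub_zero] at h3
    have h5 := Complex.imCLM.hasSum h3
    rw [← Complex.imCLM_apply, ← h5.tsum_eq]
    exact tsum_congr fun N => (hq N p hp.2.1.le hp.2.2.le).symm

/-- The part of the expansion indexed by the exponents `k π / ω`. -/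
theorem hasSum_sine (hω : 0 < ω) (hω' : ω < 2 * Real.pi) {b : ℕ+ → ℝ}
    (hb : ∀ y < X, ∃ C, ∀ k : ℕ+, |b k| ≤ C * Real.exp (-(k * Real.pi / ω * y)))
    {p : ℝ × ℝ} (hp : p ∈ halfStrip X ω) :
    ∃ s : ℂ, HasSum (fun k : ℕ+ => (b k : ℂ) * Z ω δ (.inr k) (polarExp p)) s ∧
      s.im = ∑' k : ℕ+,
        b k * Real.exp (k * Real.pi / ω * p.1) * Real.sin (k * Real.pi / ω * p.2) := by
  have hs : Summable fun k : ℕ+ => (b k : ℂ) * Z ω δ (.inr k) (polarExp p) := by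
    refine Summable.of_norm_bounded (summable_exp_coeff hω hb hp.1) fun k => le_of_eq ?_
    rw [norm_mul, Z_inr_polarExp k hp.2.1.le (hp.2.2.trans hω'), norm_monom, Complex.norm_real,
      abs_mul, abs_of_pos (Real.exp_pos _), Real.norm_eq_abs, add_zero]
  obtain ⟨s, hs⟩ := hs
  refine ⟨s, hs, ?_⟩
  have h5 := Complex.imCLM.hasSum hs
  rw [← Complex.imCLM_apply, ← h5.tsum_eq]
  refine tsum_congr fun k => ?_
  rw [Complex.imCLM_apply, Z_inr_polarExp k hp.2.1.le (hp.2.2.trans hω'), Complex.im_ofReal_mul]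
  have := monom_im (k * Real.pi / ω) 0 p.1 p.2
  rw [Prod.mk.eta] at this
  rw [this]
  simp [mul_assoc]

end

end CornerSeries

end

theorem theorem1p2
    (ω : ℝ) (hω : 0 < ω) (hω' : ω < 2 * Real.pi)
    (δ : ℝ) (hδ : 0 < δ) (hδ' : δ < min ω Real.pi / 2)
    (A : Set ℂ) (hA : IsOpen A) (hAb : Bornology.IsBounded A) (hAS : A ⊆ sector ω)
    (ρ₀ : ℝ) (hρ₀ : 0 < ρ₀)
    (hA₀ : Metric.ball 0 ρ₀ ∩ A = Metric.ball 0 ρ₀ ∩ sector ω)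
    (f : ℂ → ℝ) (hf : MemLp f 2 (volume.restrict A))
    (Mf : ℝ) (hMf : 0 < Mf) (hfan : IsAnalyticAtVertex A f Mf)
    (u₀ : ℂ → ℝ) (hu₀ : IsDirichletSolution A f u₀)
    (M₁ : ℝ) (hM₁ : Mf < M₁) (ρ₁ : ℝ) (hρ₁ : ρ₁ = min ρ₀ M₁⁻¹) :
    ∃ a : Index → ℂ,
      (∃ v : ℂ → ℝ, ContinuousOn v (A ∩ Metric.ball 0 ρ₁) ∧
        u₀ =ᵐ[volume.restrict (A ∩ Metric.ball 0 ρ₁)] v ∧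
        ∀ t ∈ A ∩ Metric.ball 0 ρ₁,
          ∃ s : ℂ, HasSum (fun γ : Index => a γ * Z ω δ γ t) s ∧ v t = s.im) ∧
      (∀ M : ℝ, ρ₁⁻¹ < M → ∃ C : ℝ, ∀ γ : Index, ‖a γ‖ ≤ C * M ^ size ω γ) ∧
      (∀ k : ℕ+, (a (Sum.inr k)).im = 0) ∧
      (∀ α : {α : ℕ × ℕ // α ≠ (0, 0)}, α.1.2 = 0 → (a (Sum.inl α)).im = 0) := by
  have hδω : δ < ω / 2 := hδ'.trans_le (by gcongr; exact min_le_left _ _)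
  have hδπ : δ < Real.pi / 2 := hδ'.trans_le (by gcongr; exact min_le_right _ _)
  have hM₁0 : 0 < M₁ := hMf.trans hM₁
  have hρ₁0 : 0 < ρ₁ := by rw [hρ₁]; positivity
  set X := Real.log ρ₁ with hX
  have heX : Real.exp X = ρ₁ := Real.exp_log hρ₁0
  have hM₁ρ : M₁ ≤ ρ₁⁻¹ := by
    rw [le_inv_comm₀ hM₁0 hρ₁0, hρ₁]
    exact min_le_right _ _
  have hM₁X : M₁ ≤ Real.exp (-X) := by rwa [Real.exp_neg, heX]
  have hAeq : A ∩ Metric.ball 0 ρ₁ = sector ω ∩ Metric.ball 0 (Real.exp X) := by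
    rw [heX]
    have hsub : Metric.ball (0 : ℂ) ρ₁ ⊆ Metric.ball 0 ρ₀ :=
      Metric.ball_subset_ball (by rw [hρ₁]; exact min_le_left _ _)
    refine Set.Subset.antisymm (Set.inter_subset_inter_left _ hAS) fun t ht => ⟨?_, ht.2⟩
    exact (hA₀.ge ⟨hsub ht.2, ht.1⟩).2
  have hAX : sector ω ∩ Metric.ball 0 (Real.exp X) ⊆ A := hAeq ▸ Set.inter_subset_left
  obtain ⟨c, C, hc, hfc⟩ := hfan
  -- an intermediate radius absorbs the polynomial losses of the two conversions
  obtain ⟨R, hMfR, hRM₁⟩ := exists_between hM₁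
  have hR : 0 < R := hMf.trans hMfR
  obtain ⟨F, C₁, hC₁, hF, hFs⟩ := exists_complex_coefficients hMf hMfR hc
  obtain ⟨a, ⟨C₂, hC₂, ha⟩, hareal, ha0, q, hq, hq0, hqω, hqL⟩ :=
    exists_pair_coefficients hω hω' hδ hδω hδπ hC₁ hR hRM₁ hF
  have hqd := isDominated_pair hω hω' hδ hδω hδπ hM₁0 hM₁X ha hq
  have hLd : IsDominated X ω _ := isDominated_monom hR (hRM₁.le.trans hM₁X) hF
  have hfL : ∀ᵐ p ∂(volume.restrict (halfStrip X ω)), HasSum (fun N => Real.exp (2 * p.1) *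
      (∑ α ∈ Finset.HasAntidiagonal.antidiagonal N, F α * monom α.1 α.2 p).re)
      (Real.exp (2 * p.1) * f (polarExp p)) := by
    have h1 : ∀ᵐ t ∂(volume.restrict (sector ω ∩ Metric.ball 0 (Real.exp X))),
        HasSum (fun α : ℕ × ℕ => c α * t.re ^ α.1 * t.im ^ α.2) (f t) := by
      refine ae_restrict_of_ae_restrict_of_subset ?_ hfc
      rw [← hAeq]
      refine Set.inter_subset_inter_right _ (Metric.ball_subset_ball ?_)
      rw [le_inv_comm₀ hρ₁0 hMf]
      exact hM₁.le.trans hM₁ρ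
    filter_upwards [(quasiMeasurePreserving_polarExp hω').ae h1] with p hp
    have h2 := (hFs _ _ hp).mul_left (Real.exp (2 * p.1))
    simpa only [polarExp_pow] using h2
  obtain ⟨b, hb, hae⟩ := hu₀.ae_eq_series hω hω' hA hAS hAX hf hqd hLd hqL hq0 hqω hfL
  have hsd := isDominated_sine hω hb
  refine ⟨Sum.elim (fun α => a α) fun k => (b k : ℂ), ?_, ?_, ?_, ?_⟩
  · refine ⟨fun t => (∑' N, q N (polarLog t)) + ∑' k : ℕ+, b k *
      Real.exp (k * Real.pi / ω * (polarLog t).1) * Real.sin (k * Real.pi / ω * (polarLog t).2),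
      ?_, ?_, ?_⟩
    · rw [hAeq]
      have h1 := (hqd.continuousOn fun N => (hqL N).continuous.1).add
        (hsd.continuousOn fun k => by fun_prop)
      exact h1.comp ((continuousOn_polarLog ω).mono Set.inter_subset_left)
        fun t ht => polarLog_mem_halfStrip ht
    · rw [hAeq]
      filter_upwards [ae_polarLog hae, ae_restrict_mem (measurableSet_truncated X ω)] with t ht hts
      rw [polarExp_polarLog (ne_zero_of_mem_sector hts.1)] at ht
      exact ht
    · intro t ht
      rw [hAeq] at ht
      have hp := polarLog_mem_halfStrip ht
      obtain ⟨s₁, hs₁, hi₁⟩ := hasSum_pair hω hω' hδ hδω hδπ hM₁0 hM₁X ha ha0 hq hp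
      obtain ⟨s₂, hs₂, hi₂⟩ := hasSum_sine (δ := δ) hω hω' hb hp
      rw [polarExp_polarLog (ne_zero_of_mem_sector ht.1)] at hs₁ hs₂
      exact ⟨s₁ + s₂, HasSum.sum hs₁ hs₂, by rw [Complex.add_im, hi₁, hi₂]⟩
  · intro M hM
    have hM0 : 0 < M := (inv_pos.2 hρ₁0).trans hM
    have hlog : -Real.log M < X := by
      rw [neg_lt, ← Real.log_inv]
      exact Real.log_lt_log (inv_pos.2 hρ₁0) hM
    obtain ⟨C₃, hC₃⟩ := hb _ hlog
    refine ⟨max C₂ C₃, ?_⟩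
    rintro (α | k)
    · have h1 : size ω (.inl α) = ((α.1.1 + α.1.2 : ℕ) : ℝ) := by simp [size]
      rw [h1, Real.rpow_natCast]
      refine (ha α).trans ?_
      have h2 : M₁ ≤ M := hM₁ρ.trans hM.le
      gcongr
      exact le_max_left _ _
    · have h1 : M ^ size ω (.inr k) = Real.exp (-(k * Real.pi / ω * -Real.log M)) := by
        rw [Real.rpow_def_of_pos hM0, size]
        congr 1
        ring
      rw [h1, Sum.elim_inr, Complex.norm_real, Real.norm_eq_abs]
      refine (hC₃ k).trans ?_
      gcongr
      exact le_max_right _ _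
  · intro k
    simp
  · rintro ⟨⟨ℓ, m⟩, hα⟩ h0
    simp only at h0
    subst h0
    exact hareal ℓ
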